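/- Let $(I^{\rm ex}_k)_{k\ge1}$ be an infinite exchangeable interval partition of $[0,1]$: random disjoint open subintervals of $[0,1]$, listed in non-increasing order of length, almost surely of strictly positive lengths with sum $1$, such that for each $n$ the left-to-right ordering of the $n$ longest intervals $I^{\rm ex}_1,\dots,I^{\rm ex}_n$ is equally likely to be any one of the $n!$ possible orderings, independently of the lengths of these $n$ intervals. Let $\bar L^0_u$ $(0\le u\le 1)$ be its normalized local time, that is, the limit as $n\to\infty$ of the fraction of the $n$ longest intervals which lie to the left of $u$; almost surely this limit exists for all $u\in[0,1]$ and is continuous in $u$. Let $U_1,U_2,\dots$ be independent uniform $(0,1)$ variables, independent of the partition. The $D$-partition consists of the intervals $I^D_j=[D_{V_{j-1}},D_{V_j}]$, $j\ge1$, where $D_{V_0}=0$, $V_j=D_{V_{j-1}}+U_j(1-D_{V_{j-1}})$ and $D_{V_j}=\inf\{t\in[V_j,1]: t\notin\bigcup_k I^{\rm ex}_k\}$. The $T$-partition consists of the intervals $I^T_j=[T_{j-1},T_j]$, $j\ge 1$, where $T_0=0$ and $T_j=\inf\{u\in[0,1]:\bar L^0_u>1-\prod_{i=1}^j(1-U_i)\}$.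 Almost surely both sequences of division points increase strictly to $1$. For $I=[g,d]$ write $\lambda_I=d-g$ and $\bar L^0_I=\bar L^0_d-\bar L^0_g$, and let $(I^D_{(j)})$ and $(I^T_{(j)})$ be the $D$- and $T$-partitions listed in decreasing order of length (equal lengths, if any, in decreasing order of $\bar L^0_I$). Then: (i) the bivariate sequences $(\lambda_{I_j},\bar L^0_{I_j})_{j\ge1}$ for $(I_j)=(I^D_{(j)})$ and for $(I_j)=(I^T_{(j)})$ have the same distribution; (ii) the bivariate sequence for $(I^D_j)$ is that for $(I^D_{(j)})$ in length-biased order: for all $n$ and distinct $k_1,\dots,k_n$, the conditional probability of the event $\{I^D_1=I^D_{(k_1)},\dots,I^D_n=I^D_{(k_n)}\}$, given the whole bivariate sequence for $(I^D_{(j)})$, is $\prod_{i=1}^n w_{k_i}/\bigl(\sum_j w_j-\sum_{l<i}w_{k_l}\bigr)$ with $w_j=\lambda_{I^D_{(j)}}$; (iii) the bivariate sequence for $(I^T_j)$ is that for $(I^T_{(j)})$ in $\bar L^0$-biased order, in the same sense with $T$ instead of $D$ and $w_j=\bar L^0_{I^T_{(j)}}$; (iv) the sequence $(\bar L^0_{I_j})_{j\ge1}$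 has the same distribution for $(I^D_j)$ as for $(I^T_j)$, whereas the sequence $(\lambda_{I_j})_{j\ge1}$ does not. Moreover, the common distribution of the sequences in the first part of (iv) is $GEM(1)$, the distribution of $\bigl(W_j\prod_{i<j}(1-W_i)\bigr)_{j\ge1}$ for independent beta$(1,1)$ variables $W_i$. -/

import Mathlib

open MeasureTheory ProbabilityTheory Filter Topology Set
open scoped ENNReal Nat

noncomputable section

namespace ExchPart

/-- `(a k, b k)`, `k = 0, 1, 2, …`, is an infinite exchangeable interval partition of `[0,1]`,
listed in length-ranked order: almost surely the intervals are disjoint, of strictly positive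
nonincreasing lengths with sum `1`, and for each `n` the left-to-right ordering of the `n` longest
intervals is equally likely to be any one of the `n!` possible orderings, independently of the
lengths of these `n` intervals. If the lengths are almost surely distinct, the length-ranked listing
is unique; equal lengths are allowed. -/
structure IsInfiniteExchangeable {Ω : Type*} [MeasurableSpace Ω] (μ : Measure Ω)
    (a b : ℕ → Ω → ℝ) : Prop where
  measurable_left : ∀ k, Measurable (a k)
  measurable_right : ∀ k, Measurable (b k)
  subset_unit : ∀ᵐ ω ∂μ, ∀ k, 0 ≤ a k ω ∧ a k ω < b k ω ∧ b k ω ≤ 1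
  disjoint : ∀ᵐ ω ∂μ, Pairwise fun k l => Disjoint (Ioo (a k ω) (b k ω)) (Ioo (a l ω) (b l ω))
  ranked : ∀ᵐ ω ∂μ, Antitone fun k => b k ω - a k ω
  total : ∀ᵐ ω ∂μ, HasSum (fun k => b k ω - a k ω) 1
  exchangeable : ∀ (n : ℕ) (σ : Equiv.Perm (Fin n)) (B : Set (Fin n → ℝ)), MeasurableSet B →
    μ ({ω | StrictMono fun i : Fin n => a (σ i) ω} ∩ {ω | (fun i : Fin n => b i ω - a i ω) ∈ B})
      = ((n ! : ℕ) : ℝ≥0∞)⁻¹ * μ {ω | (fun i : Fin n => b i ω - a i ω) ∈ B}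

/-- The fraction of the first `n` (the `n` longest) intervals which lie to the left of `u`. -/
def fracLeft (b : ℕ → ℝ) (u : ℝ) (n : ℕ) : ℝ :=
  (((Finset.range n).filter fun k => b k ≤ u).card : ℝ) / n

/-- The normalized local time at `u`: the limit as `n → ∞` of the fraction of the `n` longest
intervals which lie to the left of `u` (an upper limit, so that it is defined for every
realization). -/
def localTime (b : ℕ → ℝ) (u : ℝ) : ℝ := limsup (fun n => fracLeft b u n) atTop

/-- The first point of `[0,1]` at or after `v` which is in none of the open intervals. -/
def nextPoint (a b : ℕ → ℝ) (v : ℝ) : ℝ :=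
  sInf {t | v ≤ t ∧ t ≤ 1 ∧ t ∉ ⋃ k, Ioo (a k) (b k)}

/-- The division points `0 = D_{V_0}, D_{V_1}, D_{V_2}, …` of the `D`-partition, where
`V_{j+1} = D_{V_j} + U_{j+1} (1 - D_{V_j})`; the uniform variables `U_1, U_2, …` are
`U 0, U 1, …`. -/
def dPoint (a b U : ℕ → ℝ) : ℕ → ℝ
  | 0 => 0
  | j + 1 => nextPoint a b (dPoint a b U j + U j * (1 - dPoint a b U j))

/-- The levels `1 - ∏_{i ≤ j} (1 - U_i)`. -/
def tLevel (U : ℕ → ℝ) (j : ℕ) : ℝ := 1 - ∏ i ∈ Finset.range j, (1 - U i)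

/-- The division points `0 = T_0, T_1, T_2, …` of the `T`-partition. -/
def tPoint (b U : ℕ → ℝ) : ℕ → ℝ
  | 0 => 0
  | j + 1 => sInf {u | 0 ≤ u ∧ u ≤ 1 ∧ tLevel U (j + 1) < localTime b u}

/-- The bivariate sequence of lengths and normalized local times of the intervals
`[c j, c (j+1)]`. -/
def biSeq (b c : ℕ → ℝ) (j : ℕ) : ℝ × ℝ :=
  (c (j + 1) - c j, localTime b (c (j + 1)) - localTime b (c j))

/-- The bivariate sequence of the `D`-partition. -/
def dSeq (a b U : ℕ → ℝ) : ℕ → ℝ × ℝ := biSeq b (dPoint a b U)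

/-- The bivariate sequence of the `T`-partition. -/
def tSeq (b U : ℕ → ℝ) : ℕ → ℝ × ℝ := biSeq b (tPoint b U)

/-- Interval number `k` comes before interval number `i` in length-ranked order: it is longer.
Intervals of the same length, if any, are listed in decreasing order of local time, and those with
the same length and local time in their given order. -/
def Precedes (x : ℕ → ℝ × ℝ) (k i : ℕ) : Prop :=
  (x i).1 < (x k).1 ∨ ((x i).1 = (x k).1 ∧
    ((x i).2 < (x k).2 ∨ ((x i).2 = (x k).2 ∧ k < i)))

/-- The position (starting from `0`) of interval number `i` in the length-ranked list. -/
def rankOf (x : ℕ → ℝ × ℝ) (i : ℕ) : ℕ := {k | Precedes x k i}.ncard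

/-- The length-ranked sequence. -/
def ranked (x : ℕ → ℝ × ℝ) (j : ℕ) : ℝ × ℝ := x (sInf {i | rankOf x i = j})

/-- The conditional probability, given the ranked sequence `r`, that the first `n` terms of the
`w`-biased rearrangement of `r` are those with (distinct) ranks `k 0, …, k (n-1)`:
the product of the factors
`w (r (k i)) / (∑ of all weights - w (r (k 0)) - … - w (r (k (i-1))))`. -/
def biasedProb (w : ℝ × ℝ → ℝ) (r : ℕ → ℝ × ℝ) {n : ℕ} (k : Fin n → ℕ) : ℝ :=
  ∏ i, w (r (k i)) / ((∑' j, w (r j)) - ∑ l ∈ Finset.Iio i, w (r (k l)))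

/-- The random sequence `X` is its length-ranked sequence `ranked X` in a `w`-biased order: for all
`n` and all distinct `k 0, …, k (n-1)`, the conditional probability given `ranked X` that, for all
`i < n`, term number `i` of `X` has rank `k i`, is `biasedProb w (ranked X) k`. -/
def InBiasedOrder {Ω : Type*} [MeasurableSpace Ω] (μ : Measure Ω) (w : ℝ × ℝ → ℝ)
    (X : Ω → ℕ → ℝ × ℝ) : Prop :=
  ∀ (n : ℕ) (k : Fin n → ℕ), Function.Injective k →
    ∀ B : Set (ℕ → ℝ × ℝ), MeasurableSet B →
      μ ({ω | ∀ i : Fin n, rankOf (X ω) i = k i} ∩ {ω | ranked (X ω) ∈ B})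
        = ∫⁻ ω in {ω | ranked (X ω) ∈ B}, ENNReal.ofReal (biasedProb w (ranked (X ω)) k) ∂μ

/-- The `GEM(θ)` distribution: the law of `W_j ∏_{i<j} (1 - W_i)`, `j = 0, 1, …`, for independent
beta`(1,θ)` variables `W_i`. -/
def gem (θ : ℝ) : Measure (ℕ → ℝ) :=
  (Measure.infinitePi fun _ : ℕ => betaMeasure 1 θ).map
    fun W j => W j * ∏ i ∈ Finset.range j, (1 - W i)

end ExchPart

end

open ExchPart

/-! Let L_k be the length of the k-th longest interval and X_k the local time at it. Exchangeability
makes the X_k independent uniform variables, independent of all the lengths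
(`ExchOrder.map_levels`). With F(t) = ∑_{X_k ≤ t} L_k (`cdfOf`), interval k is the jump of F at X_k,
and the local time inverts F (`Config`). Both partitions are therefore images under F of random
points on the local time scale. The T-points are F at the division points of uniform stick-breaking
(`Config.tPoint_eq`). After the D-point F(s), the next D-point is F(X_k), where atom k is picked
among the atoms beyond s with probability proportional to L_k (`Config.dPoint_eq`,
`lintegral_dStep`).

The two are compared through the measure ∏ dp_i / p_i on {∑ p_i < 1} (`nu`). By the Palm formula for
stick-breaking (`palm_formula`) and exchangeability of the increments of F (`lintegral_incs_eq`),
the expected sum of f over r-tuples of distinct T-intervals is the integral of E f, evaluated on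
adjacent intervals of local times p_i (`lintegral_injSum_tLevel`). For the first r D-intervals one
gets the same integral with an extra factor, the probability of a length-biased order
(`lintegral_dChain`). The reason is that an atom in (s,t] can be moved to t without affecting
anything beyond t, so that E ∑_{X_k > s} L_k H(X_k, X) = ∫ E[(F(t) - F(s)) H(t, X)] dt / (t - s) for
such H (`lintegral_tsum_GT`). Hence the D-sequence has the law of a length-biased sample without
replacement from the T-sequence (`dChain_biased`), while the T-sequence has the law of a
local-time-biased sample from itself (`tLevel_biased`).

Since the sampled weights sum to 1, such a sample almost surely uses every term. It is thus a
permutation, which leaves the ranked sequence unchanged and has the stated conditional probabilities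
(`map_ranked_eq`, `biased_of_lintegral_eq`); this gives (i)-(iii). For (iv), averaging the
length-biased factor over X turns it into the local-time-biased one (`lintegral_qfst_mul`), so the
D-local times are GEM(1) like the T-local times. The mean first lengths differ: given L, the mean is
∫ p dp for T and ∫ E[F(p)²] dp / p for D, with E[F(p)²] ≥ p (p + (1 - p) L_0²). -/

noncomputable section

namespace ExchPart

/-! ### Sequences of independent uniform variables. -/

section

/-- The uniform distribution on `(0,1)`. -/
def unif : Measure ℝ := volume.restrict (Ioo (0 : ℝ) 1)

instance : IsProbabilityMeasure unif := ⟨by simp [unif]⟩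

/-- The law of a sequence of independent uniform variables. -/
def unifSeq : Measure (ℕ → ℝ) := Measure.infinitePi fun _ => unif

instance : IsProbabilityMeasure unifSeq := by unfold unifSeq; infer_instance

/-- Prepend a term to a sequence. -/
def seqCons {α : Type*} (x : α) (y : ℕ → α) : ℕ → α
  | 0 => x
  | n + 1 => y n

@[simp] lemma seqCons_zero {α : Type*} (x : α) (y : ℕ → α) : seqCons x y 0 = x := rfl

@[simp] lemma seqCons_succ {α : Type*} (x : α) (y : ℕ → α) (n : ℕ) :
    seqCons x y (n + 1) = y n := rfl

@[fun_prop]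
lemma measurable_seqCons {α β : Type*} [MeasurableSpace α] [MeasurableSpace β] {f : β → α}
    {g : β → ℕ → α} (hf : Measurable f) (hg : Measurable g) :
    Measurable fun z => seqCons (f z) (g z) := by
  refine measurable_pi_iff.2 fun n => ?_
  cases n with
  | zero => exact hf
  | succ n => exact (measurable_pi_apply n).comp hg

@[fun_prop]
lemma measurable_finCons {α β : Type*} [MeasurableSpace α] [MeasurableSpace β] {r : ℕ} {f : β → α}
    {g : β → Fin r → α} (hf : Measurable f) (hg : Measurable g) :
    Measurable fun z => (Fin.cons (f z) (g z) : Fin (r + 1) → α) := by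
  refine measurable_pi_iff.2 fun n => ?_
  refine Fin.cases ?_ (fun n => ?_) n
  · exact hf
  · simpa [Function.comp_def] using (measurable_pi_apply n).comp hg

lemma map_seqCons_unifSeq : (unif.prod unifSeq).map (fun z => seqCons z.1 z.2) = unifSeq := by
  refine Measure.eq_infinitePi _ fun s t ht => ?_
  classical
  set t' : ℕ → Set ℝ := fun i => if i ∈ s then t i else univ with ht'
  have ht'm : ∀ i, MeasurableSet (t' i) := fun i => by
    simp only [ht']; split_ifs <;> simp [ht]
  obtain ⟨N, hN⟩ : ∃ N, s ⊆ Finset.range (N + 1) :=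
    ⟨s.sup id, fun i hi => Finset.mem_range.2 (Nat.lt_succ_of_le (Finset.le_sup (f := id) hi))⟩
  have hpi : (s : Set ℕ).pi t = (Finset.range (N + 1) : Set ℕ).pi t' := by
    ext x
    simp only [Set.mem_pi, Finset.mem_coe, ht']
    constructor
    · intro h i _
      split_ifs with hi
      · exact h i hi
      · trivial
    · intro h i hi
      simpa [hi] using h i (hN hi)
  have hprod : ∏ i ∈ s, unif (t i) = ∏ i ∈ Finset.range (N + 1), unif (t' i) := by
    rw [← Finset.prod_subset hN]
    · exact Finset.prod_congr rfl fun i hi => by simp [ht', hi]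
    · intro i _ hi
      simp [ht', hi]
  rw [hprod, hpi, Measure.map_apply (by fun_prop)
    (MeasurableSet.pi (Finset.countable_toSet _) fun i _ => ht'm i)]
  have : (fun z : ℝ × (ℕ → ℝ) => seqCons z.1 z.2) ⁻¹' (Finset.range (N + 1) : Set ℕ).pi t'
      = t' 0 ×ˢ (Finset.range N : Set ℕ).pi (fun i => t' (i + 1)) := by
    ext z
    simp only [Set.mem_preimage, Set.mem_pi, Finset.mem_coe, Finset.mem_range, Set.mem_prod]
    constructor
    · intro h
      exact ⟨h 0 (by omega), fun i hi => h (i + 1) (by omega)⟩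
    · rintro ⟨h0, h⟩ i hi
      cases i with
      | zero => exact h0
      | succ i => exact h i (by omega)
  rw [this, Measure.prod_prod, unifSeq, Measure.infinitePi_pi _ (fun i _ => ht'm _),
    Finset.prod_range_succ' (fun i => unif (t' i)), mul_comm]

/-- Resampling one coordinate leaves the product law unchanged. This is how one coordinate is
integrated out with the others fixed. -/
lemma map_update_unifSeq (k : ℕ) :
    (unifSeq.prod unif).map (fun z => Function.update z.1 k z.2) = unifSeq := by
  refine Measure.eq_infinitePi _ fun s t ht => ?_
  classical
  have hm : Measurable fun z : (ℕ → ℝ) × ℝ => Function.update z.1 k z.2 := by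
    refine measurable_pi_iff.2 fun n => ?_
    rcases eq_or_ne n k with rfl | h
    · simpa using measurable_snd
    · simpa [Function.update_of_ne h, Function.comp_def] using (measurable_pi_apply n).comp measurable_fst
  rw [Measure.map_apply hm (MeasurableSet.pi (Finset.countable_toSet _) fun i _ => ht i)]
  have : (fun z : (ℕ → ℝ) × ℝ => Function.update z.1 k z.2) ⁻¹' (s : Set ℕ).pi t
      = (s.erase k : Set ℕ).pi t ×ˢ (if k ∈ s then t k else univ) := by
    ext z
    simp only [Set.mem_preimage, Set.mem_pi, Finset.mem_coe, Set.mem_prod, Finset.mem_erase]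
    constructor
    · intro h
      refine ⟨fun i hi => by simpa [Function.update_of_ne hi.1] using h i hi.2, ?_⟩
      split_ifs with hk
      · simpa using h k hk
      · trivial
    · rintro ⟨h, h'⟩ i hi
      rcases eq_or_ne i k with rfl | hik
      · simpa [hi] using h'
      · simpa [Function.update_of_ne hik] using h i ⟨hik, hi⟩
  rw [this, Measure.prod_prod, unifSeq, Measure.infinitePi_pi _ (fun i _ => ht i)]
  by_cases hk : k ∈ s
  · simp only [hk, if_true]
    exact Finset.prod_erase_mul s (fun i => unif (t i)) hk
  · simp [hk]

lemma lintegral_unifSeq_cons {G : (ℕ → ℝ) → ℝ≥0∞} (hG : Measurable G) :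
    ∫⁻ U, G U ∂unifSeq = ∫⁻ u, ∫⁻ U, G (seqCons u U) ∂unifSeq ∂unif := by
  conv_lhs => rw [← map_seqCons_unifSeq]
  rw [lintegral_map hG (by fun_prop), lintegral_prod]
  exact (hG.comp (by fun_prop)).aemeasurable

@[fun_prop]
lemma measurable_update_uncurry {β : Type*} [MeasurableSpace β] {f : β → ℕ → ℝ} {g : β → ℝ} (k : ℕ)
    (hf : Measurable f) (hg : Measurable g) :
    Measurable fun z => Function.update (f z) k (g z) := by
  refine measurable_pi_iff.2 fun n => ?_
  rcases eq_or_ne n k with rfl | h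
  · simpa using hg
  · simpa [Function.update_of_ne h, Function.comp_def] using (measurable_pi_apply n).comp hf

lemma lintegral_unifSeq_update (k : ℕ) {G : (ℕ → ℝ) → ℝ≥0∞} (hG : Measurable G) :
    ∫⁻ X, G X ∂unifSeq = ∫⁻ X, ∫⁻ x, G (Function.update X k x) ∂unif ∂unifSeq := by
  conv_lhs => rw [← map_update_unifSeq k]
  rw [lintegral_map hG (by fun_prop), lintegral_prod]
  exact (hG.comp (by fun_prop)).aemeasurable

/-- The first `r` terms of a sequence. -/
def firstTerms {α : Type*} (r : ℕ) (x : ℕ → α) : Fin r → α := fun i => x i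

@[fun_prop]
lemma measurable_firstTerms {α : Type*} [MeasurableSpace α] (r : ℕ) :
    Measurable (firstTerms r : (ℕ → α) → Fin r → α) :=
  measurable_pi_iff.2 fun i => measurable_pi_apply (i : ℕ)

lemma firstTerms_seqCons {α : Type*} (r : ℕ) (x : α) (y : ℕ → α) :
    firstTerms (r + 1) (seqCons x y) = Fin.cons x (firstTerms r y) := by
  ext i
  refine Fin.cases ?_ (fun i => ?_) i <;> simp [firstTerms]

/-- A finite measure on sequences is determined by the laws of its initial segments. -/
lemma ext_of_firstTerms {α : Type*} [MeasurableSpace α] {μ ν : Measure (ℕ → α)} [IsFiniteMeasure μ]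
    (h : ∀ r, μ.map (firstTerms r) = ν.map (firstTerms r)) : μ = ν := by
  refine ext_of_generate_finite (measurableCylinders fun _ : ℕ => α)
    generateFrom_measurableCylinders.symm isPiSystem_measurableCylinders ?_ ?_
  · intro s hs
    obtain ⟨I, S, hS, rfl⟩ := (mem_measurableCylinders s).1 hs
    obtain ⟨N, hN⟩ : ∃ N, ∀ i ∈ I, i < N :=
      ⟨I.sup id + 1, fun i hi => Nat.lt_succ_of_le (Finset.le_sup (f := id) hi)⟩
    have hg : Measurable fun (y : Fin N → α) (i : I) => y ⟨i, hN i i.2⟩ :=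
      measurable_pi_iff.2 fun i => measurable_pi_apply _
    have : cylinder I S
        = firstTerms N ⁻¹' ((fun (y : Fin N → α) (i : I) => y ⟨i, hN i i.2⟩) ⁻¹' S) := rfl
    rw [this, ← Measure.map_apply (by fun_prop) (hg hS), h N,
      Measure.map_apply (by fun_prop) (hg hS)]
  · rw [← preimage_univ (f := firstTerms 0), ← Measure.map_apply (by fun_prop) .univ, h 0,
      Measure.map_apply (by fun_prop) .univ]

end

/-! ### Uniform stick-breaking and its Palm formula. -/

section

lemma lintegral_unif_affine (G : ℝ → ℝ≥0∞) (a : ℝ) {c : ℝ} (hc : 0 < c) :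
    ∫⁻ u, G (a + u * c) ∂unif = (ENNReal.ofReal c)⁻¹ * ∫⁻ x in Ioo a (a + c), G x := by
  have himg : (fun u : ℝ => a + u * c) '' Ioo 0 1 = Ioo a (a + c) := by
    ext x
    constructor
    · rintro ⟨u, ⟨h0, h1⟩, rfl⟩
      constructor <;> nlinarith
    · rintro ⟨h0, h1⟩
      refine ⟨(x - a) / c, ⟨div_pos (by linarith) hc, (div_lt_one hc).2 (by linarith)⟩, ?_⟩
      field_simp
      ring
  have hd : ∀ x ∈ Ioo (0 : ℝ) 1, HasDerivWithinAt (fun u : ℝ => a + u * c) c (Ioo 0 1) x := by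
    intro x _
    simpa using ((hasDerivAt_id x).mul_const c).const_add a |>.hasDerivWithinAt
  have hinj : InjOn (fun u : ℝ => a + u * c) (Ioo 0 1) := by
    intro x _ y _ h
    have : x * c = y * c := by simpa using h
    exact mul_right_cancel₀ hc.ne' this
  rw [← himg, lintegral_image_eq_lintegral_abs_deriv_mul measurableSet_Ioo hd hinj, unif,
    lintegral_const_mul' _ _ (by simp), ← mul_assoc, abs_of_pos hc, ENNReal.inv_mul_cancel, one_mul]
  · simpa using hc
  · simp

lemma lintegral_unif_scale (G : ℝ → ℝ≥0∞) {s : ℝ} (hs : 0 < s) :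
    ∫⁻ u, G (s * u) ∂unif = (ENNReal.ofReal s)⁻¹ * ∫⁻ x in Ioo 0 s, G x := by
  simpa [mul_comm] using lintegral_unif_affine G 0 hs

/-- The pieces broken off a stick of length `s` in proportions `U 0, U 1, …`. -/
def stick (s : ℝ) (U : ℕ → ℝ) (j : ℕ) : ℝ := s * U j * ∏ i ∈ Finset.range j, (1 - U i)

@[fun_prop]
lemma measurable_stick {β : Type*} [MeasurableSpace β] {f : β → ℝ} {g : β → ℕ → ℝ}
    (hf : Measurable f) (hg : Measurable g) : Measurable fun z => stick (f z) (g z) := by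
  refine measurable_pi_iff.2 fun j => ?_
  unfold stick
  fun_prop

lemma stick_seqCons (s u : ℝ) (U : ℕ → ℝ) :
    stick s (seqCons u U) = seqCons (s * u) (stick (s - s * u) U) := by
  ext j
  cases j with
  | zero => simp [stick]
  | succ j =>
    simp only [stick, seqCons_succ, Finset.prod_range_succ', seqCons_zero]
    ring

lemma lintegral_stick {s : ℝ} (hs : 0 < s) {g : (ℕ → ℝ) → ℝ≥0∞} (hg : Measurable g) :
    ∫⁻ U, g (stick s U) ∂unifSeq = (ENNReal.ofReal s)⁻¹ *
      ∫⁻ x in Ioo 0 s, ∫⁻ U, g (seqCons x (stick (s - x) U)) ∂unifSeq := by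
  rw [lintegral_unifSeq_cons (G := fun U => g (stick s U)) (hg.comp (by fun_prop)), ← lintegral_unif_scale _ hs]
  simp [stick_seqCons]

/-- The integral of `g` over `{p | 0 < p i, ∑ i, p i < s}` with respect to `∏ i, dp i / p i`. -/
def nu : (r : ℕ) → ℝ → ((Fin r → ℝ) → ℝ≥0∞) → ℝ≥0∞
  | 0, _, g => g Fin.elim0
  | r + 1, s, g =>
    ∫⁻ p in Ioo 0 s, (ENNReal.ofReal p)⁻¹ * nu r (s - p) fun y => g (Fin.cons p y)

/-- The probability that successive picks in size-biased order from a collection of total weight `s`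
have weights `v 0, v 1, …`. -/
def qfac : (r : ℕ) → ℝ → (Fin r → ℝ) → ℝ≥0∞
  | 0, _, _ => 1
  | r + 1, s, v => ENNReal.ofReal (v 0) / ENNReal.ofReal s * qfac r (s - v 0) (Fin.tail v)

@[fun_prop]
lemma measurable_qfac {β : Type*} [MeasurableSpace β] {r : ℕ} {f : β → ℝ} {g : β → Fin r → ℝ}
    (hf : Measurable f) (hg : Measurable g) : Measurable fun z => qfac r (f z) (g z) := by
  induction r generalizing f with
  | zero => exact measurable_const
  | succ r ih =>
    have h0 : Measurable fun z => g z 0 := (measurable_pi_apply 0).comp hg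
    have ht : Measurable fun z => Fin.tail (g z) :=
      measurable_pi_iff.2 fun i => (measurable_pi_apply i.succ).comp hg
    have := ih (f := fun z => f z - g z 0) (by fun_prop) ht
    simp only [qfac]
    fun_prop

lemma nu_congr {r : ℕ} {s : ℝ} {g g' : (Fin r → ℝ) → ℝ≥0∞}
    (h : ∀ p, (∀ i, 0 < p i) → ∑ i, p i < s → g p = g' p) (hs : 0 < s) :
    nu r s g = nu r s g' := by
  induction r generalizing s with
  | zero => exact h _ (fun i => i.elim0) (by simpa using hs)
  | succ r ih =>
    refine setLIntegral_congr_fun measurableSet_Ioo fun p hp => ?_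
    rw [ih (g' := fun y => g' (Fin.cons p y))]
    · intro y hy hsum
      refine h _ (fun i => Fin.cases (by simpa using hp.1) (by simpa using hy) i) ?_
      rw [Fin.sum_univ_succ]
      simp
      linarith
    · linarith [hp.2]

lemma nu_const_mul {r : ℕ} (s : ℝ) (g : (Fin r → ℝ) → ℝ≥0∞) {c : ℝ≥0∞} (hc : c ≠ ∞) :
    nu r s (fun p => c * g p) = c * nu r s g := by
  induction r generalizing s with
  | zero => rfl
  | succ r ih =>
    simp only [nu, ih]
    rw [← lintegral_const_mul' _ _ hc]
    simp only [mul_left_comm]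

lemma ENNReal_div_ofReal_ne_top {x s : ℝ} (hs : 0 < s) :
    ENNReal.ofReal x / ENNReal.ofReal s ≠ ∞ :=
  ENNReal.div_ne_top (by simp) (by simpa using hs)

/-- The first piece has density 1/s = (x/s)(1/x) on (0,s): the factor 1/x belongs to `nu` and x/s to
`qfac`. The rest is a stick of length s - x. -/
lemma lintegral_stick_firstTerms (r : ℕ) {s : ℝ} (hs : 0 < s) {g : (Fin r → ℝ) → ℝ≥0∞}
    (hg : Measurable g) :
    ∫⁻ U, g (firstTerms r (stick s U)) ∂unifSeq = nu r s fun p => qfac r s p * g p := by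
  induction r generalizing s with
  | zero =>
    simp only [nu, qfac, one_mul]
    rw [lintegral_congr (g := fun _ => g Fin.elim0) fun U => by congr 1; ext i; exact i.elim0]
    simp
  | succ r ih =>
    rw [lintegral_stick hs (g := fun x => g (firstTerms (r + 1) x)) (hg.comp (by fun_prop)), nu,
      ← lintegral_const_mul' _ _ (by simpa using hs)]
    refine setLIntegral_congr_fun measurableSet_Ioo fun x hx => ?_
    simp only [firstTerms_seqCons]
    rw [ih (by linarith [hx.2]) (g := fun y => g (Fin.cons x y)) (hg.comp (by fun_prop))]
    simp only [qfac, Fin.cons_zero, Fin.tail_cons, mul_assoc]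
    rw [nu_const_mul _ _ (ENNReal_div_ofReal_ne_top hs), ← mul_assoc, div_eq_mul_inv,
      ← mul_assoc, ENNReal.inv_mul_cancel (by simpa using hx.1) (by simp), one_mul]

/-- Renumbering of the indices other than `j`. -/
def skip (j i : ℕ) : ℕ := if i < j then i else i + 1

lemma skip_injective (j : ℕ) : Function.Injective (skip j) := by
  intro a b h
  simp only [skip] at h
  split_ifs at h <;> omega

lemma skip_ne (j i : ℕ) : skip j i ≠ j := by
  simp only [skip]
  split_ifs <;> omega

lemma exists_skip_eq {j i : ℕ} (h : i ≠ j) : ∃ l, skip j l = i := by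
  rcases lt_or_gt_of_ne h with h | h
  · exact ⟨i, by simp [skip, h]⟩
  · exact ⟨i - 1, by simp only [skip]; split_ifs <;> omega⟩

lemma seqCons_comp_skip_zero {α : Type*} (x : α) (y : ℕ → α) : seqCons x y ∘ skip 0 = y := by
  ext i
  simp [skip]

lemma seqCons_comp_skip_succ {α : Type*} (x : α) (y : ℕ → α) (j : ℕ) :
    seqCons x y ∘ skip (j + 1) = seqCons x (y ∘ skip j) := by
  ext i
  cases i with
  | zero => simp [skip]
  | succ i =>
    simp only [Function.comp, skip, seqCons_succ, Nat.add_lt_add_iff_right]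
    split_ifs <;> rfl

lemma lintegral_triangle {s : ℝ} {B : ℝ → ℝ → ℝ≥0∞} (hB : Measurable (Function.uncurry B)) :
    ∫⁻ p in Ioo 0 s, ∫⁻ x in Ioo 0 (s - p), B p x =
      ∫⁻ x in Ioo 0 s, ∫⁻ p in Ioo 0 (s - x), B p x := by
  set T : Set (ℝ × ℝ) := {z | 0 < z.1 ∧ 0 < z.2 ∧ z.1 + z.2 < s} with hT
  have hTm : MeasurableSet T :=
    (measurableSet_lt measurable_const measurable_fst).inter
      ((measurableSet_lt measurable_const measurable_snd).inter
      (measurableSet_lt (measurable_fst.add measurable_snd) measurable_const))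
  have h1 : ∀ p x, (Ioo (0 : ℝ) s).indicator
      (fun p => (Ioo (0 : ℝ) (s - p)).indicator (fun x => B p x) x) p =
      T.indicator (Function.uncurry B) (p, x) := by
    intro p x
    by_cases h : (p, x) ∈ T
    · have : p ∈ Ioo 0 s ∧ x ∈ Ioo 0 (s - p) := by
        obtain ⟨h1, h2, h3⟩ := h
        simp only at h1 h2 h3
        exact ⟨⟨h1, by linarith⟩, h2, by linarith⟩
      simp [h, this.1, this.2]
    · rw [indicator_of_notMem h]
      refine indicator_apply_eq_zero.2 fun hp => indicator_apply_eq_zero.2 fun hx => ?_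
      exact absurd ⟨hp.1, hx.1, by linarith [hx.2]⟩ h
  have h2 : ∀ p x, (Ioo (0 : ℝ) s).indicator
      (fun x => (Ioo (0 : ℝ) (s - x)).indicator (fun p => B p x) p) x =
      T.indicator (Function.uncurry B) (p, x) := by
    intro p x
    by_cases h : (p, x) ∈ T
    · have : x ∈ Ioo 0 s ∧ p ∈ Ioo 0 (s - x) := by
        obtain ⟨h1, h2, h3⟩ := h
        simp only at h1 h2 h3
        exact ⟨⟨h2, by linarith⟩, h1, by linarith⟩
      simp [h, this.1, this.2]
    · rw [indicator_of_notMem h]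
      refine indicator_apply_eq_zero.2 fun hp => indicator_apply_eq_zero.2 fun hx => ?_
      exact absurd ⟨hx.1, hp.1, by linarith [hx.2]⟩ h
  have e1 : ∫⁻ p in Ioo 0 s, ∫⁻ x in Ioo 0 (s - p), B p x =
      ∫⁻ p, ∫⁻ x, T.indicator (Function.uncurry B) (p, x) := by
    rw [← lintegral_indicator measurableSet_Ioo]
    refine lintegral_congr fun p => ?_
    by_cases hp : p ∈ Ioo 0 s
    · rw [indicator_of_mem hp, ← lintegral_indicator measurableSet_Ioo]
      exact lintegral_congr fun x => by rw [← h1, indicator_of_mem hp]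
    · rw [indicator_of_notMem hp]
      symm
      rw [lintegral_congr (g := fun _ => 0) fun x => by rw [← h1, indicator_of_notMem hp]]
      simp
  have e2 : ∫⁻ x in Ioo 0 s, ∫⁻ p in Ioo 0 (s - x), B p x =
      ∫⁻ x, ∫⁻ p, T.indicator (Function.uncurry B) (p, x) := by
    rw [← lintegral_indicator measurableSet_Ioo]
    refine lintegral_congr fun p => ?_
    by_cases hp : p ∈ Ioo 0 s
    · rw [indicator_of_mem hp, ← lintegral_indicator measurableSet_Ioo]
      exact lintegral_congr fun x => by rw [← h2, indicator_of_mem hp]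
    · rw [indicator_of_notMem hp]
      symm
      rw [lintegral_congr (g := fun _ => 0) fun x => by rw [← h2, indicator_of_notMem hp]]
      simp
  rw [e1, e2]
  exact lintegral_lintegral_swap ((hB.indicator hTm).aemeasurable)

/-- The integral of `g p (stick (s - p) U)` with respect to `dp / p` on `(0, s)` and the law of
`U`. -/
def palmIntegral (s : ℝ) (g : ℝ → (ℕ → ℝ) → ℝ≥0∞) : ℝ≥0∞ :=
  ∫⁻ p in Ioo 0 s, (ENNReal.ofReal p)⁻¹ * ∫⁻ U, g p (stick (s - p) U) ∂unifSeq

lemma measurable_gexp {β : Type*} [MeasurableSpace β] {f : β → ℝ} {g : β → (ℕ → ℝ) → ℝ≥0∞}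
    (hf : Measurable f) (hg : Measurable (Function.uncurry g)) :
    Measurable fun z => ∫⁻ U, g z (stick (f z) U) ∂unifSeq :=
  Measurable.lintegral_prod_right' (f := fun z : β × (ℕ → ℝ) => g z.1 (stick (f z.1) z.2))
    (hg.comp (by fun_prop : Measurable fun z : β × (ℕ → ℝ) => (z.1, stick (f z.1) z.2)))

lemma inv_mul_inv_sub {s p : ℝ} (hp : 0 < p) (hps : p < s) :
    (ENNReal.ofReal p)⁻¹ * (ENNReal.ofReal (s - p))⁻¹ =
      (ENNReal.ofReal s)⁻¹ * ((ENNReal.ofReal (s - p))⁻¹ + (ENNReal.ofReal p)⁻¹) := by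
  have h1 : 0 < s - p := by linarith
  have h2 : 0 < s := by linarith
  rw [← ENNReal.ofReal_inv_of_pos hp, ← ENNReal.ofReal_inv_of_pos h1,
    ← ENNReal.ofReal_inv_of_pos h2, ← ENNReal.ofReal_mul (by positivity),
    ← ENNReal.ofReal_add (by positivity) (by positivity), ← ENNReal.ofReal_mul (by positivity)]
  congr 1
  field_simp
  ring

/-- Breaking a first piece x off the remaining stick of length s - p gives the density 1/(p(s-p)) =
(1/s)(1/(s-p) + 1/p). The first term reassembles the stick of length s - p, with p as first piece;
the second has x as first piece and p chosen from the rest. -/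
lemma palmIntegral_step {s : ℝ} (hs : 0 < s) {g : ℝ → (ℕ → ℝ) → ℝ≥0∞}
    (hg : Measurable (Function.uncurry g)) :
    palmIntegral s g = (ENNReal.ofReal s)⁻¹ * ∫⁻ x in Ioo 0 s,
      (∫⁻ U, g x (stick (s - x) U) ∂unifSeq +
        palmIntegral (s - x) fun p z => g p (seqCons x z)) := by
  set A : ℝ → ℝ → ℝ≥0∞ := fun p x => ∫⁻ U, g p (seqCons x (stick (s - p - x) U)) ∂unifSeq with hA
  have hAm : Measurable (Function.uncurry A) := by
    refine measurable_gexp (g := fun z : ℝ × ℝ => fun y => g z.1 (seqCons z.2 y)) (by fun_prop) ?_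
    exact hg.comp (by fun_prop : Measurable fun w : (ℝ × ℝ) × (ℕ → ℝ) => (w.1.1, seqCons w.1.2 w.2))
  have hgp : ∀ p, Measurable (g p) := fun p => hg.comp (by fun_prop : Measurable fun z => (p, z))
  have hG : Measurable fun x => ∫⁻ U, g x (stick (s - x) U) ∂unifSeq :=
    measurable_gexp (by fun_prop) hg
  have key : ∀ p ∈ Ioo 0 s, ∫⁻ U, g p (stick (s - p) U) ∂unifSeq =
      (ENNReal.ofReal (s - p))⁻¹ * ∫⁻ x in Ioo 0 (s - p), A p x := fun p hp =>
    lintegral_stick (by linarith [hp.2]) (hgp p)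
  have e1 : palmIntegral s g = ∫⁻ p in Ioo 0 s, (ENNReal.ofReal s)⁻¹ *
      (∫⁻ U, g p (stick (s - p) U) ∂unifSeq +
        ∫⁻ x in Ioo 0 (s - p), (ENNReal.ofReal p)⁻¹ * A p x) := by
    refine setLIntegral_congr_fun measurableSet_Ioo fun p hp => ?_
    rw [key p hp, lintegral_const_mul' _ _ (by simpa using hp.1), ← add_mul, ← mul_assoc,
      ← mul_assoc, inv_mul_inv_sub hp.1 hp.2]
  rw [e1, lintegral_const_mul' _ _ (by simpa using hs)]
  congr 1
  rw [lintegral_add_left hG, lintegral_add_left hG]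
  congr 1
  rw [lintegral_triangle (B := fun p x => (ENNReal.ofReal p)⁻¹ * A p x) (by fun_prop)]
  refine setLIntegral_congr_fun measurableSet_Ioo fun x hx => ?_
  refine setLIntegral_congr_fun measurableSet_Ioo fun p hp => ?_
  simp only [hA, sub_right_comm]

/-- Expected sum over the first `n` pieces of a function of the piece and the remaining pieces. -/
def palmSum (n : ℕ) (s : ℝ) (g : ℝ → (ℕ → ℝ) → ℝ≥0∞) : ℝ≥0∞ :=
  ∫⁻ U, ∑ j ∈ Finset.range n, g (stick s U j) (stick s U ∘ skip j) ∂unifSeq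

lemma measurable_comp_right {α : Type*} [MeasurableSpace α] (f : ℕ → ℕ) :
    Measurable fun x : ℕ → α => x ∘ f :=
  measurable_pi_iff.2 fun i => measurable_pi_apply (f i)

lemma measurable_palm {g : ℝ → (ℕ → ℝ) → ℝ≥0∞} (hg : Measurable (Function.uncurry g)) (j : ℕ) :
    Measurable fun x : ℕ → ℝ => g (x j) (x ∘ skip j) :=
  hg.comp ((measurable_pi_apply j).prodMk (measurable_comp_right _))

/-- The same recursion as in `palmIntegral_step`: either the first piece is the distinguished one,
or it goes to the front of the remaining pieces. -/
lemma palmSum_step (n : ℕ) {s : ℝ} (hs : 0 < s) {g : ℝ → (ℕ → ℝ) → ℝ≥0∞}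
    (hg : Measurable (Function.uncurry g)) :
    palmSum (n + 1) s g = (ENNReal.ofReal s)⁻¹ * ∫⁻ x in Ioo 0 s,
      (∫⁻ U, g x (stick (s - x) U) ∂unifSeq +
        palmSum n (s - x) fun p z => g p (seqCons x z)) := by
  have hm : Measurable fun x : ℕ → ℝ => ∑ j ∈ Finset.range (n + 1), g (x j) (x ∘ skip j) :=
    Finset.measurable_sum _ fun j _ => measurable_palm hg j
  rw [palmSum, lintegral_stick hs (g := fun x => ∑ j ∈ Finset.range (n + 1), g (x j) (x ∘ skip j)) hm]
  congr 1
  refine setLIntegral_congr_fun measurableSet_Ioo fun x hx => ?_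
  simp only [palmSum]
  have hx : Measurable fun U => g x (stick (s - x) U) :=
    hg.comp (by fun_prop : Measurable fun U => (x, stick (s - x) U))
  rw [← lintegral_add_left hx]
  refine lintegral_congr fun U => ?_
  rw [Finset.sum_range_succ', add_comm]
  simp only [seqCons_succ, seqCons_comp_skip_succ, seqCons_zero, seqCons_comp_skip_zero]

lemma palmSum_le (n : ℕ) {s : ℝ} (hs : 0 < s) {g : ℝ → (ℕ → ℝ) → ℝ≥0∞}
    (hg : Measurable (Function.uncurry g)) : palmSum n s g ≤ palmIntegral s g := by
  induction n generalizing s g with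
  | zero => simp [palmSum]
  | succ n ih =>
    rw [palmSum_step n hs hg, palmIntegral_step hs hg]
    refine mul_le_mul_right ?_ _
    refine setLIntegral_mono' measurableSet_Ioo fun x hx => ?_
    gcongr
    exact ih (by linarith [hx.2]) (hg.comp
      (by fun_prop : Measurable fun w : ℝ × (ℕ → ℝ) => (w.1, seqCons x w.2)))

lemma lintegral_sub_Ioo {s : ℝ} (hs : 0 < s) :
    ∫⁻ x in Ioo 0 s, ENNReal.ofReal (s - x) = ENNReal.ofReal (s ^ 2 / 2) := by
  rw [← ofReal_integral_eq_lintegral_ofReal]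
  · rw [← integral_Ioc_eq_integral_Ioo, ← intervalIntegral.integral_of_le hs.le]
    congr 1
    rw [intervalIntegral.integral_sub (by simp) (by simp)]
    simp
    ring
  · exact (Continuous.integrableOn_Icc (by fun_prop)).mono_set Ioo_subset_Icc_self
  · refine (ae_restrict_iff' measurableSet_Ioo).2 (Eventually.of_forall fun x hx => ?_)
    simpa using hx.2.le

/-- When g p z ≤ C p the gap is at most C s for n = 0. One step of the common recursion averages the
bound C (s - x) / 2^n over x in (0,s), which halves it. -/
lemma palmIntegral_le (n C : ℕ) {s : ℝ} (hs : 0 < s) {g : ℝ → (ℕ → ℝ) → ℝ≥0∞}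
    (hg : Measurable (Function.uncurry g)) (hC : ∀ p z, g p z ≤ C * ENNReal.ofReal p) :
    palmIntegral s g ≤ palmSum n s g + ENNReal.ofReal (C * s / 2 ^ n) := by
  induction n generalizing s g with
  | zero =>
    simp only [palmSum, Finset.range_zero, Finset.sum_empty, lintegral_zero, zero_add, pow_zero,
      div_one]
    calc palmIntegral s g ≤ ∫⁻ p in Ioo 0 s, C := by
          refine setLIntegral_mono' measurableSet_Ioo fun p hp => ?_
          calc _ ≤ (ENNReal.ofReal p)⁻¹ * ∫⁻ U, C * ENNReal.ofReal p ∂unifSeq := by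
                gcongr
                exact hC _ _
            _ = C := by
                rw [lintegral_const, measure_univ, mul_one, mul_comm, mul_assoc,
                  ENNReal.mul_inv_cancel (by simpa using hp.1) (by simp), mul_one]
      _ = _ := by
          rw [setLIntegral_const, Real.volume_Ioo, sub_zero, ENNReal.ofReal_mul (by positivity)]
          simp
  | succ n ih =>
    rw [palmIntegral_step hs hg, palmSum_step n hs hg]
    have hgx : ∀ x, Measurable (Function.uncurry fun p z => g p (seqCons x z)) := fun x =>
      hg.comp (by fun_prop : Measurable fun w : ℝ × (ℕ → ℝ) => (w.1, seqCons x w.2))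
    calc _ ≤ (ENNReal.ofReal s)⁻¹ * ∫⁻ x in Ioo 0 s, ((∫⁻ U, g x (stick (s - x) U) ∂unifSeq +
              palmSum n (s - x) fun p z => g p (seqCons x z)) +
              ENNReal.ofReal (C / 2 ^ n) * ENNReal.ofReal (s - x)) := by
          refine mul_le_mul_right ?_ _
          refine setLIntegral_mono' measurableSet_Ioo fun x hx => ?_
          rw [add_assoc, ← ENNReal.ofReal_mul (by positivity)]
          gcongr
          refine (ih (by linarith [hx.2]) (hgx x) fun p z => hC _ _).trans (le_of_eq ?_)
          congr 2
          ring
      _ = _ := by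
          rw [lintegral_add_right _ (by fun_prop), lintegral_const_mul' _ _ (by simp),
            lintegral_sub_Ioo hs, mul_add]
          congr 1
          rw [← ENNReal.ofReal_inv_of_pos hs, ← ENNReal.ofReal_mul (by positivity),
            ← ENNReal.ofReal_mul (by positivity)]
          congr 1
          field_simp
          ring

lemma iSup_min_nat_mul (a : ℝ≥0∞) {c : ℝ≥0∞} (hc : c ≠ 0) : ⨆ n : ℕ, min a (n * c) = a := by
  rw [← inf_iSup_eq, ← ENNReal.iSup_mul, ENNReal.iSup_natCast, ENNReal.top_mul hc]
  simp

/-- `palmSum_le` and `palmIntegral_le` settle the case of g bounded by a multiple of p. The general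
case follows by monotone convergence along the truncations min(g, C p). -/
lemma palm_formula {s : ℝ} (hs : 0 < s) {g : ℝ → (ℕ → ℝ) → ℝ≥0∞}
    (hg : Measurable (Function.uncurry g)) :
    ∫⁻ U, ∑' j, g (stick s U j) (stick s U ∘ skip j) ∂unifSeq = palmIntegral s g := by
  have hjm : ∀ {g : ℝ → (ℕ → ℝ) → ℝ≥0∞}, Measurable (Function.uncurry g) → ∀ j : ℕ,
      Measurable fun U => g (stick s U j) (stick s U ∘ skip j) := fun hg j =>
    (measurable_palm hg j).comp (by fun_prop : Measurable (stick s))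
  have hlim : ∀ {g : ℝ → (ℕ → ℝ) → ℝ≥0∞}, Measurable (Function.uncurry g) →
      Tendsto (fun n => palmSum n s g) atTop
        (𝓝 (∫⁻ U, ∑' j, g (stick s U j) (stick s U ∘ skip j) ∂unifSeq)) := by
    intro g hg
    rw [lintegral_tsum fun j => (hjm hg j).aemeasurable]
    have : ∀ n, palmSum n s g = ∑ j ∈ Finset.range n,
        ∫⁻ U, g (stick s U j) (stick s U ∘ skip j) ∂unifSeq := fun n =>
      lintegral_finsetSum _ fun j _ => hjm hg j
    simp only [this]
    exact ENNReal.tendsto_nat_tsum _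
  refine le_antisymm (le_of_tendsto' (hlim hg) fun n => palmSum_le n hs hg) ?_
  have hbdd : ∀ C : ℕ, palmIntegral s (fun p z => min (g p z) (C * ENNReal.ofReal p)) ≤
      ∫⁻ U, ∑' j, g (stick s U j) (stick s U ∘ skip j) ∂unifSeq := by
    intro C
    have hgC : Measurable (Function.uncurry fun p z => min (g p z) (C * ENNReal.ofReal p)) :=
      hg.min (by fun_prop)
    have h1 : Tendsto (fun n => palmSum n s (fun p z => min (g p z) (C * ENNReal.ofReal p)) +
        ENNReal.ofReal (C * s / 2 ^ n)) atTop
        (𝓝 ((∫⁻ U, ∑' j, min (g (stick s U j) (stick s U ∘ skip j))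
          (C * ENNReal.ofReal (stick s U j)) ∂unifSeq) + 0)) := by
      refine (hlim hgC).add ?_
      rw [← ENNReal.ofReal_zero]
      refine ENNReal.tendsto_ofReal ?_
      have : Tendsto (fun n : ℕ => C * s * (1 / 2) ^ n) atTop (𝓝 (C * s * 0)) :=
        (tendsto_pow_atTop_nhds_zero_of_lt_one (by norm_num) (by norm_num)).const_mul _
      simpa [div_eq_mul_inv] using this
    refine (ge_of_tendsto' h1 fun n => palmIntegral_le n C hs hgC fun p z => min_le_right _ _).trans ?_
    rw [add_zero]
    gcongr
    exact min_le_left _ _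
  refine le_trans (le_of_eq ?_) (iSup_le hbdd)
  have hmono : ∀ p z, Monotone fun C : ℕ => min (g p z) (C * ENNReal.ofReal p) := by
    intro p z m n hmn
    dsimp only
    gcongr
  have hgC : ∀ C : ℕ, Measurable (Function.uncurry fun p z => min (g p z) (C * ENNReal.ofReal p)) :=
    fun C => hg.min (by fun_prop)
  simp only [palmIntegral]
  rw [← lintegral_iSup]
  · refine setLIntegral_congr_fun measurableSet_Ioo fun p hp => ?_
    rw [← ENNReal.mul_iSup, ← lintegral_iSup]
    · simp only [iSup_min_nat_mul _ (show ENNReal.ofReal p ≠ 0 by simpa using hp.1)]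
    · exact fun C => (hgC C).comp (by fun_prop : Measurable fun U => (p, stick (s - p) U))
    · exact fun m n hmn U => hmono p _ hmn
  · exact fun C => (by fun_prop : Measurable fun p => (ENNReal.ofReal p)⁻¹).mul
      (measurable_gexp (by fun_prop) (hgC C))
  · intro m n hmn p
    dsimp only
    gcongr

/-- The sum of `g` over all `r`-tuples of distinct terms of a sequence. -/
def injSum {α : Type*} (r : ℕ) (x : ℕ → α) (g : (Fin r → α) → ℝ≥0∞) : ℝ≥0∞ :=
  ∑' j : Fin r → ℕ, {j | Function.Injective j}.indicator (fun j => g fun i => x (j i)) j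

lemma measurable_injSum {α β : Type*} [MeasurableSpace α] [MeasurableSpace β] {r : ℕ}
    {x : β → ℕ → α} {g : β → (Fin r → α) → ℝ≥0∞} (hx : Measurable x)
    (hg : Measurable (Function.uncurry g)) : Measurable fun z => injSum r (x z) (g z) := by
  refine Measurable.tsum fun j => ?_
  by_cases hj : Function.Injective j
  · simp only [mem_ofPred_eq, hj, indicator_of_mem]
    exact hg.comp (measurable_id.prodMk
      (measurable_pi_iff.2 fun i => (measurable_pi_apply (j i)).comp hx))
  · simp only [mem_ofPred_eq, hj, not_false_eq_true, indicator_of_notMem]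
    exact measurable_const

/-- A tuple of distinct indices is a first index j and a tuple of distinct indices avoiding j; `skip
j` renumbers the latter by all of ℕ. -/
lemma injSum_succ {α : Type*} (r : ℕ) (x : ℕ → α) (g : (Fin (r + 1) → α) → ℝ≥0∞) :
    injSum (r + 1) x g =
      ∑' j, injSum r (x ∘ skip j) fun y => g (Fin.cons (x j) y) := by
  unfold injSum
  rw [← (Fin.consEquiv fun _ : Fin (r + 1) => ℕ).tsum_eq, ENNReal.tsum_prod']
  refine tsum_congr fun j => ?_
  have hinj : Function.Injective fun (l : Fin r → ℕ) (i : Fin r) => skip j (l i) := by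
    intro l l' h
    ext i
    exact skip_injective j (congrFun h i)
  rw [← hinj.tsum_eq]
  · refine tsum_congr fun l => ?_
    have hiff : Function.Injective (Fin.cons j fun i => skip j (l i) : Fin (r + 1) → ℕ) ↔
        Function.Injective l := by
      rw [Fin.cons_injective_iff]
      constructor
      · rintro ⟨-, h⟩ a b hab
        exact h (by simp [hab])
      · intro h
        refine ⟨?_, (skip_injective j).comp h⟩
        rintro ⟨i, hi⟩
        exact skip_ne _ _ hi
    by_cases hl : Function.Injective l
    · simp only [Fin.consEquiv, Equiv.coe_fn_mk, mem_ofPred_eq, hiff, hl, indicator_of_mem]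
      congr 1
      ext i
      refine Fin.cases ?_ (fun i => ?_) i <;> simp
    · simp only [Fin.consEquiv, Equiv.coe_fn_mk, mem_ofPred_eq, hiff, hl, not_false_eq_true,
        indicator_of_notMem]
  · intro l hl
    have hl' : Function.Injective (Fin.cons j l : Fin (r + 1) → ℕ) := by
      by_contra h
      exact hl (indicator_of_notMem h _)
    rw [Fin.cons_injective_iff] at hl'
    have : ∀ i, ∃ m, skip j m = l i := fun i =>
      exists_skip_eq fun h => hl'.1 ⟨i, h⟩
    choose m hm using this
    exact ⟨m, funext hm⟩

/-- The Palm formula is applied r times: after removal of a piece p, the other pieces form a stick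
of length s - p. -/
lemma lintegral_injSum_stick (r : ℕ) {s : ℝ} (hs : 0 < s) {g : (Fin r → ℝ) → ℝ≥0∞}
    (hg : Measurable g) : ∫⁻ U, injSum r (stick s U) g ∂unifSeq = nu r s g := by
  induction r generalizing s with
  | zero =>
    have : ∀ U, injSum 0 (stick s U) g = g Fin.elim0 := by
      intro U
      rw [injSum, tsum_eq_single Fin.elim0 fun j hj => (hj (Subsingleton.elim _ _)).elim,
        indicator_of_mem (Function.injective_of_subsingleton _)]
      congr 1
      exact Subsingleton.elim _ _
    simp [this, nu]
  | succ r ih =>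
    simp only [injSum_succ]
    rw [palm_formula hs (g := fun p z => injSum r z fun y => g (Fin.cons p y)), palmIntegral, nu]
    · refine setLIntegral_congr_fun measurableSet_Ioo fun p hp => ?_
      rw [ih (by linarith [hp.2]) (g := fun y => g (Fin.cons p y)) (hg.comp (by fun_prop))]
    · exact measurable_injSum (g := fun (z : ℝ × (ℕ → ℝ)) y => g (Fin.cons z.1 y)) measurable_snd
        (hg.comp (by fun_prop : Measurable fun w : (ℝ × (ℕ → ℝ)) × (Fin r → ℝ) =>
          (Fin.cons w.1.1 w.2 : Fin (r + 1) → ℝ)))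

end

/-! ### Equidistribution of uniform samples. -/

section

/-- A sequence of distinct points of `(0,1)` with uniform asymptotic distribution. -/
structure Generic (X : ℕ → ℝ) : Prop where
  injective : Function.Injective X
  pos : ∀ k, 0 < X k
  lt_one : ∀ k, X k < 1
  equidist : ∀ t ∈ Icc (0 : ℝ) 1, Tendsto (fracLeft X t) atTop (𝓝 t)

lemma fracLeft_mono (X : ℕ → ℝ) (n : ℕ) : Monotone fun t => fracLeft X t n := by
  intro s t hst
  unfold fracLeft
  refine div_le_div_of_nonneg_right ?_ (by positivity)
  exact_mod_cast Finset.card_le_card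
    (Finset.monotone_filter_right _ fun k _ (hk : X k ≤ s) => hk.trans hst)

lemma ae_mem_Ioo_unifSeq : ∀ᵐ X ∂unifSeq, ∀ k, X k ∈ Ioo (0 : ℝ) 1 := by
  refine ae_all_iff.2 fun k => ?_
  have h := measurePreserving_eval_infinitePi (fun _ : ℕ => unif) k
  exact h.quasiMeasurePreserving.ae (ae_restrict_mem measurableSet_Ioo)

lemma ae_injective_unifSeq : ∀ᵐ X ∂unifSeq, Function.Injective X := by
  have : ∀ i j : ℕ, i ≠ j → ∀ᵐ X ∂unifSeq, X i ≠ X j := by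
    intro i j hij
    have hm : MeasurableSet {X : ℕ → ℝ | X i = X j} :=
      measurableSet_eq_fun (measurable_pi_apply i) (measurable_pi_apply j)
    rw [ae_iff]
    simp only [ne_eq, not_not]
    rw [← lintegral_indicator_one hm,
      lintegral_unifSeq_update i (measurable_one.indicator hm)]
    refine (lintegral_congr fun X => ?_).trans lintegral_zero
    refine (lintegral_eq_zero_iff ((measurable_one.indicator hm).comp (by fun_prop))).2 ?_
    have : ∀ᵐ x ∂unif, x ≠ X j := by
      rw [ae_iff]
      simp [unif]
    filter_upwards [this] with x hx
    simp [indicator, Function.update_of_ne hij.symm, hx]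
  have h2 : ∀ᵐ X ∂unifSeq, ∀ i j : ℕ, i ≠ j → X i ≠ X j := by
    simp only [ae_all_iff]
    exact this
  filter_upwards [h2] with X hX i j h
  by_contra hne
  exact hX i j hne h

lemma fracLeft_eq_sum (X : ℕ → ℝ) (t : ℝ) (n : ℕ) :
    fracLeft X t n = (∑ l ∈ Finset.range n, (Iic t).indicator (fun _ => (1 : ℝ)) (X l)) / n := by
  simp [fracLeft, indicator, Finset.sum_boole]

lemma unif_real_Iic {t : ℝ} (ht : t ∈ Icc (0 : ℝ) 1) : unif.real (Iic t) = t := by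
  rw [Measure.real, unif, Measure.restrict_apply measurableSet_Iic]
  have : (Iic t ∩ Ioo 0 1 : Set ℝ) =ᵐ[volume] Ioc 0 t := by
    have h1 : (Iic t ∩ Ioo 0 1 : Set ℝ) =ᵐ[volume] (Iic t ∩ Ioc 0 1 : Set ℝ) := ae_eq_set_inter (by rfl) Ioo_ae_eq_Ioc
    have h2 : Iic t ∩ Ioc 0 1 = Ioc 0 t := by
      ext x
      simp only [mem_inter_iff, mem_Iic, mem_Ioc]
      constructor
      · rintro ⟨h, h', -⟩; exact ⟨h', h⟩
      · rintro ⟨h, h'⟩; exact ⟨h', h, h'.trans ht.2⟩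
    rwa [h2] at h1
  rw [measure_congr this]
  simp [ht.1]

lemma ae_tendsto_fracLeft {t : ℝ} (ht : t ∈ Icc (0 : ℝ) 1) :
    ∀ᵐ X ∂unifSeq, Tendsto (fracLeft X t) atTop (𝓝 t) := by
  set f : ℝ → ℝ := (Iic t).indicator fun _ => 1 with hf
  have hfm : Measurable f := measurable_const.indicator measurableSet_Iic
  have hind : iIndepFun (fun (l : ℕ) (X : ℕ → ℝ) => f (X l)) unifSeq :=
    iIndepFun_infinitePi (P := fun _ : ℕ => unif) (X := fun _ => f) fun _ => hfm
  have hid : ∀ l : ℕ, IdentDistrib (fun X : ℕ → ℝ => f (X l)) (fun X => f (X 0)) unifSeq unifSeq := by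
    intro l
    have : IdentDistrib (fun X : ℕ → ℝ => X l) (fun X => X 0) unifSeq unifSeq :=
      ⟨(measurable_pi_apply l).aemeasurable, (measurable_pi_apply 0).aemeasurable, by
        rw [unifSeq, Measure.infinitePi_map_eval, Measure.infinitePi_map_eval]⟩
    exact this.comp hfm
  have hint : Integrable (fun X : ℕ → ℝ => f (X 0)) unifSeq := by
    refine Integrable.of_bound (hfm.comp (measurable_pi_apply 0)).aestronglyMeasurable 1 ?_
    refine Eventually.of_forall fun X => ?_
    simp only [hf, indicator]
    split_ifs <;> simp
  have hexp : ∫ X, f (X 0) ∂unifSeq = t := by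
    have := integral_map (μ := unifSeq) (measurable_pi_apply 0).aemeasurable
      (f := f) hfm.aestronglyMeasurable
    rw [← this, unifSeq, Measure.infinitePi_map_eval, hf, integral_indicator measurableSet_Iic]
    simpa using unif_real_Iic ht
  have := strong_law_ae_real (fun (l : ℕ) (X : ℕ → ℝ) => f (X l)) hint
    (fun i j hij => hind.indepFun hij) hid
  filter_upwards [this] with X hX
  rw [hexp] at hX
  simpa only [funext (fracLeft_eq_sum X t)] using hX

lemma tendsto_fracLeft_of_rat {X : ℕ → ℝ}
    (h : ∀ q : ℚ, (q : ℝ) ∈ Icc (0 : ℝ) 1 → Tendsto (fracLeft X q) atTop (𝓝 (q : ℝ)))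
    {t : ℝ} (ht : t ∈ Icc (0 : ℝ) 1) :
    Tendsto (fracLeft X t) atTop (𝓝 t) := by
  have hle1 : ∀ u n, fracLeft X u n ≤ 1 := by
    intro u n
    unfold fracLeft
    refine div_le_one_of_le₀ ?_ (by positivity)
    exact_mod_cast (Finset.card_filter_le _ _).trans (by simp)
  have hge0 : ∀ u n, 0 ≤ fracLeft X u n := by
    intro u n
    unfold fracLeft
    positivity
  refine tendsto_order.2 ⟨fun a ha => ?_, fun a ha => ?_⟩
  · rcases lt_or_ge a 0 with ha0 | ha0
    · exact Eventually.of_forall fun n => ha0.trans_le (hge0 _ _)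
    · obtain ⟨q, hq1, hq2⟩ := exists_rat_btwn ha
      filter_upwards [(tendsto_order.1 (h q ⟨ha0.trans hq1.le, hq2.le.trans ht.2⟩)).1 a hq1]
        with n hn
      exact hn.trans_le (fracLeft_mono X n hq2.le)
  · rcases lt_or_ge 1 a with ha0 | ha0
    · exact Eventually.of_forall fun n => (hle1 _ _).trans_lt ha0
    · obtain ⟨q, hq1, hq2⟩ := exists_rat_btwn ha
      filter_upwards [(tendsto_order.1 (h q ⟨ht.1.trans hq1.le, hq2.le.trans ha0⟩)).2 a hq2]
        with n hn
      exact (fracLeft_mono X n hq1.le).trans_lt hn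

lemma ae_generic : ∀ᵐ X ∂unifSeq, Generic X := by
  have h : ∀ᵐ X ∂unifSeq, ∀ q : ℚ, (q : ℝ) ∈ Icc (0 : ℝ) 1 →
      Tendsto (fracLeft X q) atTop (𝓝 (q : ℝ)) := by
    refine ae_all_iff.2 fun q => ?_
    by_cases hq : (q : ℝ) ∈ Icc (0 : ℝ) 1
    · filter_upwards [ae_tendsto_fracLeft hq] with X hX _
      exact hX
    · exact Eventually.of_forall fun X hq' => (hq hq').elim
  filter_upwards [h, ae_mem_Ioo_unifSeq, ae_injective_unifSeq] with X h1 h2 h3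
  exact ⟨h3, fun k => (h2 k).1, fun k => (h2 k).2, fun t ht =>
    tendsto_fracLeft_of_rat h1 ht⟩

/-- Without a point in between, the empirical fractions at s and t would coincide, yet they have
different limits. -/
lemma Generic.exists_mem_Ioc {X : ℕ → ℝ} (hX : Generic X) {s t : ℝ} (hs : 0 ≤ s) (hst : s < t)
    (ht : t ≤ 1) : ∃ k, X k ∈ Ioc s t := by
  by_contra! hk
  have h1 := hX.equidist s ⟨hs, by linarith⟩
  have h2 := hX.equidist t ⟨by linarith, ht⟩
  have : fracLeft X s = fracLeft X t := by
    ext n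
    unfold fracLeft
    congr 3
    ext k
    simp only [Finset.mem_filter, and_congr_right_iff]
    intro _
    constructor
    · intro h; exact h.trans hst.le
    · intro h; by_contra h'
      exact hk k ⟨not_le.1 h', h⟩
  rw [this] at h1
  exact hst.ne (tendsto_nhds_unique h1 h2)

lemma Generic.exists_lt {X : ℕ → ℝ} (hX : Generic X) {s : ℝ} (hs : s < 1) : ∃ k, s < X k := by
  obtain ⟨k, hk⟩ := hX.exists_mem_Ioc (le_max_right s 0) (max_lt hs one_pos) le_rfl
  exact ⟨k, (le_max_left _ _).trans_lt hk.1⟩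

end

/-! ### Atoms on the local time scale: distribution function and size-biased steps. -/

section

/-- The mass of the atoms in `(-∞, t]`, if atom `k` has mass `L k` and position `X k`. -/
def massLE (L : ℕ → ℝ≥0∞) (X : ℕ → ℝ) (t : ℝ) : ℝ≥0∞ := ∑' k, if X k ≤ t then L k else 0

/-- The mass of the atoms in `(s, t]`. -/
def massIoc (L : ℕ → ℝ≥0∞) (X : ℕ → ℝ) (s t : ℝ) : ℝ≥0∞ :=
  ∑' k, if s < X k ∧ X k ≤ t then L k else 0

/-- The mass of the atoms in `(s, ∞)`. -/
def massGT (L : ℕ → ℝ≥0∞) (X : ℕ → ℝ) (s : ℝ) : ℝ≥0∞ := ∑' k, if s < X k then L k else 0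

/-- The distribution function of the atoms. -/
def cdfOf (L : ℕ → ℝ≥0∞) (X : ℕ → ℝ) (t : ℝ) : ℝ := (massLE L X t).toReal

section Mass

variable {L : ℕ → ℝ≥0∞} {X : ℕ → ℝ}

lemma massLE_add_massIoc (L : ℕ → ℝ≥0∞) (X : ℕ → ℝ) {s t : ℝ} (h : s ≤ t) :
    massLE L X s + massIoc L X s t = massLE L X t := by
  simp only [massLE, massIoc]
  rw [← ENNReal.tsum_add]
  refine tsum_congr fun k => ?_
  by_cases h1 : X k ≤ s
  · simp [h1, h1.trans h, not_lt.2 h1]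
  · simp [h1, not_le.1 h1]

lemma massLE_add_massGT (hL : ∑' k, L k = 1) (X : ℕ → ℝ) (s : ℝ) :
    massLE L X s + massGT L X s = 1 := by
  simp only [massLE, massGT]
  rw [← ENNReal.tsum_add, ← hL]
  refine tsum_congr fun k => ?_
  by_cases h1 : X k ≤ s
  · simp [h1, not_lt.2 h1]
  · simp [h1, not_le.1 h1]

lemma massLE_le_one (hL : ∑' k, L k = 1) (X : ℕ → ℝ) (s : ℝ) : massLE L X s ≤ 1 := by
  rw [← massLE_add_massGT hL X s]
  exact le_self_add

lemma massLE_ne_top (hL : ∑' k, L k = 1) (X : ℕ → ℝ) (s : ℝ) : massLE L X s ≠ ∞ :=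
  ((massLE_le_one hL X s).trans_lt ENNReal.one_lt_top).ne

lemma mass_ne_top (hL : ∑' k, L k = 1) (k : ℕ) : L k ≠ ∞ :=
  (((ENNReal.le_tsum k).trans hL.le).trans_lt ENNReal.one_lt_top).ne

lemma massLE_mono (L : ℕ → ℝ≥0∞) (X : ℕ → ℝ) : Monotone (massLE L X) := by
  intro s t h
  rw [← massLE_add_massIoc L X h]
  exact le_self_add

lemma cdfOf_mono (hL : ∑' k, L k = 1) (X : ℕ → ℝ) : Monotone (cdfOf L X) := fun _ _ h =>
  ENNReal.toReal_mono (massLE_ne_top hL X _) (massLE_mono L X h)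

lemma cdfOf_nonneg (L : ℕ → ℝ≥0∞) (X : ℕ → ℝ) (t : ℝ) : 0 ≤ cdfOf L X t := ENNReal.toReal_nonneg

lemma cdfOf_le_one (hL : ∑' k, L k = 1) (X : ℕ → ℝ) (t : ℝ) : cdfOf L X t ≤ 1 :=
  ENNReal.toReal_mono ENNReal.one_ne_top (massLE_le_one hL X t)

lemma ofReal_cdfOf (hL : ∑' k, L k = 1) (X : ℕ → ℝ) (t : ℝ) :
    ENNReal.ofReal (cdfOf L X t) = massLE L X t := ENNReal.ofReal_toReal (massLE_ne_top hL X t)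

lemma ofReal_cdfOf_sub (hL : ∑' k, L k = 1) (X : ℕ → ℝ) {s t : ℝ} (h : s ≤ t) :
    ENNReal.ofReal (cdfOf L X t - cdfOf L X s) = massIoc L X s t := by
  rw [ENNReal.ofReal_sub _ (cdfOf_nonneg L X s), ofReal_cdfOf hL, ofReal_cdfOf hL,
    ← massLE_add_massIoc L X h, ENNReal.add_sub_cancel_left (massLE_ne_top hL X s)]

lemma ofReal_one_sub_cdfOf (hL : ∑' k, L k = 1) (X : ℕ → ℝ) (s : ℝ) :
    ENNReal.ofReal (1 - cdfOf L X s) = massGT L X s := by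
  rw [ENNReal.ofReal_sub _ (cdfOf_nonneg L X s), ofReal_cdfOf hL, ENNReal.ofReal_one,
    ← massLE_add_massGT hL X s, ENNReal.add_sub_cancel_left (massLE_ne_top hL X s)]

lemma massGT_ne_top (hL : ∑' k, L k = 1) (X : ℕ → ℝ) (s : ℝ) : massGT L X s ≠ ∞ := by
  rw [← ofReal_one_sub_cdfOf hL]
  simp

lemma massGT_ne_zero (hpos : ∀ k, L k ≠ 0) (hX : Generic X) {s : ℝ} (hs : s < 1) :
    massGT L X s ≠ 0 := by
  obtain ⟨k, hk⟩ := hX.exists_lt hs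
  intro h
  have := ENNReal.tsum_eq_zero.1 h k
  simp [hk, hpos k] at this

lemma cdfOf_lt_one (hL : ∑' k, L k = 1) (hpos : ∀ k, L k ≠ 0) (hX : Generic X) {s : ℝ}
    (hs : s < 1) : cdfOf L X s < 1 := by
  have h := massGT_ne_zero hpos hX hs
  rw [← ofReal_one_sub_cdfOf hL] at h
  simpa using h

lemma cdfOf_le_sub (hL : ∑' k, L k = 1) {t : ℝ} {k : ℕ} (h : t < X k) :
    cdfOf L X t ≤ cdfOf L X (X k) - (L k).toReal := by
  have : massLE L X t + L k ≤ massLE L X (X k) := by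
    rw [← massLE_add_massIoc L X h.le]
    gcongr
    refine le_trans (le_of_eq ?_) (ENNReal.le_tsum k)
    simp [h]
  have h2 := ENNReal.toReal_mono (massLE_ne_top hL X _) this
  rw [ENNReal.toReal_add (massLE_ne_top hL X _) (mass_ne_top hL k)] at h2
  simp only [cdfOf]
  linarith

@[fun_prop]
lemma measurable_cdfOf {β : Type*} [MeasurableSpace β] {l : β → ℕ → ℝ≥0∞} {x : β → ℕ → ℝ}
    {t : β → ℝ} (hl : Measurable l) (hx : Measurable x) (ht : Measurable t) :
    Measurable fun z => cdfOf (l z) (x z) (t z) := by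
  unfold cdfOf massLE
  refine (Measurable.tsum fun k => Measurable.ite ?_ ?_ measurable_const).ennreal_toReal
  · exact measurableSet_le ((measurable_pi_apply k).comp hx) ht
  · exact (measurable_pi_apply k).comp hl

@[fun_prop]
lemma measurable_massIoc {β : Type*} [MeasurableSpace β] {x : β → ℕ → ℝ}
    {s t : β → ℝ} (hx : Measurable x) (hs : Measurable s) (ht : Measurable t) :
    Measurable fun z => massIoc L (x z) (s z) (t z) := by
  unfold massIoc
  refine Measurable.tsum fun k => Measurable.ite ?_ measurable_const measurable_const
  have := (measurable_pi_apply k).comp hx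
  exact (measurableSet_lt hs this).inter (measurableSet_le this ht)

@[fun_prop]
lemma measurable_massGT {β : Type*} [MeasurableSpace β] {x : β → ℕ → ℝ}
    {s : β → ℝ} (hx : Measurable x) (hs : Measurable s) :
    Measurable fun z => massGT L (x z) (s z) := by
  unfold massGT
  refine Measurable.tsum fun k => Measurable.ite ?_ measurable_const measurable_const
  exact measurableSet_lt hs ((measurable_pi_apply k).comp hx)

end Mass

/-- The position of the atom whose jump of the distribution function contains the level `v`. -/
def pick (L : ℕ → ℝ≥0∞) (X : ℕ → ℝ) (v : ℝ) : ℝ :=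
  ∑' k, if cdfOf L X (X k) - (L k).toReal < v ∧ v < cdfOf L X (X k) then X k else 0

/-- One step of the chain of the `D`-partition, on the local time scale. -/
def dStep (L : ℕ → ℝ≥0∞) (X : ℕ → ℝ) (s u : ℝ) : ℝ :=
  max s (pick L X (cdfOf L X s + u * (1 - cdfOf L X s)))

/-- The chain with steps `f`, driven by `U`. -/
def chain (f : ℝ → ℝ → ℝ) (s : ℝ) (U : ℕ → ℝ) : ℕ → ℝ
  | 0 => s
  | n + 1 => f (chain f s U n) (U n)

/-- The increments of mass and position along a sequence of positions. -/
def incs (L : ℕ → ℝ≥0∞) (X : ℕ → ℝ) (c : ℕ → ℝ) (j : ℕ) : ℝ × ℝ :=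
  (cdfOf L X (c (j + 1)) - cdfOf L X (c j), c (j + 1) - c j)

section Chain

variable {L : ℕ → ℝ≥0∞} {X : ℕ → ℝ}

lemma chain_seqCons (f : ℝ → ℝ → ℝ) (s u : ℝ) (U : ℕ → ℝ) (n : ℕ) :
    chain f s (seqCons u U) (n + 1) = chain f (f s u) U n := by
  induction n with
  | zero => rfl
  | succ n ih => rw [chain, ih]; rfl

lemma incs_chain_seqCons (L : ℕ → ℝ≥0∞) (X : ℕ → ℝ) (f : ℝ → ℝ → ℝ) (s u : ℝ) (U : ℕ → ℝ) :
    incs L X (chain f s (seqCons u U)) =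
      seqCons (cdfOf L X (f s u) - cdfOf L X s, f s u - s) (incs L X (chain f (f s u) U)) := by
  ext j : 1
  cases j with
  | zero => rfl
  | succ j => simp only [incs, chain_seqCons, seqCons_succ]

@[fun_prop]
lemma measurable_pick {β : Type*} [MeasurableSpace β] {l : β → ℕ → ℝ≥0∞} {x : β → ℕ → ℝ}
    {v : β → ℝ} (hl : Measurable l) (hx : Measurable x) (hv : Measurable v) :
    Measurable fun z => pick (l z) (x z) (v z) := by
  unfold pick
  have hk := fun k => (measurable_pi_apply k).comp hx
  have hlk := fun k => ((measurable_pi_apply k).comp hl).ennreal_toReal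
  have hc := fun k => measurable_cdfOf hl hx (hk k)
  refine Measurable.tsum fun k => Measurable.ite ?_ (hk k) measurable_const
  exact (measurableSet_lt ((hc k).sub (hlk k)) hv).inter (measurableSet_lt hv (hc k))

@[fun_prop]
lemma measurable_dStep {β : Type*} [MeasurableSpace β] {l : β → ℕ → ℝ≥0∞} {x : β → ℕ → ℝ}
    {s u : β → ℝ} (hl : Measurable l) (hx : Measurable x) (hs : Measurable s) (hu : Measurable u) :
    Measurable fun z => dStep (l z) (x z) (s z) (u z) := by
  unfold dStep
  fun_prop

@[fun_prop]
lemma measurable_dChain {β : Type*} [MeasurableSpace β] {l : β → ℕ → ℝ≥0∞} {x U : β → ℕ → ℝ}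
    {s : β → ℝ} (hl : Measurable l) (hx : Measurable x) (hs : Measurable s) (hU : Measurable U) :
    Measurable fun z => chain (dStep (l z) (x z)) (s z) (U z) := by
  refine measurable_pi_iff.2 fun n => ?_
  induction n with
  | zero => exact hs
  | succ n ih =>
    simp only [chain]
    exact measurable_dStep hl hx ih ((measurable_pi_apply n).comp hU)

@[fun_prop]
lemma measurable_incs {β : Type*} [MeasurableSpace β] {l : β → ℕ → ℝ≥0∞} {x c : β → ℕ → ℝ}
    (hl : Measurable l) (hx : Measurable x) (hc : Measurable c) :
    Measurable fun z => incs (l z) (x z) (c z) := by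
  refine measurable_pi_iff.2 fun n => ?_
  have := fun n => (measurable_pi_apply n).comp hc
  exact ((measurable_cdfOf hl hx (this (n + 1))).sub (measurable_cdfOf hl hx (this n))).prodMk
    ((this (n + 1)).sub (this n))

/-- The jump of the distribution function at atom `k`, if this atom lies in `(s, ∞)`. -/
def jumpGT (L : ℕ → ℝ≥0∞) (X : ℕ → ℝ) (s : ℝ) (k : ℕ) : Set ℝ :=
  if s < X k then Ioo (cdfOf L X (X k) - (L k).toReal) (cdfOf L X (X k)) else ∅

lemma jumpGT_subset (hL : ∑' k, L k = 1) (X : ℕ → ℝ) (s : ℝ) (k : ℕ) :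
    jumpGT L X s k ⊆ Ioo (cdfOf L X s) 1 := by
  unfold jumpGT
  split_ifs with h
  · exact Ioo_subset_Ioo (cdfOf_le_sub hL h) (cdfOf_le_one hL X _)
  · exact empty_subset _

lemma measurableSet_jumpGT (s : ℝ) (k : ℕ) : MeasurableSet (jumpGT L X s k) := by
  unfold jumpGT
  split_ifs <;> simp

lemma disjoint_jumps (hL : ∑' k, L k = 1) (hX : Function.Injective X) {i j : ℕ} (hij : i ≠ j) :
    Disjoint (Ioo (cdfOf L X (X i) - (L i).toReal) (cdfOf L X (X i)))
      (Ioo (cdfOf L X (X j) - (L j).toReal) (cdfOf L X (X j))) := by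
  wlog h : X i < X j generalizing i j
  · refine (this hij.symm ?_).symm
    exact lt_of_le_of_ne (not_lt.1 h) fun h' => hij (hX h').symm
  · rw [Set.disjoint_left]
    intro v hv hv'
    have := cdfOf_le_sub hL h
    linarith [hv.2, hv'.1]

lemma pairwise_disjoint_jumpGT (hL : ∑' k, L k = 1) (hX : Function.Injective X) (s : ℝ) :
    Pairwise (Function.onFun Disjoint (jumpGT L X s)) := by
  intro i j hij
  simp only [Function.onFun, jumpGT]
  split_ifs
  · exact disjoint_jumps hL hX hij
  all_goals simp

/-- The jumps beyond s are disjoint subintervals of (F(s), 1), and their total length is the mass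
beyond s, which is 1 - F(s). -/
lemma iUnion_jumpGT_ae_eq (hL : ∑' k, L k = 1) (hX : Function.Injective X) (s : ℝ) :
    (⋃ k, jumpGT L X s k : Set ℝ) =ᵐ[volume] (Ioo (cdfOf L X s) 1 : Set ℝ) := by
  refine ae_eq_of_subset_of_measure_ge (iUnion_subset fun k => jumpGT_subset hL X s k) ?_
    (MeasurableSet.iUnion fun k => measurableSet_jumpGT s k).nullMeasurableSet (by simp)
  rw [measure_iUnion (pairwise_disjoint_jumpGT hL hX s) fun k => measurableSet_jumpGT s k,
    Real.volume_Ioo, ofReal_one_sub_cdfOf hL, massGT]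
  refine ENNReal.tsum_le_tsum fun k => ?_
  unfold jumpGT
  split_ifs
  · simp [ENNReal.ofReal_toReal (mass_ne_top hL k)]
  · simp

lemma pick_eq (hL : ∑' k, L k = 1) (hX : Function.Injective X) {v : ℝ} {k : ℕ}
    (hv : v ∈ Ioo (cdfOf L X (X k) - (L k).toReal) (cdfOf L X (X k))) : pick L X v = X k := by
  unfold pick
  rw [tsum_eq_single k]
  · rw [if_pos (mem_Ioo.1 hv)]
  · intro j hj
    rw [if_neg]
    intro h
    exact Set.disjoint_left.1 (disjoint_jumps hL hX hj) h hv

/-- A uniform level in (F(s), 1) falls in the jump of an atom k beyond s with probability L k /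
massGT L X s, so a step is a size-biased pick among the atoms beyond s. -/
lemma lintegral_dStep (hL : ∑' k, L k = 1) (hX : Function.Injective X) {s : ℝ}
    (hs : cdfOf L X s < 1) (G : ℝ → ℝ≥0∞) :
    ∫⁻ u, G (dStep L X s u) ∂unif =
      ∑' k, if s < X k then L k * (G (X k) * (massGT L X s)⁻¹) else 0 := by
  have h0 : 0 < 1 - cdfOf L X s := by linarith
  unfold dStep
  rw [lintegral_unif_affine (fun v => G (max s (pick L X v))) _ h0, add_sub_cancel,
    ← setLIntegral_congr (iUnion_jumpGT_ae_eq hL hX s),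
    lintegral_iUnion (fun k => measurableSet_jumpGT s k) (pairwise_disjoint_jumpGT hL hX s),
    ← ENNReal.tsum_mul_left]
  refine tsum_congr fun k => ?_
  unfold jumpGT
  split_ifs with h
  · rw [setLIntegral_congr_fun (g := fun _ => G (X k)) measurableSet_Ioo]
    · rw [setLIntegral_const, ofReal_one_sub_cdfOf hL, Real.volume_Ioo, sub_sub_cancel,
        ENNReal.ofReal_toReal (mass_ne_top hL k)]
      ring
    · intro v hv
      simp only [pick_eq hL hX hv, max_eq_right h.le]
  · simp

lemma ae_exists_mem_jump (hL : ∑' k, L k = 1) (hX : Function.Injective X) {s : ℝ}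
    (hs : cdfOf L X s < 1) :
    ∀ᵐ u ∂unif, ∃ k, s < X k ∧ cdfOf L X s + u * (1 - cdfOf L X s) ∈
      Ioo (cdfOf L X (X k) - (L k).toReal) (cdfOf L X (X k)) := by
  have h0 : 0 < 1 - cdfOf L X s := by linarith
  have hm : MeasurableSet (⋃ k, jumpGT L X s k) :=
    MeasurableSet.iUnion fun k => measurableSet_jumpGT s k
  have h1 : ∫⁻ u, (⋃ k, jumpGT L X s k)ᶜ.indicator 1
      (cdfOf L X s + u * (1 - cdfOf L X s)) ∂unif = 0 := by
    rw [lintegral_unif_affine (fun v => (⋃ k, jumpGT L X s k)ᶜ.indicator 1 v) _ h0,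
      add_sub_cancel, ← setLIntegral_congr (iUnion_jumpGT_ae_eq hL hX s),
      setLIntegral_congr_fun (g := fun _ => 0) hm]
    · simp
    · intro v hv
      simp only [mem_compl_iff, hv, not_true, not_false_eq_true, indicator_of_notMem]
  have hmc : Measurable fun u => (⋃ k, jumpGT L X s k)ᶜ.indicator (1 : ℝ → ℝ≥0∞)
      (cdfOf L X s + u * (1 - cdfOf L X s)) :=
    (measurable_one.indicator hm.compl).comp
      (by fun_prop : Measurable fun u => cdfOf L X s + u * (1 - cdfOf L X s))
  rw [lintegral_eq_zero_iff hmc] at h1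
  filter_upwards [h1] with u hu
  have : cdfOf L X s + u * (1 - cdfOf L X s) ∈ ⋃ k, jumpGT L X s k := by
    by_contra h
    simp only [Pi.zero_apply, indicator_apply_eq_zero, mem_compl_iff, h, not_false_eq_true,
      Pi.one_apply, one_ne_zero, imp_false, not_true_eq_false] at hu
  obtain ⟨k, hk⟩ := mem_iUnion.1 this
  unfold jumpGT at hk
  split_ifs at hk with h
  · exact ⟨k, h, hk⟩
  · exact hk.elim

end Chain

end

/-! ### Moving atoms, and the law of the D-chain. -/

section

/-- `Φ` does not change if an atom moves inside the set `I`. -/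
def MoveInv {β : Type*} (I : Set ℝ) (Φ : (ℕ → ℝ) → β) : Prop :=
  ∀ X k, ∀ x ∈ I, ∀ y ∈ I, Φ (Function.update X k x) = Φ (Function.update X k y)

lemma MoveInv.mono {β : Type*} {I J : Set ℝ} {Φ : (ℕ → ℝ) → β} (h : MoveInv J Φ) (hIJ : I ⊆ J) :
    MoveInv I Φ := fun X k x hx y hy => h X k x (hIJ hx) y (hIJ hy)

lemma MoveInv.mul {I : Set ℝ} {Φ Ψ : (ℕ → ℝ) → ℝ≥0∞} (h : MoveInv I Φ) (h' : MoveInv I Ψ) :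
    MoveInv I fun X => Φ X * Ψ X := fun X k x hx y hy => by
  simp only [h X k x hx y hy, h' X k x hx y hy]

variable {L : ℕ → ℝ≥0∞}

lemma moveInv_massLE (L : ℕ → ℝ≥0∞) {I : Set ℝ} {t : ℝ} (h : I ⊆ Iic t ∨ I ⊆ Ioi t) :
    MoveInv I fun X => massLE L X t := by
  intro X k x hx y hy
  simp only [massLE]
  refine tsum_congr fun j => ?_
  rcases eq_or_ne j k with rfl | hj
  · rcases h with h | h
    · have h1 : x ≤ t := h hx
      have h2 : y ≤ t := h hy
      simp [h1, h2]
    · have h1 : t < x := h hx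
      have h2 : t < y := h hy
      simp [not_le.2 h1, not_le.2 h2]
  · simp [hj]

lemma moveInv_cdfOf (L : ℕ → ℝ≥0∞) {I : Set ℝ} {t : ℝ} (h : I ⊆ Iic t ∨ I ⊆ Ioi t) :
    MoveInv I fun X => cdfOf L X t := fun X k x hx y hy =>
  congrArg ENNReal.toReal (moveInv_massLE L h X k x hx y hy)

/-- A move within (-∞, t] does not change the distribution function at or beyond t. The jumps of
atoms at or before t end at or below F(t) ≤ v, so they cannot contain v, before or after the move.
-/
lemma moveInv_pick (hL : ∑' k, L k = 1) {X : ℕ → ℝ} {k : ℕ} {t x y v : ℝ} (hx : x ≤ t) (hy : y ≤ t)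
    (hv : cdfOf L (Function.update X k x) t ≤ v) :
    pick L (Function.update X k x) v = pick L (Function.update X k y) v := by
  have hc : ∀ r, t ≤ r → cdfOf L (Function.update X k x) r = cdfOf L (Function.update X k y) r :=
    fun r hr => moveInv_cdfOf L (I := Iic r) (Or.inl subset_rfl) X k x (hx.trans hr) y (hy.trans hr)
  have hv' : cdfOf L (Function.update X k y) t ≤ v := by rwa [← hc t le_rfl]
  unfold pick
  refine tsum_congr fun j => ?_
  rcases eq_or_ne j k with rfl | hj
  · rw [if_neg, if_neg]
    · rintro ⟨-, h⟩
      simp only [Function.update_self] at h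
      linarith [cdfOf_mono hL (Function.update X j y) hy]
    · rintro ⟨-, h⟩
      simp only [Function.update_self] at h
      linarith [cdfOf_mono hL (Function.update X j x) hx]
  · simp only [Function.update_of_ne hj]
    rcases le_or_gt t (X j) with h | h
    · rw [hc _ h]
    · rw [if_neg, if_neg]
      · rintro ⟨-, h'⟩
        linarith [cdfOf_mono hL (Function.update X k y) h.le]
      · rintro ⟨-, h'⟩
        linarith [cdfOf_mono hL (Function.update X k x) h.le]

/-- This holds for every realization, even when a level misses all jumps, because of the `max` in
`dStep`. -/
lemma le_chain_dStep (L : ℕ → ℝ≥0∞) (X : ℕ → ℝ) (t : ℝ) (U : ℕ → ℝ) (n : ℕ) :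
    t ≤ chain (dStep L X) t U n := by
  induction n with
  | zero => exact le_rfl
  | succ n ih => exact ih.trans (le_max_left _ _)

lemma moveInv_chain (hL : ∑' k, L k = 1) (t : ℝ) {U : ℕ → ℝ} (hU : ∀ n, U n ∈ Ioo (0 : ℝ) 1) :
    MoveInv (Iic t) fun X => chain (dStep L X) t U := by
  intro X k x hx y hy
  have hc : ∀ r, t ≤ r → cdfOf L (Function.update X k x) r = cdfOf L (Function.update X k y) r :=
    fun r hr => moveInv_cdfOf L (I := Iic r) (Or.inl subset_rfl) X k x
      (mem_Iic.2 (le_trans hx hr)) y (mem_Iic.2 (le_trans hy hr))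
  ext n
  induction n with
  | zero => rfl
  | succ n ih =>
    simp only at ih
    simp only [chain]
    rw [← ih]
    have hle := le_chain_dStep L (Function.update X k x) t U n
    generalize chain (dStep L (Function.update X k x)) t U n = c at hle
    unfold dStep
    rw [← hc _ hle, moveInv_pick hL hx hy]
    have h1 := cdfOf_mono hL (Function.update X k x) hle
    have h2 := cdfOf_le_one hL (Function.update X k x) c
    nlinarith [(hU n).1]

lemma moveInv_incs_chain (hL : ∑' k, L k = 1) (t : ℝ) {U : ℕ → ℝ} (hU : ∀ n, U n ∈ Ioo (0 : ℝ) 1) :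
    MoveInv (Iic t) fun X => incs L X (chain (dStep L X) t U) := by
  intro X k x hx y hy
  have h1 := moveInv_chain hL t hU X k x hx y hy
  simp only at h1
  have hc : ∀ r, t ≤ r → cdfOf L (Function.update X k x) r = cdfOf L (Function.update X k y) r :=
    fun r hr => moveInv_cdfOf L (I := Iic r) (Or.inl subset_rfl) X k x
      (mem_Iic.2 (le_trans hx hr)) y (mem_Iic.2 (le_trans hy hr))
  ext j : 1
  simp only [incs]
  rw [← h1, hc _ (le_chain_dStep _ _ _ _ _), hc _ (le_chain_dStep _ _ _ _ _)]

/-- Resample the position of atom k: it falls in (s,t] with probability t - s, and H then has the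
same value as with the atom at y. -/
lemma lintegral_massIoc_mul {s t y : ℝ} {H : (ℕ → ℝ) → ℝ≥0∞} (hH : Measurable H) {I : Set ℝ}
    (hinv : MoveInv I H) (hs : 0 ≤ s) (ht : t ≤ 1) (hI : Ioc s t ⊆ I) (hy : y ∈ I) :
    ∫⁻ X, massIoc L X s t * H X ∂unifSeq =
      ENNReal.ofReal (t - s) * ∑' k, L k * ∫⁻ X, H (Function.update X k y) ∂unifSeq := by
  have hvol : unif (Ioc s t) = ENNReal.ofReal (t - s) := by
    have h : (Ioc s t ∩ Ioo 0 1 : Set ℝ) =ᵐ[volume] (Ioc s t : Set ℝ) := by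
      have h1 : (Ioc s t ∩ Ioo 0 1 : Set ℝ) =ᵐ[volume] (Ioc s t ∩ Ioc 0 1 : Set ℝ) :=
        ae_eq_set_inter (by rfl) Ioo_ae_eq_Ioc
      rwa [inter_eq_left.2 (Ioc_subset_Ioc hs ht)] at h1
    rw [unif, Measure.restrict_apply measurableSet_Ioc, measure_congr h, Real.volume_Ioc]
  have hk : ∀ k, Measurable fun X : ℕ → ℝ => if s < X k ∧ X k ≤ t then L k * H X else 0 := by
    intro k
    refine Measurable.ite ?_ (by fun_prop) measurable_const
    exact (measurableSet_lt measurable_const (measurable_pi_apply k)).inter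
      (measurableSet_le (measurable_pi_apply k) measurable_const)
  have h1 : ∀ X, massIoc L X s t * H X = ∑' k, if s < X k ∧ X k ≤ t then L k * H X else 0 := by
    intro X
    rw [massIoc, ← ENNReal.tsum_mul_right]
    exact tsum_congr fun k => by split_ifs <;> simp
  simp only [h1]
  rw [lintegral_tsum fun k => (hk k).aemeasurable, ← ENNReal.tsum_mul_left]
  refine tsum_congr fun k => ?_
  rw [lintegral_unifSeq_update k (hk k)]
  have h2 : ∀ X, ∫⁻ x, (if s < Function.update X k x k ∧ Function.update X k x k ≤ t then
      L k * H (Function.update X k x) else 0) ∂unif =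
      (ENNReal.ofReal (t - s) * L k) * H (Function.update X k y) := by
    intro X
    rw [lintegral_congr (g := (Ioc s t).indicator fun _ => L k * H (Function.update X k y))]
    · rw [lintegral_indicator_const measurableSet_Ioc, hvol]
      ring
    · intro x
      simp only [Function.update_self, indicator, mem_Ioc]
      split_ifs with h
      · rw [hinv X k x (hI h) y hy]
      · rfl
  simp only [h2]
  have h3 : Measurable fun X => H (Function.update X k y) := hH.comp (by fun_prop)
  rw [lintegral_const_mul _ h3, mul_assoc]

/-- Integrating over the position t of atom k gives ∫ L k E[H t (X with X k = t)] dt. Since H t does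
not see where in (s,t] the atom lies, `lintegral_massIoc_mul` turns the sum over k of these
integrands into E[massIoc L X s t · H t X] / (t - s). -/
lemma lintegral_tsum_GT {s : ℝ} {H : ℝ → (ℕ → ℝ) → ℝ≥0∞} (hH : Measurable (Function.uncurry H))
    (hinv : ∀ t, MoveInv (Ioc s t) (H t)) (hs : 0 ≤ s) :
    ∫⁻ X, (∑' k, if s < X k then L k * H (X k) X else 0) ∂unifSeq =
      ∫⁻ t in Ioo s 1, (ENNReal.ofReal (t - s))⁻¹ * ∫⁻ X, massIoc L X s t * H t X ∂unifSeq := by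
  have hHu : ∀ k, Measurable fun z : ℝ × (ℕ → ℝ) => H z.1 (Function.update z.2 k z.1) := fun k =>
    hH.comp (by fun_prop : Measurable fun z : ℝ × (ℕ → ℝ) => (z.1, Function.update z.2 k z.1))
  have hHt : ∀ t, Measurable (H t) := fun t => hH.comp (by fun_prop : Measurable fun z => (t, z))
  have h1 : ∀ t ∈ Ioo s 1, (ENNReal.ofReal (t - s))⁻¹ * ∫⁻ X, massIoc L X s t * H t X ∂unifSeq =
      ∑' k, L k * ∫⁻ X, H t (Function.update X k t) ∂unifSeq := by
    intro t ht
    rw [lintegral_massIoc_mul (hHt t) (hinv t) hs ht.2.le subset_rfl ⟨ht.1, le_rfl⟩, ← mul_assoc,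
      ENNReal.inv_mul_cancel (by simpa using ht.1) (by simp), one_mul]
  rw [setLIntegral_congr_fun measurableSet_Ioo h1]
  have hk : ∀ k, Measurable fun X : ℕ → ℝ => if s < X k then L k * H (X k) X else 0 := by
    intro k
    refine Measurable.ite (measurableSet_lt measurable_const (measurable_pi_apply k)) ?_
      measurable_const
    exact (hH.comp (by fun_prop : Measurable fun X : ℕ → ℝ => (X k, X))).const_mul _
  have hint : ∀ k, Measurable fun t => ∫⁻ X, H t (Function.update X k t) ∂unifSeq := fun k =>
    Measurable.lintegral_prod_right' (hHu k)
  rw [lintegral_tsum fun k => (hk k).aemeasurable,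
    lintegral_tsum fun k => ((hint k).const_mul _).aemeasurable]
  refine tsum_congr fun k => ?_
  rw [lintegral_unifSeq_update k (hk k), lintegral_const_mul _ (hint k),
    lintegral_lintegral_swap (f := fun t X => H t (Function.update X k t)) (hHu k).aemeasurable,
    ← lintegral_const_mul]
  · refine lintegral_congr fun X => ?_
    have hset : Ioo s 1 = Ioi s ∩ Ioo 0 1 := by
      ext x
      simp only [mem_Ioo, mem_inter_iff, mem_Ioi]
      exact ⟨fun h => ⟨h.1, by linarith, h.2⟩, fun h => ⟨h.1, h.2.2⟩⟩
    have hHX : Measurable fun t => H t (Function.update X k t) :=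
      (hHu k).comp (by fun_prop : Measurable fun t => (t, X))
    rw [hset, ← Measure.restrict_restrict measurableSet_Ioi, ← unif,
      ← lintegral_const_mul _ hHX,
      ← lintegral_indicator measurableSet_Ioi]
    refine lintegral_congr fun x => ?_
    simp [indicator]
  · exact Measurable.lintegral_prod_right'
      (f := fun z : (ℕ → ℝ) × ℝ => H z.2 (Function.update z.1 k z.2))
      ((hHu k).comp measurable_swap)

/-- The increments of mass and position over consecutive intervals of lengths `p 0, p 1, …`,
starting from `s`. -/
def pairIncs (L : ℕ → ℝ≥0∞) (X : ℕ → ℝ) : (r : ℕ) → ℝ → (Fin r → ℝ) → Fin r → ℝ × ℝ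
  | 0, _, _ => Fin.elim0
  | r + 1, s, p =>
    Fin.cons (cdfOf L X (s + p 0) - cdfOf L X s, p 0) (pairIncs L X r (s + p 0) (Fin.tail p))

@[fun_prop]
lemma measurable_pairIncs {β : Type*} [MeasurableSpace β] {r : ℕ} {l : β → ℕ → ℝ≥0∞} {x : β → ℕ → ℝ}
    {s : β → ℝ} {p : β → Fin r → ℝ} (hl : Measurable l) (hx : Measurable x) (hs : Measurable s)
    (hp : Measurable p) : Measurable fun z => pairIncs (l z) (x z) r (s z) (p z) := by
  induction r generalizing s with
  | zero => exact measurable_const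
  | succ r ih =>
    have h0 : Measurable fun z => p z 0 := (measurable_pi_apply 0).comp hp
    have ht : Measurable fun z => Fin.tail (p z) :=
      measurable_pi_iff.2 fun i => (measurable_pi_apply i.succ).comp hp
    have := ih (s := fun z => s z + p z 0) (by fun_prop) ht
    simp only [pairIncs]
    fun_prop

/-- `qfac` of the first components. -/
def qfst (r : ℕ) (s : ℝ) (y : Fin r → ℝ × ℝ) : ℝ≥0∞ := qfac r s fun i => (y i).1

lemma lintegral_Ioo_add (G : ℝ → ℝ≥0∞) (s t : ℝ) :
    ∫⁻ p in Ioo 0 (t - s), G (s + p) = ∫⁻ x in Ioo s t, G x := by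
  rw [← lintegral_indicator measurableSet_Ioo, ← lintegral_indicator measurableSet_Ioo,
    ← lintegral_add_left_eq_self ((Ioo s t).indicator fun x => G x) s]
  refine lintegral_congr fun p => ?_
  simp only [indicator, mem_Ioo]
  congr 1
  ext
  constructor <;> rintro ⟨h1, h2⟩ <;> constructor <;> linarith

/-- Induction on r, splitting off the first step with `lintegral_dStep` and `lintegral_tsum_GT`. The
test function f is allowed to depend on X because the factor left by each step does; it need only be
insensitive to moves of atoms within the part of the line still to be explored. -/
theorem lintegral_dChain (hL : ∑' k, L k = 1) (hpos : ∀ k, L k ≠ 0) (r : ℕ) {s : ℝ} (hs : 0 ≤ s)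
    (hs1 : s < 1) {f : (ℕ → ℝ) → (Fin r → ℝ × ℝ) → ℝ≥0∞} (hf : Measurable (Function.uncurry f))
    (hinv : ∀ y, MoveInv (Ioc s 1) fun X => f X y) :
    ∫⁻ X, ∫⁻ U, f X (firstTerms r (incs L X (chain (dStep L X) s U))) ∂unifSeq ∂unifSeq =
      nu r (1 - s) fun p => ∫⁻ X, qfst r (1 - cdfOf L X s) (pairIncs L X r s p) *
        f X (pairIncs L X r s p) ∂unifSeq := by
  induction r generalizing s with
  | zero =>
    simp only [nu, qfst, qfac, one_mul]
    refine lintegral_congr fun X => ?_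
    rw [lintegral_congr (g := fun _ => f X (pairIncs L X 0 s Fin.elim0)) fun U => by
      congr 1; exact Subsingleton.elim _ _]
    simp
  | succ r ih =>
    set H : ℝ → (ℕ → ℝ) → ℝ≥0∞ := fun t X => (∫⁻ U, f X (Fin.cons
      (cdfOf L X t - cdfOf L X s, t - s)
      (firstTerms r (incs L X (chain (dStep L X) t U)))) ∂unifSeq) * (massGT L X s)⁻¹ with hHdef
    have hHm : Measurable (Function.uncurry H) := by
      refine Measurable.mul ?_ (by fun_prop)
      refine Measurable.lintegral_prod_right'
        (f := fun z : (ℝ × (ℕ → ℝ)) × (ℕ → ℝ) => f z.1.2 (Fin.cons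
        (cdfOf L z.1.2 z.1.1 - cdfOf L z.1.2 s, z.1.1 - s)
        (firstTerms r (incs L z.1.2 (chain (dStep L z.1.2) z.1.1 z.2))))) ?_
      exact hf.comp (by fun_prop : Measurable fun z : (ℝ × (ℕ → ℝ)) × (ℕ → ℝ) => (z.1.2,
        (Fin.cons (cdfOf L z.1.2 z.1.1 - cdfOf L z.1.2 s, z.1.1 - s)
          (firstTerms r (incs L z.1.2 (chain (dStep L z.1.2) z.1.1 z.2))) :
          Fin (r + 1) → ℝ × ℝ)))
    have hGT : ∀ t, MoveInv (Ioc s t) fun X => massGT L X s := by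
      intro t X k x hx y hy
      have h := moveInv_cdfOf L (t := s) (I := Ioc s t) (Or.inr fun z hz => hz.1) X k x hx y hy
      simp only at h ⊢
      rw [← ofReal_one_sub_cdfOf hL, ← ofReal_one_sub_cdfOf hL, h]
    have hHinv' : ∀ t ≤ 1, MoveInv (Ioc s t) (H t) := by
      intro t ht X k x hx y hy
      have hs' := moveInv_cdfOf L (t := s) (I := Ioc s t) (Or.inr fun z hz => hz.1) X k x hx y hy
      have ht' := moveInv_cdfOf L (t := t) (I := Ioc s t) (Or.inl fun z hz => hz.2) X k x hx y hy
      have hg := hGT t X k x hx y hy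
      simp only at hs' ht' hg
      simp only [hHdef]
      rw [hs', ht', hg]
      congr 1
      refine lintegral_congr_ae ?_
      filter_upwards [ae_mem_Ioo_unifSeq] with U hU
      have h3 := moveInv_incs_chain hL t hU X k x hx.2 y hy.2
      simp only at h3
      rw [h3]
      exact hinv _ X k x ⟨hx.1, hx.2.trans ht⟩ y ⟨hy.1, hy.2.trans ht⟩
    -- The move invariance of `H t` is available for t ≤ 1 only, as that of f concerns (s,1].
    -- Cutting off at 1 gives invariance for all t and changes nothing, since the atoms lie below 1.
    set H' : ℝ → (ℕ → ℝ) → ℝ≥0∞ := fun t X => (Iic (1 : ℝ)).indicator (fun t => H t X) t with hH'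
    have hH'm : Measurable (Function.uncurry H') := by
      have : Function.uncurry H' = (Prod.fst ⁻¹' Iic (1 : ℝ)).indicator (Function.uncurry H) := by
        ext z
        simp [hH', Function.uncurry, indicator]
      rw [this]
      exact hHm.indicator (measurable_fst measurableSet_Iic)
    have hH'inv : ∀ t, MoveInv (Ioc s t) (H' t) := by
      intro t X k x hx y hy
      simp only [hH', indicator]
      split_ifs with h
      · exact hHinv' t h X k x hx y hy
      · rfl
    have hstep : ∀ᵐ X ∂unifSeq,
        ∫⁻ U, f X (firstTerms (r + 1) (incs L X (chain (dStep L X) s U))) ∂unifSeq =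
        ∑' k, if s < X k then L k * H' (X k) X else 0 := by
      filter_upwards [ae_generic] with X hX
      rw [lintegral_unifSeq_cons
        (G := fun U => f X (firstTerms (r + 1) (incs L X (chain (dStep L X) s U))))
        (hf.comp (by fun_prop : Measurable fun U =>
          (X, firstTerms (r + 1) (incs L X (chain (dStep L X) s U)))))]
      simp only [incs_chain_seqCons, firstTerms_seqCons]
      rw [lintegral_dStep hL hX.injective (cdfOf_lt_one hL hpos hX hs1) (fun t => ∫⁻ U,
        f X (Fin.cons (cdfOf L X t - cdfOf L X s, t - s)
          (firstTerms r (incs L X (chain (dStep L X) t U)))) ∂unifSeq)]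
      refine tsum_congr fun k => ?_
      simp [hH', hHdef, (hX.lt_one k).le]
    rw [lintegral_congr_ae hstep, lintegral_tsum_GT hH'm hH'inv hs, nu]
    rw [← lintegral_Ioo_add]
    refine setLIntegral_congr_fun measurableSet_Ioo fun p hp => ?_
    have hsp1 : s + p < 1 := by linarith [hp.2]
    simp only [add_sub_cancel_left]
    congr 1
    have e1 : ∀ X, massIoc L X s (s + p) * H' (s + p) X =
        ∫⁻ U, (massIoc L X s (s + p) * (massGT L X s)⁻¹) * f X (Fin.cons
          (cdfOf L X (s + p) - cdfOf L X s, p)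
          (firstTerms r (incs L X (chain (dStep L X) (s + p) U)))) ∂unifSeq := by
      intro X
      rw [lintegral_const_mul]
      · simp only [hH', hHdef, indicator, mem_Iic, hsp1.le, if_true, add_sub_cancel_left]
        ring
      · exact hf.comp (by fun_prop : Measurable fun U => (X, (Fin.cons
          (cdfOf L X (s + p) - cdfOf L X s, p)
          (firstTerms r (incs L X (chain (dStep L X) (s + p) U))) : Fin (r + 1) → ℝ × ℝ)))
    simp only [e1]
    -- The ratio of the mass of (s, s+p] to the mass beyond s is the first factor of `qfst`. It
    -- depends on X only through F(s) and F(s+p), so it can be absorbed into the test function.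
    rw [ih (by linarith [hp.1]) hsp1 (f := fun X y => (massIoc L X s (s + p) * (massGT L X s)⁻¹) *
      f X (Fin.cons (cdfOf L X (s + p) - cdfOf L X s, p) y))]
    · rw [sub_add_eq_sub_sub]
      congr 1
      ext p'
      refine lintegral_congr fun X => ?_
      simp only [qfst, pairIncs, qfac, Fin.cons_zero, Fin.tail_cons]
      have : (Fin.tail fun i => ((Fin.cons (cdfOf L X (s + p) - cdfOf L X s, p)
          (pairIncs L X r (s + p) p') : Fin (r + 1) → ℝ × ℝ) i).1) =
          fun i => (pairIncs L X r (s + p) p' i).1 := by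
        ext i
        simp [Fin.tail]
      rw [this, ofReal_cdfOf_sub hL X (by linarith [hp.1] : s ≤ s + p), ofReal_one_sub_cdfOf hL,
        sub_sub_sub_cancel_right, ENNReal.div_eq_inv_mul]
      ring
    · refine Measurable.mul (by fun_prop) (hf.comp (by fun_prop :
        Measurable fun z : (ℕ → ℝ) × (Fin r → ℝ × ℝ) => (z.1, (Fin.cons
          (cdfOf L z.1 (s + p) - cdfOf L z.1 s, p) z.2 : Fin (r + 1) → ℝ × ℝ))))
    · intro y X k x hx x' hx'
      have hle : s ≤ s + p := by linarith [hp.1]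
      have hs' := moveInv_cdfOf L (t := s) (I := Ioc (s + p) 1)
        (Or.inr fun z hz => hle.trans_lt hz.1) X k x hx x' hx'
      have ht' := moveInv_cdfOf L (t := s + p) (I := Ioc (s + p) 1) (Or.inr fun z hz => hz.1)
        X k x hx x' hx'
      have hsub : Ioc (s + p) 1 ⊆ Ioc s 1 := Ioc_subset_Ioc_left hle
      have hg := hGT 1 X k x (hsub hx) x' (hsub hx')
      simp only at hs' ht' hg
      simp only
      rw [← ofReal_cdfOf_sub hL _ hle, ← ofReal_cdfOf_sub hL _ hle, hs', ht', hg]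
      congr 1
      exact hinv _ X k x (hsub hx) x' (hsub hx')

end

/-! ### Exchangeable increments, the two biased-sampling identities, and the first-length
comparison. -/

section

variable {L : ℕ → ℝ≥0∞}

lemma unif_Ioc {s t : ℝ} (hs : 0 ≤ s) (ht : t ≤ 1) : unif (Ioc s t) = ENNReal.ofReal (t - s) := by
  have h : (Ioc s t ∩ Ioo 0 1 : Set ℝ) =ᵐ[volume] (Ioc s t : Set ℝ) := by
    have h1 : (Ioc s t ∩ Ioo 0 1 : Set ℝ) =ᵐ[volume] (Ioc s t ∩ Ioc 0 1 : Set ℝ) :=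
      ae_eq_set_inter (by rfl) Ioo_ae_eq_Ioc
    rwa [inter_eq_left.2 (Ioc_subset_Ioc hs ht)] at h1
  rw [unif, Measure.restrict_apply measurableSet_Ioc, measure_congr h, Real.volume_Ioc]

/-- Number `i + 1` if `x` is in the interval number `i` of the list, `0` if there is none. -/
def labelOf {r : ℕ} (I : Fin r → Set ℝ) (x : ℝ) : ℕ :=
  ∑ i : Fin r, (I i).indicator (fun _ => (i : ℕ) + 1) x

lemma labelOf_of_mem {r : ℕ} {I : Fin r → Set ℝ} (hI : Pairwise (Function.onFun Disjoint I))
    {x : ℝ} {i : Fin r} (hx : x ∈ I i) : labelOf I x = i + 1 := by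
  rw [labelOf, Finset.sum_eq_single i, indicator_of_mem hx]
  · intro j _ hj
    exact indicator_of_notMem (fun h => Set.disjoint_left.1 (hI hj) h hx) _
  · simp

lemma labelOf_of_notMem {r : ℕ} {I : Fin r → Set ℝ} {x : ℝ} (hx : ∀ i, x ∉ I i) :
    labelOf I x = 0 :=
  Finset.sum_eq_zero fun i _ => indicator_of_notMem (hx i) _

lemma labelOf_eq_iff {r : ℕ} {I : Fin r → Set ℝ} (hI : Pairwise (Function.onFun Disjoint I))
    {x : ℝ} {i : Fin r} : labelOf I x = i + 1 ↔ x ∈ I i := by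
  refine ⟨fun h => ?_, labelOf_of_mem hI⟩
  by_cases hx : ∃ j, x ∈ I j
  · obtain ⟨j, hj⟩ := hx
    rw [labelOf_of_mem hI hj] at h
    have : j = i := Fin.ext (by omega)
    rwa [← this]
  · push Not at hx
    rw [labelOf_of_notMem hx] at h
    omega

lemma measurable_labelOf {r : ℕ} {I : Fin r → Set ℝ} (hI : ∀ i, MeasurableSet (I i)) :
    Measurable (labelOf I) :=
  Finset.measurable_sum _ fun i _ => measurable_const.indicator (hI i)

lemma map_labelOf_singleton {r : ℕ} {I : Fin r → Set ℝ} (hI : Pairwise (Function.onFun Disjoint I))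
    (hIm : ∀ i, MeasurableSet (I i)) (n : ℕ) :
    unif.map (labelOf I) {n} = if n = 0 then 1 - ∑ i, unif (I i) else
      if h : n - 1 < r then unif (I ⟨n - 1, h⟩) else 0 := by
  rw [Measure.map_apply (measurable_labelOf hIm) (measurableSet_singleton n)]
  split_ifs with h0 h
  · have : labelOf I ⁻¹' {n} = (⋃ i, I i)ᶜ := by
      ext x
      simp only [mem_preimage, mem_singleton_iff, mem_compl_iff, mem_iUnion, not_exists, h0]
      constructor
      · intro h i hi
        rw [labelOf_of_mem hI hi] at h
        omega
      · exact labelOf_of_notMem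
    rw [this, prob_compl_eq_one_sub (MeasurableSet.iUnion hIm), measure_iUnion hI hIm, tsum_fintype]
  · congr 1
    ext x
    rw [← labelOf_eq_iff hI]
    simp only [mem_preimage, mem_singleton_iff]
    omega
  · convert measure_empty (μ := unif)
    ext x
    simp only [mem_preimage, mem_singleton_iff, mem_empty_iff_false, iff_false]
    by_cases hx : ∃ j, x ∈ I j
    · obtain ⟨j, hj⟩ := hx
      rw [labelOf_of_mem hI hj]
      omega
    · push Not at hx
      rw [labelOf_of_notMem hx]
      omega

/-- The labels of the independent uniform points are independent, with a common law given by the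
probabilities of the disjoint sets alone. -/
lemma lintegral_labels {r : ℕ} {I I' : Fin r → Set ℝ} (hI : Pairwise (Function.onFun Disjoint I))
    (hI' : Pairwise (Function.onFun Disjoint I')) (hIm : ∀ i, MeasurableSet (I i))
    (hIm' : ∀ i, MeasurableSet (I' i)) (h : ∀ i, unif (I i) = unif (I' i))
    {G : (ℕ → ℕ) → ℝ≥0∞} (hG : Measurable G) :
    ∫⁻ X, G (fun k => labelOf I (X k)) ∂unifSeq = ∫⁻ X, G (fun k => labelOf I' (X k)) ∂unifSeq := by
  have hmap : ∀ {J : Fin r → Set ℝ}, (∀ i, MeasurableSet (J i)) →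
      Measurable fun (X : ℕ → ℝ) (k : ℕ) => labelOf J (X k) := fun hJ =>
    measurable_pi_iff.2 fun k => (measurable_labelOf hJ).comp (measurable_pi_apply k)
  have hlaw : unif.map (labelOf I) = unif.map (labelOf I') := by
    refine Measure.ext_of_singleton fun n => ?_
    simp only [map_labelOf_singleton hI hIm, map_labelOf_singleton hI' hIm', h]
  have key : unifSeq.map (fun X k => labelOf I (X k)) = unifSeq.map fun X k => labelOf I' (X k) := by
    have e := Measure.infinitePi_map_pi (fun _ : ℕ => unif) fun _ => measurable_labelOf hIm
    have e' := Measure.infinitePi_map_pi (fun _ : ℕ => unif) fun _ => measurable_labelOf hIm'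
    rw [unifSeq, e, e']
    simp only [hlaw]
  rw [← lintegral_map hG (hmap hIm), key, lintegral_map hG (hmap hIm')]

/-- F has exchangeable increments: the masses of disjoint intervals depend only on which atom falls
in which interval, and the law of this assignment depends only on the interval lengths. -/
lemma lintegral_incs_eq (hL : ∑' k, L k = 1) {r : ℕ} {c c' : ℕ → ℝ} (hc : Monotone c)
    (hc' : Monotone c') (h0 : 0 ≤ c 0) (h0' : 0 ≤ c' 0) (h1 : ∀ n, c n ≤ 1) (h1' : ∀ n, c' n ≤ 1)
    {e e' : Fin r → ℕ} (he : Function.Injective e) (he' : Function.Injective e')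
    (hee : ∀ i, c (e i + 1) - c (e i) = c' (e' i + 1) - c' (e' i))
    {g : (Fin r → ℝ × ℝ) → ℝ≥0∞} (hg : Measurable g) :
    ∫⁻ X, g (fun i => incs L X c (e i)) ∂unifSeq =
      ∫⁻ X, g (fun i => incs L X c' (e' i)) ∂unifSeq := by
  have hdisj : ∀ {c : ℕ → ℝ} (hc : Monotone c) {e : Fin r → ℕ} (he : Function.Injective e),
      Pairwise (Function.onFun Disjoint fun i => Ioc (c (e i)) (c (e i + 1))) := by
    intro c hc e he i j hij
    exact hc.pairwise_disjoint_on_Ioc_succ fun h => hij (he h)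
  -- `G` computes the masses from the labels. Interval i has label i + 1, as 0 marks the points in
  -- none of the intervals.
  set G : (ℕ → ℕ) → ℝ≥0∞ := fun y => g fun i =>
    ((∑' k, if y k = (i : ℕ) + 1 then L k else 0).toReal, c (e i + 1) - c (e i)) with hG
  have hGm : Measurable G := by
    refine hg.comp (measurable_pi_iff.2 fun i => Measurable.prodMk ?_ measurable_const)
    refine (Measurable.tsum fun k => Measurable.ite ?_ measurable_const
      measurable_const).ennreal_toReal
    exact measurableSet_eq_fun (measurable_pi_apply k) measurable_const
  have key : ∀ {c₁ : ℕ → ℝ} (hc : Monotone c₁) {e₁ : Fin r → ℕ} (he : Function.Injective e₁)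
      (h : ∀ i, c₁ (e₁ i + 1) - c₁ (e₁ i) = c (e i + 1) - c (e i)) (X : ℕ → ℝ),
      g (fun i => incs L X c₁ (e₁ i)) =
        G fun k => labelOf (fun i => Ioc (c₁ (e₁ i)) (c₁ (e₁ i + 1))) (X k) := by
    intro c₁ hc₁ e₁ he₁ h X
    simp only [hG]
    congr 1
    ext i : 1
    simp only [incs, labelOf_eq_iff (hdisj hc₁ he₁), h]
    congr 1
    have hle := hc₁ (Nat.le_succ (e₁ i))
    rw [← ENNReal.toReal_ofReal (sub_nonneg.2 (cdfOf_mono hL X hle)), Nat.succ_eq_add_one,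
      ofReal_cdfOf_sub hL X hle]
    rfl
  have k1 := key hc he fun _ => rfl
  have k2 := key hc' he' fun i => (hee i).symm
  simp only [k1, k2]
  refine lintegral_labels (hdisj hc he) (hdisj hc' he') (fun _ => measurableSet_Ioc)
    (fun _ => measurableSet_Ioc) (fun i => ?_) hGm
  rw [unif_Ioc (h0.trans (hc (Nat.zero_le _))) (h1 _),
    unif_Ioc (h0'.trans (hc' (Nat.zero_le _))) (h1' _), hee]

/-- Partial sums of a finite sequence, starting from `s`. -/
def cumSum {r : ℕ} (s : ℝ) (p : Fin r → ℝ) (n : ℕ) : ℝ :=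
  s + ∑ l ∈ Finset.range n, if h : l < r then p ⟨l, h⟩ else 0

lemma cumSum_succ {r : ℕ} (s : ℝ) (p : Fin (r + 1) → ℝ) (n : ℕ) :
    cumSum s p (n + 1) = cumSum (s + p 0) (Fin.tail p) n := by
  simp only [cumSum, Finset.sum_range_succ', Nat.zero_lt_succ, dif_pos, Nat.add_lt_add_iff_right]
  simp only [Fin.tail]
  have : (⟨0, Nat.zero_lt_succ r⟩ : Fin (r + 1)) = 0 := rfl
  rw [this]
  have h2 : ∀ l, (if h : l < r then p ⟨l + 1, by omega⟩ else 0) =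
      if h : l < r then p (Fin.succ ⟨l, h⟩) else 0 := fun l => rfl
  simp only [h2]
  ring

lemma pairIncs_eq (L : ℕ → ℝ≥0∞) (X : ℕ → ℝ) (r : ℕ) (s : ℝ) (p : Fin r → ℝ) :
    pairIncs L X r s p = fun i : Fin r => incs L X (cumSum s p) i := by
  induction r generalizing s with
  | zero => exact Subsingleton.elim _ _
  | succ r ih =>
    have h0 : cumSum s p 0 = s := by simp [cumSum]
    ext i : 1
    refine Fin.cases ?_ (fun i => ?_) i
    · simp only [pairIncs, Fin.cons_zero, incs, Fin.val_zero, zero_add, cumSum_succ, h0]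
      simp [cumSum]
    · simp only [pairIncs, Fin.cons_succ, ih, incs, Fin.val_succ, cumSum_succ]

lemma pairIncs_snd (L : ℕ → ℝ≥0∞) (X : ℕ → ℝ) (r : ℕ) (s : ℝ) (p : Fin r → ℝ) (i : Fin r) :
    (pairIncs L X r s p i).2 = p i := by
  simp [pairIncs_eq, incs, cumSum, Finset.sum_range_succ]

lemma tLevel_succ_sub (U : ℕ → ℝ) (n : ℕ) : tLevel U (n + 1) - tLevel U n = stick 1 U n := by
  simp only [tLevel, stick, Finset.prod_range_succ]
  ring

lemma tLevel_zero (U : ℕ → ℝ) : tLevel U 0 = 0 := by simp [tLevel]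

lemma stick_pos {U : ℕ → ℝ} (hU : ∀ k, U k ∈ Ioo (0 : ℝ) 1) (n : ℕ) : 0 < stick 1 U n := by
  unfold stick
  have : 0 < ∏ i ∈ Finset.range n, (1 - U i) :=
    Finset.prod_pos fun i _ => by linarith [(hU i).2]
  have := (hU n).1
  positivity

lemma tLevel_strictMono {U : ℕ → ℝ} (hU : ∀ k, U k ∈ Ioo (0 : ℝ) 1) : StrictMono (tLevel U) :=
  strictMono_nat_of_lt_succ fun n => by linarith [tLevel_succ_sub U n, stick_pos hU n]

lemma tLevel_lt_one {U : ℕ → ℝ} (hU : ∀ k, U k ∈ Ioo (0 : ℝ) 1) (n : ℕ) : tLevel U n < 1 := by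
  have : 0 < ∏ i ∈ Finset.range n, (1 - U i) :=
    Finset.prod_pos fun i _ => by linarith [(hU i).2]
  simp only [tLevel]
  linarith

lemma tLevel_nonneg {U : ℕ → ℝ} (hU : ∀ k, U k ∈ Ioo (0 : ℝ) 1) (n : ℕ) : 0 ≤ tLevel U n := by
  rw [← tLevel_zero U]
  exact (tLevel_strictMono hU).monotone (Nat.zero_le n)

lemma sum_tLevel (U : ℕ → ℝ) (n : ℕ) : ∑ i ∈ Finset.range n, stick 1 U i = tLevel U n := by
  simp only [← tLevel_succ_sub]
  rw [Finset.sum_range_sub, tLevel_zero, sub_zero]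

@[fun_prop]
lemma measurable_tLevel {β : Type*} [MeasurableSpace β] {U : β → ℕ → ℝ} (hU : Measurable U) :
    Measurable fun z => tLevel (U z) := by
  refine measurable_pi_iff.2 fun n => ?_
  unfold tLevel
  fun_prop

lemma measurable_lintegral_pairIncs {r : ℕ} {f : (Fin r → ℝ × ℝ) → ℝ≥0∞} (hf : Measurable f) :
    Measurable fun p : Fin r → ℝ => ∫⁻ X, f (pairIncs L X r 0 p) ∂unifSeq :=
  Measurable.lintegral_prod_right'
    (f := fun z : (Fin r → ℝ) × (ℕ → ℝ) => f (pairIncs L z.2 r 0 z.1)) (hf.comp (by fun_prop))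

/-- By exchangeability of the increments, the chosen intervals may be placed side by side starting
at 0, in the order given by e. -/
lemma lintegral_incs_tLevel (hL : ∑' k, L k = 1) {r : ℕ} {U : ℕ → ℝ}
    (hU : ∀ k, U k ∈ Ioo (0 : ℝ) 1) {e : Fin r → ℕ} (he : Function.Injective e)
    {f : (Fin r → ℝ × ℝ) → ℝ≥0∞} (hf : Measurable f) :
    ∫⁻ X, f (fun i => incs L X (tLevel U) (e i)) ∂unifSeq =
      ∫⁻ X, f (pairIncs L X r 0 fun i => stick 1 U (e i)) ∂unifSeq := by
  simp only [pairIncs_eq]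
  set p : Fin r → ℝ := fun i => stick 1 U (e i) with hp
  have hcm : Monotone (cumSum 0 p) := by
    refine monotone_nat_of_le_succ fun n => ?_
    simp only [cumSum, Finset.sum_range_succ]
    have : 0 ≤ if h : n < r then p ⟨n, h⟩ else 0 := by
      split_ifs
      · exact (stick_pos hU _).le
      · exact le_rfl
    linarith
  have hsum : ∑ i, p i ≤ 1 := by
    obtain ⟨N, hN⟩ : ∃ N, ∀ i, e i < N :=
      ⟨Finset.univ.sup e + 1, fun i => Nat.lt_succ_of_le (Finset.le_sup (Finset.mem_univ i))⟩
    calc ∑ i, p i = ∑ j ∈ Finset.univ.map ⟨e, he⟩, stick 1 U j := by simp [hp]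
      _ ≤ ∑ j ∈ Finset.range N, stick 1 U j := by
          refine Finset.sum_le_sum_of_subset_of_nonneg ?_ fun j _ _ => (stick_pos hU j).le
          intro j hj
          simp only [Finset.mem_map, Finset.mem_univ, Function.Embedding.coeFn_mk, true_and] at hj
          obtain ⟨i, rfl⟩ := hj
          exact Finset.mem_range.2 (hN i)
      _ ≤ 1 := by
          rw [sum_tLevel]
          exact (tLevel_lt_one hU N).le
  have hle : ∀ n, cumSum 0 p n ≤ 1 := by
    intro n
    refine (hcm (Nat.le_add_right n r)).trans ?_
    refine le_trans (le_of_eq ?_) hsum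
    simp only [cumSum, zero_add]
    rw [← Finset.sum_subset (Finset.range_mono (Nat.le_add_left r n)), Finset.sum_range]
    · exact Finset.sum_congr rfl fun i _ => by simp
    · intro i _ hi
      simp only [Finset.mem_range] at hi
      simp [hi]
  refine lintegral_incs_eq hL (tLevel_strictMono hU).monotone hcm (tLevel_zero U).ge
    (by simp [cumSum]) (fun n => (tLevel_lt_one hU n).le) hle he Fin.val_injective (fun i => ?_) hf
  rw [tLevel_succ_sub]
  simp [cumSum, Finset.sum_range_succ, hp]

/-- For fixed U, averaging over X leaves a function of the chosen pieces only
(`lintegral_incs_tLevel`); the sum over tuples of distinct pieces is then evaluated by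
`lintegral_injSum_stick`. -/
theorem lintegral_injSum_tLevel (hL : ∑' k, L k = 1) (r : ℕ) {f : (Fin r → ℝ × ℝ) → ℝ≥0∞}
    (hf : Measurable f) :
    ∫⁻ X, ∫⁻ U, injSum r (incs L X (tLevel U)) f ∂unifSeq ∂unifSeq =
      nu r 1 fun p => ∫⁻ X, f (pairIncs L X r 0 p) ∂unifSeq := by
  have hm : Measurable fun z : (ℕ → ℝ) × (ℕ → ℝ) => injSum r (incs L z.1 (tLevel z.2)) f :=
    measurable_injSum (by fun_prop) (hf.comp measurable_snd)
  rw [lintegral_lintegral_swap hm.aemeasurable,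
    ← lintegral_injSum_stick r one_pos (measurable_lintegral_pairIncs hf)]
  refine lintegral_congr_ae ?_
  filter_upwards [ae_mem_Ioo_unifSeq] with U hU
  have hfj : ∀ j : Fin r → ℕ, Measurable fun X : ℕ → ℝ => f fun i => incs L X (tLevel U) (j i) :=
    fun j => hf.comp (measurable_pi_iff.2 fun i => (measurable_pi_apply (j i)).comp
      (measurable_incs measurable_const measurable_id measurable_const))
  unfold injSum
  rw [lintegral_tsum]
  · refine tsum_congr fun j => ?_
    by_cases hj : Function.Injective j
    · simp only [mem_ofPred_eq, hj, indicator_of_mem]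
      exact lintegral_incs_tLevel hL hU hj hf
    · simp [hj]
  · intro j
    by_cases hj : Function.Injective j
    · simp only [mem_ofPred_eq, hj, indicator_of_mem]
      exact (hfj j).aemeasurable
    · simp only [mem_ofPred_eq, hj, not_false_eq_true, indicator_of_notMem]
      exact aemeasurable_const

theorem lintegral_firstTerms_tLevel (hL : ∑' k, L k = 1) (r : ℕ) {f : (Fin r → ℝ × ℝ) → ℝ≥0∞}
    (hf : Measurable f) :
    ∫⁻ X, ∫⁻ U, f (firstTerms r (incs L X (tLevel U))) ∂unifSeq ∂unifSeq =
      nu r 1 fun p => qfac r 1 p * ∫⁻ X, f (pairIncs L X r 0 p) ∂unifSeq := by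
  have hm : Measurable fun z : (ℕ → ℝ) × (ℕ → ℝ) => f (firstTerms r (incs L z.1 (tLevel z.2))) :=
    hf.comp (by fun_prop)
  rw [lintegral_lintegral_swap hm.aemeasurable,
    ← lintegral_stick_firstTerms r one_pos (measurable_lintegral_pairIncs hf)]
  refine lintegral_congr_ae ?_
  filter_upwards [ae_mem_Ioo_unifSeq] with U hU
  exact lintegral_incs_tLevel hL hU Fin.val_injective hf

/-- `qfac` of the second components. -/
def qsnd (r : ℕ) (s : ℝ) (y : Fin r → ℝ × ℝ) : ℝ≥0∞ := qfac r s fun i => (y i).2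

@[fun_prop]
lemma measurable_qfst {r : ℕ} (s : ℝ) : Measurable (qfst r s) := by
  unfold qfst
  exact measurable_qfac measurable_const
    (measurable_pi_iff.2 fun i => measurable_fst.comp (measurable_pi_apply i))

@[fun_prop]
lemma measurable_qsnd {r : ℕ} (s : ℝ) : Measurable (qsnd r s) := by
  unfold qsnd
  exact measurable_qfac measurable_const
    (measurable_pi_iff.2 fun i => measurable_snd.comp (measurable_pi_apply i))

lemma qfac_ne_top {r : ℕ} {s : ℝ} {p : Fin r → ℝ} (hp : ∀ i, 0 < p i) (hs : ∑ i, p i < s) :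
    qfac r s p ≠ ∞ := by
  induction r generalizing s with
  | zero => simp [qfac]
  | succ r ih =>
    rw [Fin.sum_univ_succ] at hs
    have h0 : 0 ≤ ∑ i : Fin r, p i.succ := Finset.sum_nonneg fun i _ => (hp _).le
    refine ENNReal.mul_ne_top (ENNReal_div_ofReal_ne_top (by linarith [hp 0])) (ih
      (fun i => hp i.succ) ?_)
    simp only [Fin.tail]
    linarith

/-- The `T`-sequence is in local-time-biased order, in terms of sums over distinct terms. -/
theorem tLevel_biased (hL : ∑' k, L k = 1) (r : ℕ) {f : (Fin r → ℝ × ℝ) → ℝ≥0∞}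
    (hf : Measurable f) :
    ∫⁻ X, ∫⁻ U, f (firstTerms r (incs L X (tLevel U))) ∂unifSeq ∂unifSeq =
      ∫⁻ X, ∫⁻ U, injSum r (incs L X (tLevel U)) (fun y => qsnd r 1 y * f y) ∂unifSeq ∂unifSeq := by
  rw [lintegral_firstTerms_tLevel hL r hf, lintegral_injSum_tLevel hL r (by fun_prop)]
  refine nu_congr (fun p hp hs => ?_) one_pos
  simp only [qsnd, pairIncs_snd]
  rw [lintegral_const_mul' _ _ (qfac_ne_top hp hs)]

lemma cdfOf_zero {X : ℕ → ℝ} (hX : ∀ k, 0 < X k) : cdfOf L X 0 = 0 := by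
  simp [cdfOf, massLE, not_le.2 (hX _)]

/-- The `D`-sequence is a length-biased ordering of the terms of the `T`-sequence, in terms of sums
over distinct terms. -/
theorem dChain_biased (hL : ∑' k, L k = 1) (hpos : ∀ k, L k ≠ 0) (r : ℕ)
    {f : (Fin r → ℝ × ℝ) → ℝ≥0∞} (hf : Measurable f) :
    ∫⁻ X, ∫⁻ U, f (firstTerms r (incs L X (chain (dStep L X) 0 U))) ∂unifSeq ∂unifSeq =
      ∫⁻ X, ∫⁻ U, injSum r (incs L X (tLevel U)) (fun y => qfst r 1 y * f y) ∂unifSeq ∂unifSeq := by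
  rw [lintegral_injSum_tLevel hL r (by fun_prop), lintegral_dChain hL hpos r le_rfl one_pos
    (f := fun _ y => f y) (hf.comp measurable_snd) fun y X k x _ x' _ => rfl]
  rw [sub_zero]
  congr 1
  ext p
  refine lintegral_congr_ae ?_
  filter_upwards [ae_generic] with X hX
  rw [cdfOf_zero hX.pos, sub_zero]

/-- By `lintegral_massIoc_mul`, the integrals over (s,t] and (s,1] are t - s and 1 - s times the
same sum, in which atom k is placed at 1. -/
lemma lintegral_massGT_mul {s t : ℝ} {H : (ℕ → ℝ) → ℝ≥0∞}
    (hH : Measurable H) (hinv : MoveInv (Ioc s 1) H) (hs : 0 ≤ s) (hst : s < t) (ht : t ≤ 1) :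
    ∫⁻ X, massIoc L X s t * H X ∂unifSeq = ENNReal.ofReal (t - s) / ENNReal.ofReal (1 - s) *
      ∫⁻ X, massGT L X s * H X ∂unifSeq := by
  have hs1 : s < 1 := hst.trans_le ht
  have h1 : ∫⁻ X, massGT L X s * H X ∂unifSeq = ∫⁻ X, massIoc L X s 1 * H X ∂unifSeq := by
    refine lintegral_congr_ae ?_
    filter_upwards [ae_generic] with X hX
    simp [massGT, massIoc, (hX.lt_one _).le]
  rw [h1, lintegral_massIoc_mul hH hinv hs ht (Ioc_subset_Ioc_right ht) (y := 1) ⟨hs1, le_rfl⟩,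
    lintegral_massIoc_mul hH hinv hs le_rfl subset_rfl (y := 1) ⟨hs1, le_rfl⟩, ← mul_assoc,
    ENNReal.div_mul_cancel (by simpa using hs1) (by simp)]

/-- Averaging over the positions replaces mass ratios by length ratios on the local time scale. The
factors beyond s + p 0 are averaged first, with the first factor absorbed in H; then
`lintegral_massGT_mul` treats the first factor. -/
theorem lintegral_qfst_mul (hL : ∑' k, L k = 1) (hpos : ∀ k, L k ≠ 0) {r : ℕ} {s : ℝ} (hs : 0 ≤ s)
    {p : Fin r → ℝ} (hp : ∀ i, 0 < p i) (hps : ∑ i, p i < 1 - s) {H : (ℕ → ℝ) → ℝ≥0∞}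
    (hH : Measurable H) (hinv : MoveInv (Ioc s 1) H) :
    ∫⁻ X, qfst r (1 - cdfOf L X s) (pairIncs L X r s p) * H X ∂unifSeq =
      qfac r (1 - s) p * ∫⁻ X, H X ∂unifSeq := by
  induction r generalizing s H with
  | zero => simp [qfst, qfac]
  | succ r ih =>
    rw [Fin.sum_univ_succ] at hps
    have h0 : 0 ≤ ∑ i : Fin r, p i.succ := Finset.sum_nonneg fun i _ => (hp _).le
    have hp0 := hp 0
    have hle : s ≤ s + p 0 := by linarith
    have hsub : Ioc (s + p 0) 1 ⊆ Ioc s 1 := Ioc_subset_Ioc_left hle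
    have hGTinv : MoveInv (Ioc s 1) fun X => (massGT L X s)⁻¹ := by
      intro X k x hx y hy
      have h := moveInv_cdfOf L (t := s) (I := Ioc s 1) (Or.inr fun z hz => hz.1) X k x hx y hy
      simp only at h ⊢
      rw [← ofReal_one_sub_cdfOf hL, ← ofReal_one_sub_cdfOf hL, h]
    have hIoc : MoveInv (Ioc (s + p 0) 1) fun X => massIoc L X s (s + p 0) := by
      intro X k x hx y hy
      have h := moveInv_cdfOf L (t := s) (I := Ioc s 1) (Or.inr fun z hz => hz.1) X k x (hsub hx) y
        (hsub hy)
      have h' := moveInv_cdfOf L (t := s + p 0) (I := Ioc (s + p 0) 1) (Or.inr fun z hz => hz.1)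
        X k x hx y hy
      simp only at h h' ⊢
      rw [← ofReal_cdfOf_sub hL _ hle, ← ofReal_cdfOf_sub hL _ hle, h, h']
    have e1 : ∀ X, qfst (r + 1) (1 - cdfOf L X s) (pairIncs L X (r + 1) s p) * H X =
        qfst r (1 - cdfOf L X (s + p 0)) (pairIncs L X r (s + p 0) (Fin.tail p)) *
          (massIoc L X s (s + p 0) * ((massGT L X s)⁻¹ * H X)) := by
      intro X
      simp only [qfst, pairIncs, qfac, Fin.cons_zero]
      have : (Fin.tail fun i => ((Fin.cons (cdfOf L X (s + p 0) - cdfOf L X s, p 0)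
          (pairIncs L X r (s + p 0) (Fin.tail p)) : Fin (r + 1) → ℝ × ℝ) i).1) =
          fun i => (pairIncs L X r (s + p 0) (Fin.tail p) i).1 := by
        ext i
        simp [Fin.tail]
      rw [this, ofReal_cdfOf_sub hL X hle, ofReal_one_sub_cdfOf hL, sub_sub_sub_cancel_right,
        ENNReal.div_eq_inv_mul]
      ring
    simp only [e1]
    have hH' : Measurable fun X => (massGT L X s)⁻¹ * H X := by fun_prop
    rw [ih (p := Fin.tail p) (by linarith) (fun i => hp i.succ) (by simp only [Fin.tail]; linarith) (by fun_prop)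
      (hIoc.mul ((hGTinv.mul hinv).mono hsub)),
      lintegral_massGT_mul hH' (hGTinv.mul hinv) hs (by linarith) (by linarith)]
    have e2 : ∫⁻ X, massGT L X s * ((massGT L X s)⁻¹ * H X) ∂unifSeq = ∫⁻ X, H X ∂unifSeq := by
      refine lintegral_congr_ae ?_
      filter_upwards [ae_generic] with X hX
      rw [← mul_assoc, ENNReal.mul_inv_cancel (massGT_ne_zero hpos hX (by linarith))
        (massGT_ne_top hL X s), one_mul]
    rw [e2, add_sub_cancel_left, qfac, sub_add_eq_sub_sub]
    ring

/-- If g involves only the local times p, the weight `qfst` in `lintegral_dChain` averages to `qfac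
r 1 p`, which is the density of stick-breaking with respect to `nu`. -/
theorem lintegral_dChain_snd (hL : ∑' k, L k = 1) (hpos : ∀ k, L k ≠ 0) (r : ℕ)
    {g : (Fin r → ℝ) → ℝ≥0∞} (hg : Measurable g) :
    ∫⁻ X, ∫⁻ U, g (fun i => (incs L X (chain (dStep L X) 0 U) i).2) ∂unifSeq ∂unifSeq =
      ∫⁻ U, g (firstTerms r (stick 1 U)) ∂unifSeq := by
  have hm : Measurable fun y : Fin r → ℝ × ℝ => g fun i => (y i).2 :=
    hg.comp (measurable_pi_iff.2 fun i => measurable_snd.comp (measurable_pi_apply i))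
  rw [lintegral_stick_firstTerms r one_pos hg]
  refine (lintegral_dChain hL hpos r le_rfl one_pos (f := fun _ y => g fun i => (y i).2)
    (hm.comp measurable_snd) fun y X k x _ x' _ => rfl).trans ?_
  rw [sub_zero]
  refine nu_congr (fun p hp hs => ?_) one_pos
  simp only [pairIncs_snd]
  rw [lintegral_qfst_mul hL hpos le_rfl hp (by simpa using hs) measurable_const
    fun X k x _ x' _ => rfl, lintegral_const, measure_univ, mul_one, sub_zero]

lemma lintegral_massIoc (hL : ∑' k, L k = 1) {p : ℝ} (hp : p ∈ Ioo (0 : ℝ) 1) :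
    ∫⁻ X, massIoc L X 0 p ∂unifSeq = ENNReal.ofReal p := by
  have := lintegral_massIoc_mul (L := L) (H := fun _ => 1) (s := 0) (t := p) (y := 1) (I := univ)
    measurable_const (fun X k x _ y _ => rfl) le_rfl hp.2.le (subset_univ _) trivial
  simpa [hL] using this

/-- One factor of the square is a sum over atoms in (0,p]. With atom k placed in (0,p], the mean of
the other factor exceeds p by at least (1 - p) L k; of the resulting excesses only that for k = 0 is
kept. -/
lemma le_lintegral_massIoc_sq (hL : ∑' k, L k = 1) {p : ℝ} (hp : p ∈ Ioo (0 : ℝ) 1) :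
    ENNReal.ofReal p * (ENNReal.ofReal p + ENNReal.ofReal (1 - p) * (L 0) ^ 2) ≤
      ∫⁻ X, massIoc L X 0 p * massIoc L X 0 p ∂unifSeq := by
  have hinv : MoveInv (Ioc 0 p) fun X => massIoc L X 0 p := by
    intro X k x hx y hy
    have h := moveInv_cdfOf L (t := 0) (I := Ioc 0 p) (Or.inr fun z hz => hz.1) X k x hx y hy
    have h' := moveInv_cdfOf L (t := p) (I := Ioc 0 p) (Or.inl fun z hz => hz.2) X k x hx y hy
    simp only at h h' ⊢
    rw [← ofReal_cdfOf_sub hL _ hp.1.le, ← ofReal_cdfOf_sub hL _ hp.1.le, h, h']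
  rw [lintegral_massIoc_mul (by fun_prop) hinv le_rfl hp.2.le subset_rfl (y := p) ⟨hp.1, le_rfl⟩,
    sub_zero]
  gcongr
  -- Placing atom k at p adds L k to the mass of (0,p] when the atom was beyond p, an event of
  -- probability 1 - p.
  have hk : ∀ k, ENNReal.ofReal p + ENNReal.ofReal (1 - p) * L k ≤
      ∫⁻ X, massIoc L (Function.update X k p) 0 p ∂unifSeq := by
    intro k
    have h1 : ∫⁻ X, (if p < X k then L k else 0) ∂unifSeq = ENNReal.ofReal (1 - p) * L k := by
      have hm : Measurable fun x : ℝ => if p < x then L k else 0 :=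
        Measurable.ite measurableSet_Ioi measurable_const measurable_const
      have := lintegral_map (μ := unifSeq) hm (measurable_pi_apply k)
      rw [← this, unifSeq, Measure.infinitePi_map_eval]
      have e : ∀ x, (if p < x then L k else 0) = (Ioi p).indicator (fun _ => L k) x := by
        intro x
        simp [indicator]
      simp only [e]
      rw [lintegral_indicator_const measurableSet_Ioi, mul_comm]
      congr 1
      rw [← unif_Ioc hp.1.le le_rfl]
      refine measure_congr ?_
      have : ∀ᵐ x ∂unif, x ∈ Ioo (0 : ℝ) 1 := ae_restrict_mem measurableSet_Ioo
      filter_upwards [this] with x hx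
      simp only [eq_iff_iff]
      exact ⟨fun h => ⟨h, hx.2.le⟩, fun h => h.1⟩
    rw [← h1, ← lintegral_massIoc hL hp, ← lintegral_add_left (by fun_prop)]
    refine lintegral_mono_ae ?_
    filter_upwards [ae_generic] with X hX
    rw [← tsum_ite_eq k (fun _ => if p < X k then L k else 0), massIoc, massIoc,
      ← ENNReal.tsum_add]
    refine ENNReal.tsum_le_tsum fun j => ?_
    rcases eq_or_ne j k with rfl | hj
    · rcases le_or_gt (X j) p with h | h
      · simp [h, hp.1, not_lt.2 h, hX.pos]
      · simp [h, hp.1, not_le.2 h]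
    · simp [hj]
  calc ENNReal.ofReal p + ENNReal.ofReal (1 - p) * (L 0) ^ 2
      ≤ ∑' k, L k * (ENNReal.ofReal p + ENNReal.ofReal (1 - p) * L k) := by
        simp only [mul_add]
        rw [ENNReal.tsum_add, ENNReal.tsum_mul_right, hL, one_mul]
        gcongr
        refine le_trans (le_of_eq ?_) (ENNReal.le_tsum 0)
        ring
    _ ≤ _ := ENNReal.tsum_le_tsum fun k => by gcongr; exact hk k

lemma lintegral_tLevel_fst (hL : ∑' k, L k = 1) :
    ∫⁻ X, ∫⁻ U, ENNReal.ofReal (incs L X (tLevel U) 0).1 ∂unifSeq ∂unifSeq =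
      ∫⁻ p in Ioo (0 : ℝ) 1, ENNReal.ofReal p := by
  have := lintegral_firstTerms_tLevel hL 1 (f := fun y => ENNReal.ofReal (y 0).1)
    (measurable_fst.comp (measurable_pi_apply 0)).ennreal_ofReal
  refine this.trans ?_
  simp only [nu, qfac, pairIncs, Fin.cons_zero, zero_add, mul_one, ENNReal.ofReal_one, div_one]
  refine setLIntegral_congr_fun measurableSet_Ioo fun p hp => ?_
  simp only [ofReal_cdfOf_sub hL _ hp.1.le]
  rw [lintegral_massIoc hL hp, ← mul_assoc, ENNReal.inv_mul_cancel (by simpa using hp.1) (by simp),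
    one_mul]

/-- By `lintegral_dChain` the mean is the integral of E[F(p)²] / p. The second moment bound makes it
exceed the T-value of `lintegral_tLevel_fst` by a positive term. -/
lemma le_lintegral_dChain_fst (hL : ∑' k, L k = 1) (hpos : ∀ k, L k ≠ 0) :
    (∫⁻ p in Ioo (0 : ℝ) 1, ENNReal.ofReal p) +
      (∫⁻ p in Ioo (0 : ℝ) 1, ENNReal.ofReal (1 - p)) * (L 0) ^ 2 ≤
    ∫⁻ X, ∫⁻ U, ENNReal.ofReal (incs L X (chain (dStep L X) 0 U) 0).1 ∂unifSeq ∂unifSeq := by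
  have hm : Measurable fun y : Fin 1 → ℝ × ℝ => ENNReal.ofReal (y 0).1 :=
    (measurable_fst.comp (measurable_pi_apply 0)).ennreal_ofReal
  have := lintegral_dChain hL hpos 1 le_rfl one_pos (f := fun _ y => ENNReal.ofReal (y 0).1)
    (hm.comp measurable_snd) fun y X k x _ x' _ => rfl
  refine le_trans ?_ this.ge
  rw [← lintegral_mul_const _ (by fun_prop), ← lintegral_add_left (by fun_prop)]
  simp only [nu, qfst, qfac, pairIncs, Fin.cons_zero, zero_add, mul_one, sub_zero]
  refine setLIntegral_mono' measurableSet_Ioo fun p hp => ?_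
  have h1 : ∫⁻ X, ENNReal.ofReal (cdfOf L X p - cdfOf L X 0) / ENNReal.ofReal (1 - cdfOf L X 0) *
      ENNReal.ofReal (cdfOf L X p - cdfOf L X 0) ∂unifSeq =
      ∫⁻ X, massIoc L X 0 p * massIoc L X 0 p ∂unifSeq := by
    refine lintegral_congr_ae ?_
    filter_upwards [ae_generic] with X hX
    rw [ofReal_cdfOf_sub hL _ hp.1.le, cdfOf_zero hX.pos]
    simp
  rw [h1]
  refine le_trans (le_of_eq ?_) (mul_le_mul_right (le_lintegral_massIoc_sq hL hp) _)
  rw [← mul_assoc, ENNReal.inv_mul_cancel (by simpa using hp.1) (by simp), one_mul]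

end

/-! ### Ranking of sequences and measurability of ranks. -/

section

/-- A sequence of distinct terms with positive and summable lengths. -/
structure Rankable (x : ℕ → ℝ × ℝ) : Prop where
  injective : Function.Injective x
  pos : ∀ k, 0 < (x k).1
  summable : Summable fun k => (x k).1

lemma Precedes.trans {x : ℕ → ℝ × ℝ} {i j k : ℕ} (h : Precedes x i j) (h' : Precedes x j k) :
    Precedes x i k := by
  simp only [Precedes] at *
  grind

lemma not_precedes_self (x : ℕ → ℝ × ℝ) (i : ℕ) : ¬ Precedes x i i := by
  simp [Precedes]

lemma precedes_or_precedes (x : ℕ → ℝ × ℝ) {i j : ℕ} (h : i ≠ j) :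
    Precedes x i j ∨ Precedes x j i := by
  simp only [Precedes]
  grind

section Rank

variable {x : ℕ → ℝ × ℝ}

lemma Rankable.finite (hx : Rankable x) (i : ℕ) : {k | Precedes x k i}.Finite := by
  have h := (tendsto_order.1 hx.summable.tendsto_cofinite_zero).2 _ (hx.pos i)
  refine (Filter.eventually_cofinite.1 h).subset fun k hk => ?_
  rcases hk with hk | hk
  · exact not_lt.2 hk.le
  · exact not_lt.2 hk.1.le

lemma Rankable.rankOf_lt (hx : Rankable x) {i j : ℕ} (h : Precedes x i j) :
    rankOf x i < rankOf x j := by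
  refine Set.ncard_lt_ncard ?_ (hx.finite j)
  refine ⟨fun k hk => Precedes.trans hk h, fun hsub => ?_⟩
  exact not_precedes_self x i (hsub h)

lemma Rankable.rankOf_injective (hx : Rankable x) : Function.Injective (rankOf x) := by
  intro i j hij
  by_contra h
  rcases precedes_or_precedes x h with h | h
  · exact (hx.rankOf_lt h).ne hij
  · exact (hx.rankOf_lt h).ne hij.symm

/-- The terms preceding term i have distinct ranks below that of i, and there are exactly `rankOf x
i` of them, so every smaller rank is taken. Ranks are unbounded by injectivity. -/
lemma Rankable.rankOf_surjective (hx : Rankable x) : Function.Surjective (rankOf x) := by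
  intro n
  obtain ⟨i, hi⟩ : ∃ i, n < rankOf x i := by
    by_contra! h
    exact Set.infinite_of_injective_forall_mem hx.rankOf_injective (s := Iic n) h (finite_Iic n)
  have hfin := hx.finite i
  have himg : hfin.toFinset.image (rankOf x) = Finset.range (rankOf x i) := by
    refine Finset.eq_of_subset_of_card_le ?_ ?_
    · intro m hm
      obtain ⟨k, hk, rfl⟩ := Finset.mem_image.1 hm
      exact Finset.mem_range.2 (hx.rankOf_lt (hfin.mem_toFinset.1 hk))
    · rw [Finset.card_image_of_injective _ hx.rankOf_injective, Finset.card_range, rankOf,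
        Set.ncard_eq_toFinset_card _ hfin]
  have : n ∈ hfin.toFinset.image (rankOf x) := himg ▸ Finset.mem_range.2 hi
  obtain ⟨k, -, hk⟩ := Finset.mem_image.1 this
  exact ⟨k, hk⟩

lemma Rankable.ranked_rankOf (hx : Rankable x) (i : ℕ) : ranked x (rankOf x i) = x i := by
  have : {l | rankOf x l = rankOf x i} = {i} := by
    ext l
    simp [hx.rankOf_injective.eq_iff]
  rw [ranked, this, csInf_singleton]

lemma Rankable.comp (hx : Rankable x) {J : ℕ → ℕ} (hJ : Function.Injective J) :
    Rankable (x ∘ J) :=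
  ⟨hx.injective.comp hJ, fun _ => hx.pos _, hx.summable.comp_injective hJ⟩

/-- The index is used in `Precedes` only to separate equal pairs, and the terms here are distinct;
so ranks do not depend on the numbering. -/
lemma Rankable.rankOf_comp (hx : Rankable x) {J : ℕ → ℕ} (hJ : Function.Bijective J) (i : ℕ) :
    rankOf (x ∘ J) i = rankOf x (J i) := by
  have : {k | Precedes (x ∘ J) k i} = J ⁻¹' {k | Precedes x k (J i)} := by
    ext k
    simp only [mem_ofPred_eq, mem_preimage, Precedes, Function.comp]
    rcases eq_or_ne k i with rfl | h
    · simp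
    · have h1 : x (J k) ≠ x (J i) := fun h' => h (hJ.1 (hx.injective h'))
      have h2 : (x (J i)).1 = (x (J k)).1 → (x (J i)).2 ≠ (x (J k)).2 := fun h3 h4 =>
        h1 (Prod.ext h3.symm h4.symm)
      constructor
      · rintro (h | ⟨h, h' | ⟨h', -⟩⟩)
        · exact Or.inl h
        · exact Or.inr ⟨h, Or.inl h'⟩
        · exact absurd h' (h2 h)
      · rintro (h | ⟨h, h' | ⟨h', -⟩⟩)
        · exact Or.inl h
        · exact Or.inr ⟨h, Or.inl h'⟩
        · exact absurd h' (h2 h)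
  rw [rankOf, this, Set.ncard_preimage_of_injective_subset_range hJ.1, rankOf]
  rw [hJ.2.range_eq]
  exact subset_univ _

lemma Rankable.ranked_comp (hx : Rankable x) {J : ℕ → ℕ} (hJ : Function.Bijective J) :
    ranked (x ∘ J) = ranked x := by
  ext j : 1
  obtain ⟨i, rfl⟩ := (hx.comp hJ.1).rankOf_surjective j
  rw [(hx.comp hJ.1).ranked_rankOf, hx.rankOf_comp hJ, hx.ranked_rankOf]
  rfl

end Rank

lemma measurableSet_precedes (k i : ℕ) : MeasurableSet {x : ℕ → ℝ × ℝ | Precedes x k i} := by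
  have h1 : ∀ k, Measurable fun x : ℕ → ℝ × ℝ => (x k).1 := fun k =>
    measurable_fst.comp (measurable_pi_apply k)
  have h2 : ∀ k, Measurable fun x : ℕ → ℝ × ℝ => (x k).2 := fun k =>
    measurable_snd.comp (measurable_pi_apply k)
  refine (measurableSet_lt (h1 i) (h1 k)).union ((measurableSet_eq_fun (h1 i) (h1 k)).inter
    ((measurableSet_lt (h2 i) (h2 k)).union ((measurableSet_eq_fun (h2 i) (h2 k)).inter ?_)))
  exact MeasurableSet.const _

open Classical in
@[fun_prop]
lemma measurable_rankOf (i : ℕ) : Measurable fun x : ℕ → ℝ × ℝ => rankOf x i := by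
  -- The count is written as a series of measurable terms. For infinite sets both sides are 0, as
  -- `ncard` and `toReal` of `∞` are both 0.
  have h : ∀ x : ℕ → ℝ × ℝ, rankOf x i =
      ⌊(∑' k, if Precedes x k i then (1 : ℝ≥0∞) else 0).toReal⌋₊ := by
    intro x
    have : (∑' k, if Precedes x k i then (1 : ℝ≥0∞) else 0) =
        ({k | Precedes x k i}.encard : ℝ≥0∞) := by
      rw [← ENNReal.tsum_set_one, tsum_subtype {k | Precedes x k i} fun _ => (1 : ℝ≥0∞)]
      rfl
    rw [this, rankOf]
    by_cases hf : {k | Precedes x k i}.Finite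
    · rw [← hf.cast_ncard_eq]
      simp
    · rw [Set.Infinite.ncard hf, Set.Infinite.encard_eq hf]
      simp
  simp only [h]
  refine Nat.measurable_floor.comp (Measurable.tsum fun k => Measurable.ite ?_ measurable_const
    measurable_const).ennreal_toReal
  exact measurableSet_precedes k i

lemma measurable_sInf_nat {α : Type*} [MeasurableSpace α] {P : α → ℕ → Prop}
    (hP : ∀ i, MeasurableSet {x | P x i}) : Measurable fun x => sInf {i | P x i} := by
  refine measurable_to_countable' fun n => ?_
  -- The second set accounts for the convention that the infimum of the empty set is 0.
  have : (fun x => sInf {i | P x i}) ⁻¹' {n} =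
      ({x | P x n} ∩ ⋂ m ∈ Finset.range n, {x | P x m}ᶜ) ∪
        ({x | n = 0} ∩ ⋂ m, {x | P x m}ᶜ) := by
    ext x
    simp only [mem_preimage, mem_singleton_iff, mem_union, mem_inter_iff, mem_ofPred_eq, mem_iInter,
      Finset.mem_range, mem_compl_iff]
    constructor
    · rintro rfl
      by_cases hne : {i | P x i}.Nonempty
      · exact Or.inl ⟨Nat.sInf_mem hne, fun m hm => Nat.notMem_of_lt_sInf hm⟩
      · rw [Set.not_nonempty_iff_eq_empty] at hne
        refine Or.inr ⟨by rw [hne, Nat.sInf_empty], fun m hm => ?_⟩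
        have : m ∈ {i | P x i} := hm
        rw [hne] at this
        exact this
    · rintro (⟨h1, h2⟩ | ⟨rfl, h⟩)
      · refine le_antisymm (Nat.sInf_le h1) ?_
        by_contra hlt
        exact h2 _ (not_le.1 hlt) (Nat.sInf_mem ⟨n, h1⟩)
      · rw [show {i | P x i} = ∅ from Set.eq_empty_of_forall_notMem h, Nat.sInf_empty]
  rw [this]
  refine ((hP n).inter ?_).union ((MeasurableSet.const _).inter ?_)
  · exact Finset.measurableSet_biInter _ fun m _ => (hP m).compl
  · exact MeasurableSet.iInter fun m => (hP m).compl

lemma measurable_apply_nat {α β : Type*} [MeasurableSpace α] [MeasurableSpace β] {x : α → ℕ → β}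
    {n : α → ℕ} (hx : Measurable x) (hn : Measurable n) : Measurable fun z => x z (n z) := by
  have : Measurable fun p : (ℕ → β) × ℕ => p.1 p.2 :=
    measurable_from_prod_countable_left fun n => measurable_pi_apply n
  exact this.comp (hx.prodMk hn)

@[fun_prop]
lemma measurable_ranked : Measurable ranked := by
  refine measurable_pi_iff.2 fun j => ?_
  refine measurable_apply_nat (x := fun x => x) measurable_id (measurable_sInf_nat fun i => ?_)
  exact measurableSet_eq_fun (measurable_rankOf i) measurable_const

lemma measurable_biasedProb {w : ℝ × ℝ → ℝ} (hw : Measurable w) {n : ℕ} (k : Fin n → ℕ) :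
    Measurable fun r : ℕ → ℝ × ℝ => biasedProb w r k := by
  unfold biasedProb
  have h : ∀ j, Measurable fun r : ℕ → ℝ × ℝ => w (r j) := fun j =>
    hw.comp (measurable_pi_apply j)
  refine Finset.measurable_prod _ fun i _ => (h _).div ((Measurable.tsum h).sub ?_)
  exact Finset.measurable_sum _ fun l _ => h _

/-- Links the recursive form of the sampling probability, suited to induction, with the product form
of `biasedProb`. -/
lemma qfac_eq_prod (r : ℕ) (s : ℝ) (v : Fin r → ℝ) :
    qfac r s v = ∏ i, ENNReal.ofReal (v i) / ENNReal.ofReal (s - ∑ l ∈ Finset.Iio i, v l) := by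
  induction r generalizing s with
  | zero => simp [qfac]
  | succ r ih =>
    rw [qfac, ih, Fin.prod_univ_succ]
    have h0 : Finset.Iio (0 : Fin (r + 1)) = ∅ := by ext; simp
    rw [h0, Finset.sum_empty, sub_zero]
    congr 1
    · refine Finset.prod_congr rfl fun i _ => ?_
      have : ∑ l ∈ Finset.Iio i.succ, v l = v 0 + ∑ l ∈ Finset.Iio i, Fin.tail v l := by
        have h1 : Finset.Iio i.succ = Finset.univ.filter fun l => l < i.succ := by ext; simp
        have h2 : Finset.Iio i = Finset.univ.filter fun l => l < i := by ext; simp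
        rw [h1, h2, Finset.sum_filter, Finset.sum_filter, Fin.sum_univ_succ]
        simp [Fin.tail]
      rw [this, sub_add_eq_sub_sub]
      rfl

end

/-! ### Weighted sampling without replacement. -/

section

/-- The index chosen by a uniform variable `u` with probabilities proportional to `v`. -/
def chooseIdx (v : ℕ → ℝ) (u : ℝ) : ℕ :=
  sInf {m | u * ∑' k, v k < ∑ l ∈ Finset.range (m + 1), v l}

/-- Set the weight of index `m` to zero. -/
def dropIdx (v : ℕ → ℝ) (m : ℕ) : ℕ → ℝ := fun n => if n = m then 0 else v n

/-- The remaining weights in sampling without replacement. -/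
def remaining (v : ℕ → ℝ) (U : ℕ → ℝ) : ℕ → ℕ → ℝ
  | 0 => v
  | n + 1 => dropIdx (remaining v U n) (chooseIdx (remaining v U n) (U n))

/-- The indices chosen in sampling without replacement. -/
def picks (v : ℕ → ℝ) (U : ℕ → ℝ) (n : ℕ) : ℕ := chooseIdx (remaining v U n) (U n)

lemma remaining_seqCons (v : ℕ → ℝ) (u : ℝ) (U : ℕ → ℝ) (n : ℕ) :
    remaining v (seqCons u U) (n + 1) = remaining (dropIdx v (chooseIdx v u)) U n := by
  induction n with
  | zero => rfl
  | succ n ih => rw [remaining, ih]; rfl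

lemma picks_seqCons (v : ℕ → ℝ) (u : ℝ) (U : ℕ → ℝ) :
    picks v (seqCons u U) = seqCons (chooseIdx v u) (picks (dropIdx v (chooseIdx v u)) U) := by
  ext n
  cases n with
  | zero => rfl
  | succ n => simp only [picks, remaining_seqCons, seqCons_succ]

lemma measurable_chooseIdx {α : Type*} [MeasurableSpace α] {v : α → ℕ → ℝ} {u : α → ℝ}
    (hv : Measurable v) (hu : Measurable u) : Measurable fun z => chooseIdx (v z) (u z) := by
  have h : ∀ k, Measurable fun z => v z k := fun k => (measurable_pi_apply k).comp hv
  refine measurable_sInf_nat fun m => measurableSet_lt (hu.mul (Measurable.tsum h)) ?_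
  exact Finset.measurable_sum _ fun l _ => h l

lemma measurable_remaining {α : Type*} [MeasurableSpace α] {v U : α → ℕ → ℝ}
    (hv : Measurable v) (hU : Measurable U) (n : ℕ) :
    Measurable fun z => remaining (v z) (U z) n := by
  induction n with
  | zero => exact hv
  | succ n ih =>
    refine measurable_pi_iff.2 fun k => Measurable.ite ?_ measurable_const
      ((measurable_pi_apply k).comp ih)
    exact measurableSet_eq_fun measurable_const
      (measurable_chooseIdx ih ((measurable_pi_apply n).comp hU))

lemma measurable_picks {α : Type*} [MeasurableSpace α] {v U : α → ℕ → ℝ}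
    (hv : Measurable v) (hU : Measurable U) : Measurable fun z => picks (v z) (U z) :=
  measurable_pi_iff.2 fun n => measurable_chooseIdx (measurable_remaining hv hU n)
    ((measurable_pi_apply n).comp hU)

lemma measurable_firstTerms_picks (v : ℕ → ℝ) (r : ℕ) :
    Measurable fun U => firstTerms r (picks v U) :=
  (measurable_firstTerms r).comp (measurable_picks (v := fun _ => v) measurable_const measurable_id)

/-- Nonnegative weights with sum `S`, infinitely many of them positive. -/
structure Weights (v : ℕ → ℝ) (S : ℝ) : Prop where
  nonneg : ∀ k, 0 ≤ v k
  hasSum : HasSum v S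
  infinite : {k | 0 < v k}.Infinite

section Weights

variable {v : ℕ → ℝ} {S : ℝ}

lemma Weights.pos (hv : Weights v S) : 0 < S := by
  obtain ⟨k, hk⟩ := hv.infinite.nonempty
  have : v k ≤ S := le_hasSum hv.hasSum k fun j _ => hv.nonneg j
  exact lt_of_lt_of_le hk this

/-- Infinitely many positive weights remain after a removal, so the total stays positive and
sampling never stops. -/
lemma Weights.drop (hv : Weights v S) (m : ℕ) : Weights (dropIdx v m) (S - v m) := by
  refine ⟨fun k => ?_, ?_, ?_⟩
  · simp only [dropIdx]
    split_ifs
    · exact le_rfl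
    · exact hv.nonneg k
  · have := hv.hasSum.sub (hasSum_ite_eq m (v m))
    have e : dropIdx v m = fun b => v b - if b = m then v m else 0 := by
      funext b
      by_cases hb : b = m <;> simp [dropIdx, hb]
    rwa [e]
  · refine (hv.infinite.sdiff (finite_singleton m)).mono ?_
    rintro k ⟨hk, hkm⟩
    have : k ≠ m := hkm
    simpa [dropIdx, this] using hk

lemma Weights.chooseIdx_eq_iff (hv : Weights v S) {u : ℝ} (hu : u ∈ Ioo (0 : ℝ) 1) (m : ℕ) :
    chooseIdx v u = m ↔ ∑ l ∈ Finset.range m, v l ≤ u * S ∧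
      u * S < ∑ l ∈ Finset.range (m + 1), v l := by
  have hmono : Monotone fun n => ∑ l ∈ Finset.range n, v l := by
    refine monotone_nat_of_le_succ fun n => ?_
    rw [Finset.sum_range_succ]
    linarith [hv.nonneg n]
  have hlt : u * S < S := by nlinarith [hv.pos, hu.2]
  have hne : {m | u * ∑' k, v k < ∑ l ∈ Finset.range (m + 1), v l}.Nonempty := by
    rw [hv.hasSum.tsum_eq]
    have h := (tendsto_order.1 hv.hasSum.tendsto_sum_nat).1 _ hlt
    obtain ⟨n, hn⟩ := h.exists
    exact ⟨n, hn.trans_le (hmono (Nat.le_succ n))⟩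
  unfold chooseIdx
  rw [hv.hasSum.tsum_eq] at *
  constructor
  · rintro rfl
    refine ⟨?_, Nat.sInf_mem hne⟩
    rcases Nat.eq_zero_or_pos (sInf {m | u * S < ∑ l ∈ Finset.range (m + 1), v l}) with h0 | h0
    · rw [h0]
      simpa using mul_nonneg hu.1.le hv.pos.le
    · have h := Nat.notMem_of_lt_sInf (Nat.sub_lt h0 one_pos)
      simp only [mem_ofPred_eq, not_lt] at h
      have e : sInf {m | u * S < ∑ l ∈ Finset.range (m + 1), v l} - 1 + 1 =
          sInf {m | u * S < ∑ l ∈ Finset.range (m + 1), v l} := by omega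
      rwa [e] at h
  · rintro ⟨h1, h2⟩
    refine le_antisymm (Nat.sInf_le h2) ?_
    by_contra h
    have h3 := Nat.sInf_mem hne
    simp only [mem_ofPred_eq] at h3
    exact absurd (h3.trans_le (hmono (Nat.succ_le_of_lt (not_le.1 h)))) (not_lt.2 h1)

lemma Weights.unif_chooseIdx (hv : Weights v S) (m : ℕ) :
    unif.map (chooseIdx v) {m} = ENNReal.ofReal (v m) / ENNReal.ofReal S := by
  have hS := hv.pos
  have hcm : Measurable (chooseIdx v) := measurable_chooseIdx measurable_const measurable_id
  rw [Measure.map_apply hcm (measurableSet_singleton m), unif,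
    Measure.restrict_apply (hcm (measurableSet_singleton m))]
  set C := ∑ l ∈ Finset.range m, v l with hC
  have hC0 : 0 ≤ C := Finset.sum_nonneg fun l _ => hv.nonneg l
  have hC1 : C + v m ≤ S := by
    rw [hC, ← Finset.sum_range_succ]
    exact sum_le_hasSum _ (fun j _ => hv.nonneg j) hv.hasSum
  have hset : chooseIdx v ⁻¹' {m} ∩ Ioo 0 1 = Ico (C / S) ((C + v m) / S) ∩ Ioo 0 1 := by
    ext u
    simp only [mem_inter_iff, mem_preimage, mem_singleton_iff, and_congr_left_iff]
    intro hu
    rw [hv.chooseIdx_eq_iff hu, Finset.sum_range_succ, mem_Ico, div_le_iff₀ hS, lt_div_iff₀ hS]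
  have hae : (Ico (C / S) ((C + v m) / S) ∩ Ioo 0 1 : Set ℝ) =ᵐ[volume]
      (Ico (C / S) ((C + v m) / S) : Set ℝ) := by
    have h1 : (Ico (C / S) ((C + v m) / S) ∩ Ioo 0 1 : Set ℝ) =ᵐ[volume]
        (Ico (C / S) ((C + v m) / S) ∩ Ico 0 1 : Set ℝ) := ae_eq_set_inter (by rfl) Ioo_ae_eq_Ico
    rwa [inter_eq_left.2 (Ico_subset_Ico (by positivity) ((div_le_one hS).2 hC1))] at h1
  rw [hset, measure_congr hae, Real.volume_Ico, ← ENNReal.ofReal_div_of_pos hS]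
  congr 1
  ring

lemma Weights.lintegral_chooseIdx (hv : Weights v S) (G : ℕ → ℝ≥0∞) :
    ∫⁻ u, G (chooseIdx v u) ∂unif =
      ∑' m, ENNReal.ofReal (v m) / ENNReal.ofReal S * G m := by
  have hcm : Measurable (chooseIdx v) := measurable_chooseIdx measurable_const measurable_id
  rw [← lintegral_map (measurable_of_countable G) hcm, lintegral_countable']
  exact tsum_congr fun m => by rw [hv.unif_chooseIdx, mul_comm]

lemma qfac_eq_zero {r : ℕ} {s : ℝ} {p : Fin r → ℝ} {i : Fin r} (h : p i = 0) : qfac r s p = 0 := by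
  rw [qfac_eq_prod]
  exact Finset.prod_eq_zero (Finset.mem_univ i) (by simp [h])

/-- After the pick m, the rest is sampling from the weights without m, of total S - v m; this is the
recursion of `qfac`. -/
lemma Weights.lintegral_picks (hv : Weights v S) (r : ℕ) (g : (Fin r → ℕ) → ℝ≥0∞) :
    ∫⁻ U, g (firstTerms r (picks v U)) ∂unifSeq =
      ∑' j : Fin r → ℕ, {j | Function.Injective j}.indicator
        (fun j => qfac r S (fun i => v (j i)) * g j) j := by
  induction r generalizing v S with
  | zero =>
    rw [tsum_eq_single Fin.elim0 fun j hj => (hj (Subsingleton.elim _ _)).elim,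
      indicator_of_mem (Function.injective_of_subsingleton _), qfac, one_mul,
      lintegral_congr (g := fun _ => g Fin.elim0) fun U => by congr 1; exact Subsingleton.elim _ _]
    simp
  | succ r ih =>
    have hm := measurable_firstTerms_picks v (r + 1)
    rw [lintegral_unifSeq_cons (G := fun U => g (firstTerms (r + 1) (picks v U)))
      ((measurable_of_countable g).comp hm)]
    simp only [picks_seqCons, firstTerms_seqCons]
    rw [hv.lintegral_chooseIdx fun m => ∫⁻ U, g (Fin.cons m
      (firstTerms r (picks (dropIdx v m) U))) ∂unifSeq,
      ← (Fin.consEquiv fun _ : Fin (r + 1) => ℕ).tsum_eq, ENNReal.tsum_prod']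
    refine tsum_congr fun m => ?_
    rw [ih (hv.drop m) fun j => g (Fin.cons m j), ← ENNReal.tsum_mul_left]
    refine tsum_congr fun j => ?_
    simp only [Fin.consEquiv, Equiv.coe_fn_mk, indicator, mem_ofPred_eq, Fin.cons_injective_iff]
    by_cases hj : Function.Injective j
    · by_cases hmj : m ∈ range j
      · obtain ⟨i, rfl⟩ := hmj
        -- A tuple that uses m again has probability zero, since the weight of m has been set to 0.
        rw [qfac_eq_zero (i := i) (by simp [dropIdx])]
        simp
      · have : ∀ i, dropIdx v m (j i) = v (j i) := fun i => by
          have : j i ≠ m := fun h => hmj ⟨i, h⟩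
          simp [dropIdx, this]
        simp only [hj, hmj, not_false_eq_true, and_self, if_true, this, qfac, Fin.cons_zero]
        rw [← mul_assoc]
        rfl
    · simp [hj]

lemma Weights.ae_injective_picks (hv : Weights v S) :
    ∀ᵐ U ∂unifSeq, Function.Injective (picks v U) := by
  have h : ∀ r, ∀ᵐ U ∂unifSeq, Function.Injective (firstTerms r (picks v U)) := by
    intro r
    have h0 := hv.lintegral_picks r ({j | Function.Injective j}ᶜ.indicator 1)
    have h1 : ∀ j : Fin r → ℕ, {j : Fin r → ℕ | Function.Injective j}.indicator
        (fun j => qfac r S (fun i => v (j i)) *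
          ({j | Function.Injective j}ᶜ.indicator 1 : (Fin r → ℕ) → ℝ≥0∞) j) j = 0 := by
      intro j
      by_cases hj : Function.Injective j <;> simp [indicator, hj]
    simp only [h1, tsum_zero] at h0
    have hm : Measurable fun U => ({j | Function.Injective j}ᶜ.indicator 1 :
        (Fin r → ℕ) → ℝ≥0∞) (firstTerms r (picks v U)) :=
      (measurable_of_countable ({j | Function.Injective j}ᶜ.indicator 1 :
        (Fin r → ℕ) → ℝ≥0∞)).comp (measurable_firstTerms_picks v r)
    rw [lintegral_eq_zero_iff hm] at h0
    filter_upwards [h0] with U hU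
    by_contra hc
    simp [indicator, hc] at hU
  filter_upwards [ae_all_iff.2 h] with U hU i j hij
  have := @hU (max i j + 1) ⟨i, by omega⟩ ⟨j, by omega⟩ hij
  simpa using this

end Weights

/-- If the value m were missed, all partial sums of `v ∘ J` would stay below S - v m. -/
lemma surjective_of_hasSum_comp {v : ℕ → ℝ} {S : ℝ} (hpos : ∀ k, 0 < v k) (hv : HasSum v S)
    {J : ℕ → ℕ} (hJ : Function.Injective J) (h : HasSum (v ∘ J) S) : Function.Surjective J := by
  by_contra hns
  simp only [Function.Surjective, not_forall, not_exists] at hns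
  obtain ⟨m, hm⟩ := hns
  have hle : ∀ n, ∑ i ∈ Finset.range n, v (J i) ≤ S - v m := by
    intro n
    have : ∑ l ∈ insert m ((Finset.range n).map ⟨J, hJ⟩), v l ≤ S :=
      sum_le_hasSum _ (fun j _ => (hpos j).le) hv
    rw [Finset.sum_insert, Finset.sum_map] at this
    · simp only [Function.Embedding.coeFn_mk] at this
      linarith
    · simp [hm]
  have := le_of_tendsto' h.tendsto_sum_nat hle
  linarith [hpos m]

/-- The terms of a rankable sequence have positive weights with sum `1`. -/
structure GoodWeights (w : ℝ × ℝ → ℝ) (x : ℕ → ℝ × ℝ) : Prop extends Rankable x where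
  weight_pos : ∀ k, 0 < w (x k)
  weight_hasSum : HasSum (fun k => w (x k)) 1

lemma GoodWeights.weights {w : ℝ × ℝ → ℝ} {x : ℕ → ℝ × ℝ} (h : GoodWeights w x) :
    Weights (fun k => w (x k)) 1 :=
  ⟨fun k => (h.weight_pos k).le, h.weight_hasSum, by
    simp only [h.weight_pos, Set.ofPred_true]; exact infinite_univ⟩

section Biased

variable {w : ℝ × ℝ → ℝ} {τ η : Measure (ℕ → ℝ × ℝ)}

/-- A random rearrangement of `x`, where the picks are made in `w`-biased order. -/
def rearrange (w : ℝ × ℝ → ℝ) (z : (ℕ → ℝ × ℝ) × (ℕ → ℝ)) : ℕ → ℝ × ℝ :=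
  z.1 ∘ picks (fun k => w (z.1 k)) z.2

lemma measurable_weightPicks (hw : Measurable w) :
    Measurable fun z : (ℕ → ℝ × ℝ) × (ℕ → ℝ) => picks (fun k => w (z.1 k)) z.2 :=
  measurable_picks (measurable_pi_iff.2 fun k =>
    hw.comp ((measurable_pi_apply k).comp measurable_fst)) measurable_snd

lemma measurable_rearrange (hw : Measurable w) : Measurable (rearrange w) :=
  measurable_pi_iff.2 fun n => measurable_apply_nat (x := fun z : (ℕ → ℝ × ℝ) × (ℕ → ℝ) => z.1)
    (n := fun z : (ℕ → ℝ × ℝ) × (ℕ → ℝ) => picks (fun k => w (z.1 k)) z.2 n) measurable_fst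
    ((measurable_pi_apply n).comp (measurable_weightPicks hw))

/-- By `Weights.lintegral_picks`, the hypothesis h says that η and the biased sample from τ have the
same finite-dimensional laws. -/
lemma map_rearrange [IsProbabilityMeasure τ] (hw : Measurable w) (hτ : ∀ᵐ x ∂τ, GoodWeights w x)
    (h : ∀ (r : ℕ) (f : (Fin r → ℝ × ℝ) → ℝ≥0∞), Measurable f →
      ∫⁻ y, f (firstTerms r y) ∂η =
        ∫⁻ x, injSum r x (fun y => qfac r 1 (fun i => w (y i)) * f y) ∂τ) :
    (τ.prod unifSeq).map (rearrange w) = η := by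
  have : IsProbabilityMeasure ((τ.prod unifSeq).map (rearrange w)) :=
    Measure.isProbabilityMeasure_map (measurable_rearrange hw).aemeasurable
  refine ext_of_firstTerms fun r => Measure.ext_of_lintegral _ fun f hf => ?_
  have hfr : Measurable fun y : ℕ → ℝ × ℝ => f (firstTerms r y) := hf.comp (by fun_prop)
  have hfR : Measurable fun z => f (firstTerms r (rearrange w z)) :=
    hfr.comp (measurable_rearrange hw)
  rw [lintegral_map hf (by fun_prop), lintegral_map hf (by fun_prop),
    lintegral_map hfr (measurable_rearrange hw), h r f hf,
    lintegral_prod _ hfR.aemeasurable]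
  refine lintegral_congr_ae ?_
  filter_upwards [hτ] with x hx
  exact hx.weights.lintegral_picks r fun j => f fun i => x (j i)

/-- The picks are distinct because a chosen weight is removed. They are exhaustive because the
picked weights have sum 1 under η, the full weight of x. -/
lemma ae_bijective_picks (hw : Measurable w) (hτ : ∀ᵐ x ∂τ, GoodWeights w x)
    (hη : ∀ᵐ y ∂η, HasSum (fun k => w (y k)) 1)
    (hmap : (τ.prod unifSeq).map (rearrange w) = η) :
    ∀ᵐ z ∂τ.prod unifSeq, GoodWeights w z.1 ∧
      Function.Bijective (picks (fun k => w (z.1 k)) z.2) := by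
  have h1 : ∀ᵐ z ∂τ.prod unifSeq, HasSum (fun k => w (rearrange w z k)) 1 := by
    rw [← hmap] at hη
    exact ae_of_ae_map (measurable_rearrange hw).aemeasurable hη
  have h2 : ∀ᵐ z ∂τ.prod unifSeq, GoodWeights w z.1 :=
    Measure.quasiMeasurePreserving_fst.ae hτ
  have h3 : ∀ᵐ z ∂τ.prod unifSeq, Function.Injective (picks (fun k => w (z.1 k)) z.2) := by
    have hms : MeasurableSet {z : (ℕ → ℝ × ℝ) × (ℕ → ℝ) |
        Function.Injective (picks (fun k => w (z.1 k)) z.2)} := by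
      have hp := fun n => (measurable_pi_apply n).comp (measurable_weightPicks (w := w) hw)
      simp only [Function.Injective, Set.ofPred_forall]
      refine MeasurableSet.iInter fun i => MeasurableSet.iInter fun j => ?_
      by_cases hij : i = j
      · simp [hij]
      · simp only [hij, imp_false]
        exact (measurableSet_eq_fun (hp i) (hp j)).compl
    rw [Measure.ae_prod_iff_ae_ae hms]
    filter_upwards [hτ] with x hx
    exact hx.weights.ae_injective_picks
  filter_upwards [h1, h2, h3] with z h1 h2 h3
  exact ⟨h2, h3, surjective_of_hasSum_comp h2.weight_pos h2.weight_hasSum h3 h1⟩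

/-- η is the law of a random permutation of a τ-sample, and permuting distinct terms does not change
the ranked sequence. -/
theorem map_ranked_eq [IsProbabilityMeasure τ] (hw : Measurable w) (hτ : ∀ᵐ x ∂τ, GoodWeights w x)
    (hη : ∀ᵐ y ∂η, HasSum (fun k => w (y k)) 1)
    (h : ∀ (r : ℕ) (f : (Fin r → ℝ × ℝ) → ℝ≥0∞), Measurable f →
      ∫⁻ y, f (firstTerms r y) ∂η =
        ∫⁻ x, injSum r x (fun y => qfac r 1 (fun i => w (y i)) * f y) ∂τ) :
    η.map ranked = τ.map ranked := by
  have hmap := map_rearrange hw hτ h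
  have hbij := ae_bijective_picks hw hτ hη hmap
  rw [← hmap, Measure.map_map measurable_ranked (measurable_rearrange hw)]
  have : ranked ∘ rearrange w =ᵐ[τ.prod unifSeq] ranked ∘ Prod.fst := by
    filter_upwards [hbij] with z hz
    exact hz.1.toRankable.ranked_comp hz.2
  rw [Measure.map_congr this, ← Measure.map_map measurable_ranked measurable_fst,
    ← Measure.fst, Measure.fst_prod]

/-- Realize η as the rearranged τ-sample. Given x, the ranked sequence is fixed and the event
prescribes the indices of the first n picks, whose probability is `biasedProb`. -/
theorem biased_of_lintegral_eq [IsProbabilityMeasure τ] (hw : Measurable w) (hτ : ∀ᵐ x ∂τ, GoodWeights w x)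
    (hη : ∀ᵐ y ∂η, HasSum (fun k => w (y k)) 1)
    (h : ∀ (r : ℕ) (f : (Fin r → ℝ × ℝ) → ℝ≥0∞), Measurable f →
      ∫⁻ y, f (firstTerms r y) ∂η =
        ∫⁻ x, injSum r x (fun y => qfac r 1 (fun i => w (y i)) * f y) ∂τ)
    (n : ℕ) (k : Fin n → ℕ) (hk : Function.Injective k) (B : Set (ℕ → ℝ × ℝ))
    (hB : MeasurableSet B) :
    η ({y | ∀ i : Fin n, rankOf y i = k i} ∩ {y | ranked y ∈ B}) =
      ∫⁻ y in {y | ranked y ∈ B}, ENNReal.ofReal (biasedProb w (ranked y) k) ∂η := by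
  have hmap := map_rearrange hw hτ h
  have hbij := ae_bijective_picks hw hτ hη hmap
  have hbm := (measurable_biasedProb hw k).ennreal_ofReal
  -- The integrand depends on the ranked sequence only, whose law is the same under η and τ.
  have hrhs : ∫⁻ y in {y | ranked y ∈ B}, ENNReal.ofReal (biasedProb w (ranked y) k) ∂η =
      ∫⁻ x in {y | ranked y ∈ B}, ENNReal.ofReal (biasedProb w (ranked x) k) ∂τ := by
    have e : ∀ ξ : Measure (ℕ → ℝ × ℝ),
        ∫⁻ y in {y | ranked y ∈ B}, ENNReal.ofReal (biasedProb w (ranked y) k) ∂ξ =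
        ∫⁻ r in B, ENNReal.ofReal (biasedProb w r k) ∂(ξ.map ranked) := fun ξ =>
      (setLIntegral_map hB hbm measurable_ranked).symm
    rw [e, e, map_ranked_eq hw hτ hη h]
  have hmR : MeasurableSet {y : ℕ → ℝ × ℝ | ∀ i : Fin n, rankOf y i = k i} := by
    simp only [Set.ofPred_forall]
    exact MeasurableSet.iInter fun i => measurableSet_eq_fun (measurable_rankOf _) measurable_const
  have hmB : MeasurableSet {y : ℕ → ℝ × ℝ | ranked y ∈ B} := measurable_ranked hB
  rw [hrhs, ← hmap, Measure.map_apply (measurable_rearrange hw) (hmR.inter hmB),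
    ← lintegral_indicator_one (measurable_rearrange hw (hmR.inter hmB)),
    lintegral_prod _ (measurable_one.indicator
      (measurable_rearrange hw (hmR.inter hmB))).aemeasurable,
    ← lintegral_indicator hmB]
  refine lintegral_congr_ae ?_
  filter_upwards [hτ, Measure.ae_ae_of_ae_prod hbij] with x hx hb
  choose ρ hρ using hx.toRankable.rankOf_surjective
  have hρinj : Function.Injective ρ := fun i j hij => by rw [← hρ i, hij, hρ]
  have hrk : ∀ j, ranked x j = x (ρ j) := fun j => by
    conv_lhs => rw [← hρ j]
    exact hx.toRankable.ranked_rankOf _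
  -- `ρ` inverts the rank, so `j₀` lists the indices in x of the terms with the prescribed ranks.
  set j₀ : Fin n → ℕ := fun i => ρ (k i) with hj₀
  have hj₀inj : Function.Injective j₀ := hρinj.comp hk
  have hev : ∀ᵐ U ∂unifSeq, (rearrange w ⁻¹' ({y | ∀ i : Fin n, rankOf y i = k i} ∩
      {y | ranked y ∈ B})).indicator (1 : (ℕ → ℝ × ℝ) × (ℕ → ℝ) → ℝ≥0∞) (x, U) =
      {y | ranked y ∈ B}.indicator 1 x * ({j₀} : Set (Fin n → ℕ)).indicator 1
        (firstTerms n (picks (fun k => w (x k)) U)) := by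
    filter_upwards [hb] with U hU
    have h1 : ranked (rearrange w (x, U)) = ranked x := hx.toRankable.ranked_comp hU.2
    have h2 : ∀ i, rankOf (rearrange w (x, U)) i = rankOf x (picks (fun k => w (x k)) U i) :=
      hx.toRankable.rankOf_comp hU.2
    have h3 : firstTerms n (picks (fun k => w (x k)) U) = j₀ ↔
        ∀ i : Fin n, rankOf (rearrange w (x, U)) i = k i := by
      simp only [h2, funext_iff, firstTerms, hj₀]
      refine forall_congr' fun i => ⟨fun h => by rw [h, hρ], fun h => ?_⟩
      exact hx.toRankable.rankOf_injective (by rw [h, hρ])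
    by_cases hxB : ranked x ∈ B <;>
    by_cases hj : firstTerms n (picks (fun k => w (x k)) U) = j₀
    · simp [indicator, h1, hxB, h3.1 hj, hj]
    · simp [indicator, h1, hxB, hj, mt h3.2 hj]
    · simp [indicator, h1, hxB]
    · simp [indicator, h1, hxB]
  rw [lintegral_congr_ae hev]
  have hpm : Measurable fun U => ({j₀} : Set (Fin n → ℕ)).indicator (1 : (Fin n → ℕ) → ℝ≥0∞)
      (firstTerms n (picks (fun k => w (x k)) U)) :=
    (measurable_of_countable (({j₀} : Set (Fin n → ℕ)).indicator
      (1 : (Fin n → ℕ) → ℝ≥0∞))).comp (measurable_firstTerms_picks _ n)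
  rw [lintegral_const_mul _ hpm, hx.weights.lintegral_picks n, tsum_eq_single j₀]
  · rw [indicator_of_mem (show j₀ ∈ {j | Function.Injective j} from hj₀inj),
      indicator_of_mem (mem_singleton j₀)]
    have hq : qfac n 1 (fun i => w (x (j₀ i))) =
        ENNReal.ofReal (biasedProb w (ranked x) k) := by
      have hsum : ∑' j, w (ranked x j) = 1 := by
        have hρs : Function.Bijective ρ := ⟨hρinj, fun i => ⟨rankOf x i,
          hx.toRankable.rankOf_injective (hρ _)⟩⟩
        simp only [hrk]
        exact ((Equiv.ofBijective ρ hρs).tsum_eq fun j => w (x j)).trans hx.weight_hasSum.tsum_eq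
      -- The weight remaining before pick i still contains the positive weight of `j₀ i`.
      have hlt : ∀ i : Fin n, 0 < 1 - ∑ l ∈ Finset.Iio i, w (x (j₀ l)) := by
        intro i
        have hle : ∑ l ∈ Finset.Iic i, w (x (j₀ l)) ≤ 1 := by
          have := sum_le_hasSum ((Finset.Iic i).map ⟨j₀, hj₀inj⟩)
            (fun j _ => (hx.weight_pos j).le) hx.weight_hasSum
          simpa using this
        have hIic : Finset.Iic i = insert i (Finset.Iio i) := by
          ext l
          simp [le_iff_eq_or_lt]
        rw [hIic, Finset.sum_insert (by simp)] at hle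
        linarith [hx.weight_pos (j₀ i)]
      rw [qfac_eq_prod, biasedProb, hsum, ENNReal.ofReal_prod_of_nonneg]
      · simp only [hrk]
        exact Finset.prod_congr rfl fun i _ => (ENNReal.ofReal_div_of_pos (hlt i)).symm
      · intro i _
        simp only [hrk]
        exact div_nonneg (hx.weight_pos _).le (hlt i).le
    rw [hq]
    by_cases hxB : ranked x ∈ B <;> simp [indicator, hxB]
  · intro j hj
    rw [indicator_apply_eq_zero]
    intro _
    simp [hj]

end Biased

end

/-! ### From exchangeable order to independent uniform levels. -/

section

section Order

variable {Ω : Type*} [MeasurableSpace Ω] {μ : Measure Ω} {l a : ℕ → Ω → ℝ}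

/-- Random distinct points `a`, such that all orders of the first `n` points are equally likely,
independently of `l`. -/
structure ExchOrder (μ : Measure Ω) (l a : ℕ → Ω → ℝ) : Prop where
  measurable_mark : ∀ k, Measurable (l k)
  measurable_point : ∀ k, Measurable (a k)
  injective : ∀ᵐ ω ∂μ, Function.Injective fun k => a k ω
  exchangeable : ∀ (n : ℕ) (σ : Equiv.Perm (Fin n)) (B : Set (Fin n → ℝ)), MeasurableSet B →
    μ ({ω | StrictMono fun i : Fin n => a (σ i) ω} ∩ {ω | (fun i : Fin n => l i ω) ∈ B})
      = ((n ! : ℕ) : ℝ≥0∞)⁻¹ * μ {ω | (fun i : Fin n => l i ω) ∈ B}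

/-- The marks of the points, along with their order relative to the earlier points. -/
def orderCode (l a : ℕ → ℝ) (n : ℕ) : ℝ × (ℕ → ℝ) :=
  (l n, fun i => if i ≤ n ∧ a i ≤ a n then 1 else 0)

/-- Points which are ordered as `σ` prescribes. -/
def permPoints {r : ℕ} (σ : Equiv.Perm (Fin r)) (i : ℕ) : ℝ :=
  if h : i < r then ((σ.symm ⟨i, h⟩ : ℕ) : ℝ) else 0

/-- The code of `r` marked points which are ordered as `σ` prescribes. -/
def permCode {r : ℕ} (σ : Equiv.Perm (Fin r)) (m : Fin r → ℝ) (n : Fin r) : ℝ × (ℕ → ℝ) :=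
  (m n, fun i => if i ≤ n ∧ permPoints σ i ≤ permPoints σ n then 1 else 0)

lemma measurable_permCode {r : ℕ} (σ : Equiv.Perm (Fin r)) : Measurable (permCode σ) :=
  measurable_pi_iff.2 fun n => (measurable_pi_apply n).prodMk measurable_const

lemma measurable_orderCode {α : Type*} [MeasurableSpace α] {l a : α → ℕ → ℝ} (hl : Measurable l)
    (ha : Measurable a) : Measurable fun z => orderCode (l z) (a z) := by
  refine measurable_pi_iff.2 fun n => ((measurable_pi_apply n).comp hl).prodMk ?_
  refine measurable_pi_iff.2 fun i => Measurable.ite ?_ measurable_const measurable_const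
  by_cases h : i ≤ n
  · simp only [h, true_and]
    exact measurableSet_le ((measurable_pi_apply i).comp ha) ((measurable_pi_apply n).comp ha)
  · simp [h]

lemma firstTerms_orderCode {r : ℕ} {σ : Equiv.Perm (Fin r)} {l a : ℕ → ℝ}
    (h : StrictMono fun i : Fin r => a (σ i)) :
    firstTerms r (orderCode l a) = permCode σ (fun i => l i) := by
  funext n
  refine Prod.ext rfl (funext fun i => ?_)
  simp only [firstTerms, orderCode, permCode]
  refine if_congr (and_congr_right fun hi => ?_) rfl rfl
  have hir : i < r := hi.trans_lt n.2
  have h1 := h.le_iff_le (a := σ.symm ⟨i, hir⟩) (b := σ.symm n)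
  simp only [Equiv.apply_symm_apply] at h1
  rw [h1]
  simp [permPoints, hir]

lemma existsUnique_strictMono {r : ℕ} {a : Fin r → ℝ} (h : Function.Injective a) :
    ∃! σ : Equiv.Perm (Fin r), StrictMono fun i => a (σ i) := by
  refine ⟨Tuple.sort a, (Tuple.monotone_sort a).strictMono_of_injective
    (h.comp (Tuple.sort a).injective), fun σ hσ => ?_⟩
  have := Tuple.unique_monotone (f := a) hσ.monotone (Tuple.monotone_sort a)
  exact Equiv.ext fun i => h (congrFun this i)

lemma sum_indicator_strictMono {r : ℕ} {a : Fin r → ℝ} (h : Function.Injective a) :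
    ∑ σ : Equiv.Perm (Fin r), {b : Fin r → ℝ | StrictMono fun i => b (σ i)}.indicator
      (1 : (Fin r → ℝ) → ℝ≥0∞) a = 1 := by
  obtain ⟨σ, hσ, hu⟩ := existsUnique_strictMono h
  rw [Finset.sum_eq_single σ]
  · exact indicator_of_mem hσ 1
  · intro τ _ hτ
    exact indicator_of_notMem (fun h => hτ (hu τ h)) 1
  · simp

lemma measurableSet_strictMono {r : ℕ} (σ : Equiv.Perm (Fin r)) :
    MeasurableSet {b : Fin r → ℝ | StrictMono fun i => b (σ i)} := by
  simp only [StrictMono, Set.ofPred_forall]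
  exact MeasurableSet.iInter fun i => MeasurableSet.iInter fun j => MeasurableSet.iInter fun _ =>
    measurableSet_lt (measurable_pi_apply _) (measurable_pi_apply _)

/-- Almost surely exactly one permutation σ orders the first r points. Where it does, the code is a
function of σ and the marks, and by exchangeability this event has probability 1/r! independently of
the marks. -/
lemma ExchOrder.lintegral_code (h : ExchOrder μ l a) (r : ℕ)
    {f : (Fin r → ℝ × (ℕ → ℝ)) → ℝ≥0∞} (hf : Measurable f) :
    ∫⁻ ω, f (firstTerms r (orderCode (fun k => l k ω) (fun k => a k ω))) ∂μ =
      ∑ σ : Equiv.Perm (Fin r), ((r ! : ℕ) : ℝ≥0∞)⁻¹ *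
        ∫⁻ m, f (permCode σ m) ∂(μ.map fun ω k => l k ω).map (firstTerms r) := by
  have hl : Measurable fun ω k => l k ω := measurable_pi_iff.2 h.measurable_mark
  have hlr : Measurable fun ω => fun i : Fin r => l i ω :=
    measurable_pi_iff.2 fun i => h.measurable_mark i
  have har : Measurable fun ω => fun i : Fin r => a i ω :=
    measurable_pi_iff.2 fun i => h.measurable_point i
  have hmap : (μ.map fun ω k => l k ω).map (firstTerms r) = μ.map fun ω => fun i : Fin r => l i ω :=
    Measure.map_map (measurable_firstTerms r) hl
  have hE : ∀ σ : Equiv.Perm (Fin r),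
      MeasurableSet {ω | StrictMono fun i : Fin r => a (σ i) ω} := fun σ =>
    har (measurableSet_strictMono σ)
  have hrestr : ∀ σ : Equiv.Perm (Fin r),
      (μ.restrict {ω | StrictMono fun i : Fin r => a (σ i) ω}).map (fun ω => fun i : Fin r => l i ω)
        = ((r ! : ℕ) : ℝ≥0∞)⁻¹ • μ.map fun ω => fun i : Fin r => l i ω := by
    intro σ
    ext B hB
    rw [Measure.map_apply hlr hB, Measure.restrict_apply (hlr hB), inter_comm, Measure.smul_apply,
      Measure.map_apply hlr hB, smul_eq_mul]
    exact h.exchangeable r σ B hB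
  have hfm : ∀ σ, Measurable fun m => f (permCode σ m) := fun σ => hf.comp (measurable_permCode σ)
  have hσ : ∀ σ : Equiv.Perm (Fin r), ((r ! : ℕ) : ℝ≥0∞)⁻¹ *
      ∫⁻ m, f (permCode σ m) ∂(μ.map fun ω k => l k ω).map (firstTerms r) =
      ∫⁻ ω, {b : Fin r → ℝ | StrictMono fun i => b (σ i)}.indicator 1 (fun i => a i ω) *
        f (firstTerms r (orderCode (fun k => l k ω) (fun k => a k ω))) ∂μ := by
    intro σ
    rw [hmap, ← smul_eq_mul, ← lintegral_smul_measure, ← hrestr, lintegral_map (hfm σ) hlr,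
      ← lintegral_indicator (hE σ)]
    refine lintegral_congr fun ω => ?_
    by_cases hω : StrictMono fun i : Fin r => a (σ i) ω
    · rw [indicator_of_mem (show ω ∈ {ω | StrictMono fun i : Fin r => a (σ i) ω} from hω),
        indicator_of_mem (show (fun i : Fin r => a i ω) ∈ {b : Fin r → ℝ |
          StrictMono fun i => b (σ i)} from hω), Pi.one_apply, one_mul, firstTerms_orderCode hω]
    · rw [indicator_of_notMem (show ω ∉ {ω | StrictMono fun i : Fin r => a (σ i) ω} from hω),
        indicator_of_notMem (show (fun i : Fin r => a i ω) ∉ {b : Fin r → ℝ |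
          StrictMono fun i => b (σ i)} from hω), zero_mul]
  have hcode : Measurable fun ω => f (firstTerms r (orderCode (fun k => l k ω) fun k => a k ω)) :=
    hf.comp ((measurable_firstTerms r).comp
      (measurable_orderCode hl (measurable_pi_iff.2 h.measurable_point)))
  simp only [hσ]
  rw [← lintegral_finsetSum]
  · refine lintegral_congr_ae ?_
    filter_upwards [h.injective] with ω hω
    rw [← Finset.sum_mul, sum_indicator_strictMono, one_mul]
    exact fun i j hij => Fin.ext (hω hij)
  · intro σ _
    exact ((measurable_one.indicator (measurableSet_strictMono σ)).comp har).mul hcode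

/-- By `ExchOrder.lintegral_code` the law of the code is determined by that of the marks, so
exchangeably ordered points may be replaced by independent uniform points. -/
theorem ExchOrder.map_code_eq [IsProbabilityMeasure μ] {Ω' : Type*} [MeasurableSpace Ω']
    {ν : Measure Ω'} {l' a' : ℕ → Ω' → ℝ} (h : ExchOrder μ l a) (h' : ExchOrder ν l' a')
    (hl : (μ.map fun ω k => l k ω) = ν.map fun ω k => l' k ω) :
    (μ.map fun ω => orderCode (fun k => l k ω) (fun k => a k ω)) =
      ν.map fun ω => orderCode (fun k => l' k ω) (fun k => a' k ω) := by
  have hm : Measurable fun ω => orderCode (fun k => l k ω) (fun k => a k ω) := measurable_orderCode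
    (measurable_pi_iff.2 h.measurable_mark) (measurable_pi_iff.2 h.measurable_point)
  have hm' : Measurable fun ω => orderCode (fun k => l' k ω) (fun k => a' k ω) :=
    measurable_orderCode
      (measurable_pi_iff.2 h'.measurable_mark) (measurable_pi_iff.2 h'.measurable_point)
  have := Measure.isProbabilityMeasure_map (μ := μ) hm.aemeasurable
  refine ext_of_firstTerms fun r => Measure.ext_of_lintegral _ fun f hf => ?_
  have hfr : Measurable fun y : ℕ → ℝ × (ℕ → ℝ) => f (firstTerms r y) :=
    hf.comp (measurable_firstTerms r)
  rw [lintegral_map hf (measurable_firstTerms r), lintegral_map hf (measurable_firstTerms r),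
    lintegral_map hfr hm, lintegral_map hfr hm', h.lintegral_code r hf, h'.lintegral_code r hf, hl]

/-- All n! orders have the same probability, as the coordinates can be permuted, and almost surely
exactly one of them occurs. -/
lemma unifSeq_strictMono (n : ℕ) (σ : Equiv.Perm (Fin n)) :
    unifSeq {Z | StrictMono fun i : Fin n => Z (σ i)} = ((n ! : ℕ) : ℝ≥0∞)⁻¹ := by
  have hm : ∀ τ : Equiv.Perm (Fin n), Measurable fun (Z : ℕ → ℝ) (i : Fin n) => Z (τ i) := fun τ =>
    measurable_pi_iff.2 fun i => measurable_pi_apply _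
  have h : ∀ τ : Equiv.Perm (Fin n), unifSeq {Z | StrictMono fun i : Fin n => Z (τ i)} =
      (Measure.infinitePi fun _ : Fin n => unif) {b | StrictMono b} := by
    intro τ
    have e := Measure.map_infinitePi_infinitePi_of_inj (P := fun _ : ℕ => unif)
      (f := fun i : Fin n => ((τ i : Fin n) : ℕ)) (Fin.val_injective.comp τ.injective)
    rw [← e, Measure.map_apply (hm τ)]
    · rfl
    · exact measurableSet_strictMono (Equiv.refl _)
  have hsum : ∑ τ : Equiv.Perm (Fin n), unifSeq {Z | StrictMono fun i : Fin n => Z (τ i)} = 1 := by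
    have hi : ∀ τ : Equiv.Perm (Fin n), unifSeq {Z | StrictMono fun i : Fin n => Z (τ i)} =
        ∫⁻ Z, {b : Fin n → ℝ | StrictMono fun i => b (τ i)}.indicator 1 (fun i : Fin n => Z i)
          ∂unifSeq := by
      intro τ
      exact (lintegral_indicator_one ((hm (Equiv.refl _)) (measurableSet_strictMono τ))).symm
    simp only [hi]
    rw [← lintegral_finsetSum]
    · have : ∀ᵐ Z ∂unifSeq, (∑ τ : Equiv.Perm (Fin n), {b : Fin n → ℝ |
          StrictMono fun i => b (τ i)}.indicator (1 : (Fin n → ℝ) → ℝ≥0∞)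
            (fun i : Fin n => Z i)) = 1 := by
        filter_upwards [ae_injective_unifSeq] with Z hZ
        exact sum_indicator_strictMono (hZ.comp Fin.val_injective)
      rw [lintegral_congr_ae this]
      simp
    · intro τ _
      exact (measurable_one.indicator (measurableSet_strictMono τ)).comp (hm (Equiv.refl _))
  rw [h σ]
  simp only [h, Finset.sum_const, nsmul_eq_mul, Finset.card_univ, Fintype.card_perm,
    Fintype.card_fin] at hsum
  exact ENNReal.eq_inv_of_mul_eq_one_left ((mul_comm _ _).trans hsum)

lemma exchOrder_unifSeq (rho : Measure (ℕ → ℝ)) [IsProbabilityMeasure rho] :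
    ExchOrder (rho.prod unifSeq) (fun k z => z.1 k) (fun k z => z.2 k) where
  measurable_mark k := (measurable_pi_apply k).comp measurable_fst
  measurable_point k := (measurable_pi_apply k).comp measurable_snd
  injective := Measure.quasiMeasurePreserving_snd.ae ae_injective_unifSeq
  exchangeable n σ B hB := by
    have e1 : ({z : (ℕ → ℝ) × (ℕ → ℝ) | StrictMono fun i : Fin n => z.2 (σ i)} ∩
        {z | (fun i : Fin n => z.1 i) ∈ B}) =
        {x : ℕ → ℝ | (fun i : Fin n => x i) ∈ B} ×ˢ {Z | StrictMono fun i : Fin n => Z (σ i)} := by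
      ext z
      simp [and_comm]
    have e2 : {z : (ℕ → ℝ) × (ℕ → ℝ) | (fun i : Fin n => z.1 i) ∈ B} =
        {x : ℕ → ℝ | (fun i : Fin n => x i) ∈ B} ×ˢ univ := by
      ext z
      simp
    rw [e1, e2, Measure.prod_prod, Measure.prod_prod, unifSeq_strictMono, measure_univ, mul_one,
      mul_comm]

/-- Whether point `i` is to the left of point `k` or equal to it. -/
def codeLE (y : ℕ → ℝ × (ℕ → ℝ)) (i k : ℕ) : ℝ :=
  if i ≤ k then (y k).2 i else 1 - (y i).2 k

/-- The asymptotic fraction of the points to the left of point `k`. -/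
def codeLevel (y : ℕ → ℝ × (ℕ → ℝ)) (k : ℕ) : ℝ :=
  limsup (fun n : ℕ => (∑ i ∈ Finset.range n, codeLE y i k) / n) atTop

lemma measurable_codeLevel : Measurable codeLevel := by
  have h : ∀ n i, Measurable fun y : ℕ → ℝ × (ℕ → ℝ) => (y n).2 i := fun n i =>
    (measurable_pi_apply i).comp (measurable_snd.comp (measurable_pi_apply n))
  refine measurable_pi_iff.2 fun k => Measurable.limsup fun n => ?_
  refine Measurable.div_const (Finset.measurable_sum _ fun i _ => ?_) _
  unfold codeLE
  split_ifs
  · exact h k i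
  · exact measurable_const.sub (h i k)

/-- The code compares a point with earlier ones only; comparison with a later point is recovered by
complementation, which is valid since the points are distinct. -/
lemma codeLevel_orderCode {l a : ℕ → ℝ} (ha : Function.Injective a) (k : ℕ) :
    codeLevel (orderCode l a) k = localTime a (a k) := by
  unfold codeLevel localTime fracLeft
  congr 1
  funext n
  congr 1
  rw [Finset.card_filter]
  push_cast
  refine Finset.sum_congr rfl fun i _ => ?_
  simp only [codeLE, orderCode]
  rcases le_or_gt i k with hik | hik
  · simp [hik]
  · have hne : a i ≠ a k := fun h => hik.ne' (ha h)
    rw [if_neg (not_le.2 hik)]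
    rcases lt_or_gt_of_ne hne with h | h
    · simp [h.le, h]
    · simp [h.le, h, hik.le]

lemma Generic.localTime_self {Z : ℕ → ℝ} (hZ : Generic Z) {t : ℝ} (ht : t ∈ Icc (0 : ℝ) 1) :
    localTime Z t = t :=
  (hZ.equidist t ht).limsup_eq

/-- The marks and levels of exchangeably ordered points are independent, and the levels are
independent uniform variables. -/
theorem ExchOrder.map_levels [IsProbabilityMeasure μ] (h : ExchOrder μ l a) :
    (μ.map fun ω => ((fun k => l k ω), codeLevel (orderCode (fun k => l k ω) (fun k => a k ω)))) =
      (μ.map fun ω k => l k ω).prod unifSeq := by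
  have hl : Measurable fun ω k => l k ω := measurable_pi_iff.2 h.measurable_mark
  have := Measure.isProbabilityMeasure_map (μ := μ) hl.aemeasurable
  have h' := exchOrder_unifSeq (μ.map fun ω k => l k ω)
  have hm : Measurable fun ω => orderCode (fun k => l k ω) (fun k => a k ω) :=
    measurable_orderCode hl (measurable_pi_iff.2 h.measurable_point)
  have hm' : Measurable fun z : (ℕ → ℝ) × (ℕ → ℝ) => orderCode (fun k => z.1 k) (fun k => z.2 k) :=
    measurable_orderCode measurable_fst measurable_snd
  have hF : Measurable fun y : ℕ → ℝ × (ℕ → ℝ) => ((fun k => (y k).1), codeLevel y) :=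
    (measurable_pi_iff.2 fun k => measurable_fst.comp (measurable_pi_apply k)).prodMk
      measurable_codeLevel
  have e := h.map_code_eq h' (by
    change _ = Measure.map Prod.fst _
    rw [← Measure.fst, Measure.fst_prod])
  have e2 := congrArg (Measure.map fun y : ℕ → ℝ × (ℕ → ℝ) => ((fun k => (y k).1), codeLevel y)) e
  rw [Measure.map_map hF hm, Measure.map_map hF hm'] at e2
  refine Eq.trans e2 ?_
  conv_rhs => rw [← Measure.map_id (μ := (μ.map fun ω k => l k ω).prod unifSeq)]
  refine Measure.map_congr ?_
  have hg : ∀ᵐ z ∂(μ.map fun ω k => l k ω).prod unifSeq, Generic z.2 :=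
    Measure.quasiMeasurePreserving_snd.ae ae_generic
  -- In the model with independent uniform points, the level of a point is the point itself by
  -- equidistribution.
  filter_upwards [hg] with z hz
  refine Prod.ext rfl (funext fun k => ?_)
  simp only [Function.comp, id]
  exact (codeLevel_orderCode hz.injective k).trans
    (hz.localTime_self ⟨(hz.pos k).le, (hz.lt_one k).le⟩)

end Order

end

/-! ### Local time as the inverse of the distribution function; identification of the division
points. -/

section

section LocalTime

lemma fracLeft_nonneg (b : ℕ → ℝ) (u : ℝ) (n : ℕ) : 0 ≤ fracLeft b u n := by
  unfold fracLeft
  positivity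

lemma fracLeft_le_one (b : ℕ → ℝ) (u : ℝ) (n : ℕ) : fracLeft b u n ≤ 1 := by
  unfold fracLeft
  refine div_le_one_of_le₀ ?_ (by positivity)
  exact_mod_cast (Finset.card_filter_le _ _).trans_eq (Finset.card_range n)

lemma isBoundedUnder_fracLeft (b : ℕ → ℝ) (u : ℝ) :
    IsBoundedUnder (· ≤ ·) atTop (fracLeft b u) :=
  isBoundedUnder_of ⟨1, fracLeft_le_one b u⟩

lemma isCoboundedUnder_fracLeft (b : ℕ → ℝ) (u : ℝ) :
    IsCoboundedUnder (· ≤ ·) atTop (fracLeft b u) :=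
  (isBoundedUnder_of ⟨0, fracLeft_nonneg b u⟩).isCoboundedUnder_le

lemma localTime_mono (b : ℕ → ℝ) : Monotone (localTime b) := fun s t h =>
  limsup_le_limsup (Eventually.of_forall fun n => fracLeft_mono b n h)
    (isCoboundedUnder_fracLeft b s) (isBoundedUnder_fracLeft b t)

lemma localTime_mem_Icc (b : ℕ → ℝ) (u : ℝ) : localTime b u ∈ Icc (0 : ℝ) 1 :=
  ⟨le_limsup_of_frequently_le (Frequently.of_forall fun n => fracLeft_nonneg b u n)
      (isBoundedUnder_fracLeft b u),
    limsup_le_of_le (isCoboundedUnder_fracLeft b u)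
      (Eventually.of_forall fun n => fracLeft_le_one b u n)⟩

end LocalTime

section Cdf

variable {L : ℕ → ℝ≥0∞} {X : ℕ → ℝ}

lemma cdfOf_eq_tsum (hL : ∑' k, L k = 1) (X : ℕ → ℝ) (t : ℝ) :
    cdfOf L X t = ∑' k, if X k ≤ t then (L k).toReal else 0 := by
  unfold cdfOf massLE
  rw [ENNReal.tsum_toReal_eq]
  · exact tsum_congr fun k => by split_ifs <;> simp
  · intro k
    split_ifs
    · exact mass_ne_top hL k
    · simp

lemma tendsto_cdfOf (hL : ∑' k, L k = 1) {ι : Type*} {l : Filter ι} {f : ι → ℝ} {t : ℝ}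
    (h : ∀ k, ∀ᶠ i in l, (X k ≤ f i ↔ X k ≤ t)) :
    Tendsto (fun i => cdfOf L X (f i)) l (𝓝 (cdfOf L X t)) := by
  simp only [cdfOf_eq_tsum hL]
  have hs : Summable fun k => (L k).toReal := ENNReal.summable_toReal (by simp [hL])
  refine tendsto_tsum_of_dominated_convergence hs (fun k => ?_) ?_
  · refine tendsto_const_nhds.congr' ?_
    filter_upwards [h k] with i hi
    simp only [hi]
  · refine Eventually.of_forall fun i k => ?_
    split_ifs <;> simp

lemma tendsto_cdfOf_nhdsGT (hL : ∑' k, L k = 1) (X : ℕ → ℝ) (t : ℝ) :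
    Tendsto (cdfOf L X) (𝓝[>] t) (𝓝 (cdfOf L X t)) := by
  refine tendsto_cdfOf hL fun k => ?_
  rcases le_or_gt (X k) t with h | h
  · filter_upwards [self_mem_nhdsWithin] with i hi
    exact ⟨fun _ => h, fun _ => h.trans (le_of_lt hi)⟩
  · filter_upwards [mem_nhdsWithin_of_mem_nhds (Iio_mem_nhds h)] with i hi
    exact ⟨fun hk => absurd hk (not_le.2 hi), fun hk => absurd hk (not_le.2 h)⟩

lemma cdfOf_one (hL : ∑' k, L k = 1) (hX : Generic X) : cdfOf L X 1 = 1 := by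
  simp [cdfOf, massLE, (hX.lt_one _).le, hL]

/-- Equidistributed atoms are dense in [0,1] and each has positive mass. -/
lemma strictMonoOn_cdfOf (hL : ∑' k, L k = 1) (hpos : ∀ k, L k ≠ 0) (hX : Generic X) :
    StrictMonoOn (cdfOf L X) (Icc 0 1) := by
  intro s hs t ht hst
  obtain ⟨k, hk⟩ := hX.exists_mem_Ioc hs.1 hst ht.2
  have h1 := cdfOf_le_sub hL hk.1
  have h2 := cdfOf_mono hL X hk.2
  have h3 : 0 < (L k).toReal := ENNReal.toReal_pos (hpos k) (mass_ne_top hL k)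
  linarith

lemma cdfOf_notMem_jump (hL : ∑' k, L k = 1) (X : ℕ → ℝ) (t : ℝ) (k : ℕ) :
    cdfOf L X t ∉ Ioo (cdfOf L X (X k) - (L k).toReal) (cdfOf L X (X k)) := by
  rintro ⟨h1, h2⟩
  rcases lt_or_ge t (X k) with h | h
  · linarith [cdfOf_le_sub hL h]
  · linarith [cdfOf_mono hL X h]

lemma pick_lt_one (hL : ∑' k, L k = 1) (hX : Generic X) (v : ℝ) : pick L X v < 1 := by
  by_cases h : ∃ k, v ∈ Ioo (cdfOf L X (X k) - (L k).toReal) (cdfOf L X (X k))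
  · obtain ⟨k, hk⟩ := h
    rw [pick_eq hL hX.injective hk]
    exact hX.lt_one k
  · push Not at h
    have h' : ∀ k, ¬(cdfOf L X (X k) - (L k).toReal < v ∧ v < cdfOf L X (X k)) := fun k => h k
    simp [pick, h']

lemma chain_dStep_lt_one (hL : ∑' k, L k = 1) (hX : Generic X) (U : ℕ → ℝ) (j : ℕ) :
    chain (dStep L X) 0 U j < 1 := by
  induction j with
  | zero => exact one_pos
  | succ j ih => exact max_lt ih (pick_lt_one hL hX _)

lemma chain_dStep_nonneg (L : ℕ → ℝ≥0∞) (X U : ℕ → ℝ) (j : ℕ) :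
    0 ≤ chain (dStep L X) 0 U j := by
  induction j with
  | zero => exact le_rfl
  | succ j ih => exact ih.trans (le_max_left _ _)

lemma chain_update (f : ℝ → ℝ → ℝ) (s : ℝ) (U : ℕ → ℝ) {i j : ℕ} (hij : i ≤ j) (x : ℝ) :
    chain f s (Function.update U j x) i = chain f s U i := by
  induction i with
  | zero => rfl
  | succ i ih =>
    simp only [chain]
    rw [ih (by omega), Function.update_of_ne (by omega)]

/-- Each uniform variable falls in some interval when the `D`-partition is built. -/
def Hits (L : ℕ → ℝ≥0∞) (X U : ℕ → ℝ) : Prop :=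
  ∀ j, ∃ k, chain (dStep L X) 0 U j < X k ∧
    cdfOf L X (chain (dStep L X) 0 U j) + U j * (1 - cdfOf L X (chain (dStep L X) 0 U j)) ∈
      Ioo (cdfOf L X (X k) - (L k).toReal) (cdfOf L X (X k))

lemma measurableSet_hits {β : Type*} [MeasurableSpace β] {l : β → ℕ → ℝ≥0∞} {x U : β → ℕ → ℝ}
    (hl : Measurable l) (hx : Measurable x) (hU : Measurable U) :
    MeasurableSet {z | Hits (l z) (x z) (U z)} := by
  have hc := fun n => (measurable_pi_apply n).comp (measurable_dChain hl hx measurable_const hU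
    (s := fun _ => 0))
  have hF := fun n => measurable_cdfOf hl hx (hc n)
  have hxk := fun k => (measurable_pi_apply k).comp hx
  have hFk := fun k => measurable_cdfOf hl hx (hxk k)
  have hlk := fun k => ((measurable_pi_apply k).comp hl).ennreal_toReal
  have hUk := fun k => (measurable_pi_apply k).comp hU
  have hv := fun n => (hF n).add ((hUk n).mul (measurable_const.sub (hF n) (f := fun _ => (1 : ℝ))))
  simp only [Hits, Set.ofPred_forall, Set.ofPred_exists]
  refine MeasurableSet.iInter fun j => MeasurableSet.iUnion fun k => ?_
  exact (measurableSet_lt (hc j) (hxk k)).inter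
    ((measurableSet_lt ((hFk k).sub (hlk k)) (hv j)).inter (measurableSet_lt (hv j) (hFk k)))

lemma ae_hits (hL : ∑' k, L k = 1) (hpos : ∀ k, L k ≠ 0) (hX : Generic X) :
    ∀ᵐ U ∂unifSeq, Hits L X U := by
  refine ae_all_iff.2 fun j => ?_
  set c : (ℕ → ℝ) → ℝ := fun U => chain (dStep L X) 0 U j with hc
  have hcm : Measurable c := (measurable_pi_apply j).comp
    (measurable_dChain (l := fun _ => L) (x := fun _ => X) (s := fun _ => 0) measurable_const
      measurable_const measurable_const measurable_id)
  set A : ℝ → Set ℝ := fun s => {u | ∃ k, s < X k ∧ cdfOf L X s + u * (1 - cdfOf L X s) ∈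
      Ioo (cdfOf L X (X k) - (L k).toReal) (cdfOf L X (X k))} with hA
  have hFc : Measurable fun U => cdfOf L X (c U) :=
    measurable_cdfOf (l := fun _ => L) (x := fun _ => X) measurable_const measurable_const hcm
  have hv : Measurable fun U : ℕ → ℝ => cdfOf L X (c U) + U j * (1 - cdfOf L X (c U)) := by
    fun_prop
  have hm : MeasurableSet {U : ℕ → ℝ | U j ∉ A (c U)} := by
    have e : {U : ℕ → ℝ | U j ∈ A (c U)} = ⋃ k : ℕ, {U | c U < X k} ∩
        (fun U : ℕ → ℝ => cdfOf L X (c U) + U j * (1 - cdfOf L X (c U))) ⁻¹'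
          Ioo (cdfOf L X (X k) - (L k).toReal) (cdfOf L X (X k)) := by
      ext U
      simp [hA]
    have hm' : MeasurableSet {U : ℕ → ℝ | U j ∈ A (c U)} := by
      rw [e]
      exact MeasurableSet.iUnion fun k =>
        (measurableSet_lt hcm measurable_const).inter (hv measurableSet_Ioo)
    exact hm'.compl
  have h0 : unifSeq {U : ℕ → ℝ | U j ∉ A (c U)} = 0 := by
    rw [← lintegral_indicator_one hm, lintegral_unifSeq_update j (measurable_one.indicator hm)]
    refine (lintegral_congr fun U => ?_).trans lintegral_zero
    have hs : cdfOf L X (c U) < 1 := cdfOf_lt_one hL hpos hX (chain_dStep_lt_one hL hX U j)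
    refine (lintegral_congr_ae ?_).trans lintegral_zero
    filter_upwards [ae_exists_mem_jump hL hX.injective hs] with u hu
    refine indicator_of_notMem ?_ _
    -- The chain up to time j does not involve U j, so U j can be integrated out with the current
    -- state fixed.
    have hcu : c (Function.update U j u) = c U := chain_update _ _ _ le_rfl _
    simp only [mem_ofPred_eq, not_not, hcu, Function.update_self]
    exact hu
  filter_upwards [measure_eq_zero_iff_ae_notMem.1 h0] with U hU
  exact not_not.1 hU

end Cdf

/-- The interval with number `k` is the jump of the distribution function `cdfOf L X` at `X k`. -/
structure Config (a b : ℕ → ℝ) (L : ℕ → ℝ≥0∞) (X : ℕ → ℝ) : Prop where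
  tsum_eq : ∑' k, L k = 1
  ne_zero : ∀ k, L k ≠ 0
  generic : Generic X
  right : ∀ k, b k = cdfOf L X (X k)
  left : ∀ k, a k = cdfOf L X (X k) - (L k).toReal

/-- The intervals with X l ≤ X k are packed disjointly in (0, b k) and the others in (b k, 1). The
total length is 1, so both bounds are equalities and F(X k) = b k. -/
lemma config_of_partition {a b X : ℕ → ℝ} (hab : ∀ k, 0 ≤ a k ∧ a k < b k ∧ b k ≤ 1)
    (hdisj : Pairwise fun k l => Disjoint (Ioo (a k) (b k)) (Ioo (a l) (b l)))
    (hsum : HasSum (fun k => b k - a k) 1) (hX : Generic X)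
    (hord : ∀ k l, a k < a l → X k < X l) :
    Config a b (fun k => ENNReal.ofReal (b k - a k)) X := by
  set L : ℕ → ℝ≥0∞ := fun k => ENNReal.ofReal (b k - a k) with hLdef
  have hsep : ∀ k l, k ≠ l → a k ≤ a l → b k ≤ a l := by
    intro k l hkl h
    have := Set.Ioo_disjoint_Ioo.1 (hdisj hkl)
    rw [max_eq_right h] at this
    rcases min_le_iff.1 this with h1 | h1
    · exact h1
    · linarith [(hab l).2.1]
  have hL : ∑' k, L k = 1 := by
    rw [hLdef, ← ENNReal.ofReal_tsum_of_nonneg (fun k => by linarith [(hab k).2.1]) hsum.summable,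
      hsum.tsum_eq, ENNReal.ofReal_one]
  have hvol : ∀ (p : ℕ → Prop) [DecidablePred p] (c d : ℝ),
      (∀ k, p k → Ioo (a k) (b k) ⊆ Ioo c d) →
      ∑' k, (if p k then L k else 0) ≤ ENNReal.ofReal (d - c) := by
    intro p _ c d h
    have e : ∀ k, (if p k then L k else 0) = volume (if p k then Ioo (a k) (b k) else ∅) := by
      intro k
      split_ifs <;> simp [hLdef]
    simp only [e]
    rw [← measure_iUnion, ← Real.volume_Ioo]
    · refine measure_mono (iUnion_subset fun k => ?_)
      split_ifs with hk
      · exact h k hk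
      · exact empty_subset _
    · intro k l hkl
      simp only [Function.onFun]
      split_ifs
      · exact hdisj hkl
      all_goals simp
    · intro k
      split_ifs <;> simp
  have hright : ∀ k, b k = cdfOf L X (X k) := by
    intro k
    have h1 : massLE L X (X k) ≤ ENNReal.ofReal (b k - 0) := by
      refine hvol (fun l => X l ≤ X k) 0 (b k) fun l hl => ?_
      have hal : a l ≤ a k := not_lt.1 fun h => absurd (hord k l h) (not_lt.2 hl)
      refine Ioo_subset_Ioo (hab l).1 ?_
      by_cases hlk : l = k
      · rw [hlk]
      · exact (hsep l k hlk hal).trans (hab k).2.1.le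
    have h2 : massGT L X (X k) ≤ ENNReal.ofReal (1 - b k) := by
      refine hvol (fun l => X k < X l) (b k) 1 fun l hl => ?_
      have hkl : k ≠ l := fun h => by simp [h] at hl
      have hal : a k ≤ a l := not_lt.1 fun h => absurd (hord l k h) (not_lt.2 hl.le)
      exact Ioo_subset_Ioo (hsep k l hkl hal) (hab l).2.2
    rw [← ofReal_cdfOf hL, sub_zero, ENNReal.ofReal_le_ofReal_iff
      ((hab k).1.trans (hab k).2.1.le)] at h1
    rw [← ofReal_one_sub_cdfOf hL, ENNReal.ofReal_le_ofReal_iff (by linarith [(hab k).2.2])] at h2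
    linarith
  refine ⟨hL, fun k => ?_, hX, hright, fun k => ?_⟩
  · simpa [hLdef] using (hab k).2.1
  · rw [← hright, hLdef, ENNReal.toReal_ofReal (by linarith [(hab k).2.1])]
    ring

namespace Config

variable {a b X U : ℕ → ℝ} {L : ℕ → ℝ≥0∞}

lemma fracLeft_cdfOf (h : Config a b L X) {t : ℝ} (ht : t ∈ Icc (0 : ℝ) 1) :
    fracLeft b (cdfOf L X t) = fracLeft X t := by
  have hmono := strictMonoOn_cdfOf h.tsum_eq h.ne_zero h.generic
  funext n
  simp only [fracLeft, h.right]
  have e : ∀ k, cdfOf L X (X k) ≤ cdfOf L X t ↔ X k ≤ t := fun k => by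
    rw [hmono.le_iff_le ⟨(h.generic.pos k).le, (h.generic.lt_one k).le⟩ ht]
  simp only [e]

lemma localTime_cdfOf (h : Config a b L X) {t : ℝ} (ht : t ∈ Icc (0 : ℝ) 1) :
    localTime b (cdfOf L X t) = t := by
  have := h.generic.localTime_self ht
  rwa [localTime, ← h.fracLeft_cdfOf ht] at this

/-- The limit is the generalized inverse sup {t | F(t) ≤ u}: `fracLeft b` is monotone in u, and at
the points F(t) it is the empirical fraction of the X k, which tends to t. -/
lemma tendsto_fracLeft (h : Config a b L X) {u : ℝ} (hu : u ∈ Icc (0 : ℝ) 1) :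
    Tendsto (fracLeft b u) atTop (𝓝 (localTime b u)) := by
  set S := {t | t ∈ Icc (0 : ℝ) 1 ∧ cdfOf L X t ≤ u} with hS
  have h0 : (0 : ℝ) ∈ S := ⟨by simp, by
    rw [cdfOf_zero h.generic.pos]
    exact hu.1⟩
  have hbdd : BddAbove S := ⟨1, fun t ht => ht.1.2⟩
  have hs1 : sSup S ≤ 1 := csSup_le ⟨0, h0⟩ fun t ht => ht.1.2
  have hs0 : 0 ≤ sSup S := le_csSup hbdd h0
  have key : Tendsto (fracLeft b u) atTop (𝓝 (sSup S)) := by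
    refine tendsto_order.2 ⟨fun c hc => ?_, fun c hc => ?_⟩
    · obtain ⟨t, ht, hct⟩ := exists_lt_of_lt_csSup ⟨0, h0⟩ hc
      filter_upwards [(tendsto_order.1 (h.generic.equidist t ht.1)).1 c hct] with n hn
      rw [← h.fracLeft_cdfOf ht.1] at hn
      exact hn.trans_le (fracLeft_mono b n ht.2)
    · rcases eq_or_lt_of_le hs1 with h1 | h1
      · exact Eventually.of_forall fun n => (fracLeft_le_one b u n).trans_lt (h1 ▸ hc)
      · obtain ⟨t, ht1, ht2⟩ := exists_between (lt_min hc h1)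
        have ht : t ∈ Icc (0 : ℝ) 1 := ⟨hs0.trans ht1.le, (ht2.trans_le (min_le_right _ _)).le⟩
        have hut : u ≤ cdfOf L X t := by
          by_contra hlt
          exact absurd (le_csSup hbdd ⟨ht, (not_le.1 hlt).le⟩) (not_le.2 ht1)
        filter_upwards [(tendsto_order.1 (h.generic.equidist t ht)).2 c
          (ht2.trans_le (min_le_left _ _))] with n hn
        rw [← h.fracLeft_cdfOf ht] at hn
        exact (fracLeft_mono b n hut).trans_lt hn
  have e : localTime b u = sSup S := key.limsup_eq
  rwa [e]

/-- A monotone map onto [0,1] has no jumps, and the value t is attained at F(t). -/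
lemma continuous_localTime (h : Config a b L X) : Continuous (localTime b) := by
  have hmono : Monotone fun u => (⟨localTime b u, localTime_mem_Icc b u⟩ : Icc (0 : ℝ) 1) :=
    fun s t hst => localTime_mono b hst
  have hsurj : Function.Surjective fun u =>
      (⟨localTime b u, localTime_mem_Icc b u⟩ : Icc (0 : ℝ) 1) := fun t =>
    ⟨cdfOf L X t, Subtype.ext (h.localTime_cdfOf t.2)⟩
  exact continuous_subtype_val.comp (hmono.continuous_of_surjective hsurj)

lemma tPoint_eq (h : Config a b L X) (hU : ∀ k, U k ∈ Ioo (0 : ℝ) 1) (j : ℕ) :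
    tPoint b U j = cdfOf L X (tLevel U j) := by
  cases j with
  | zero => rw [tPoint, tLevel_zero, cdfOf_zero h.generic.pos]
  | succ j =>
    rw [tPoint]
    set t := tLevel U (j + 1) with ht
    have ht0 : 0 ≤ t := tLevel_nonneg hU _
    have ht1 : t < 1 := tLevel_lt_one hU _
    have hmem : ∀ s, t < s → s ≤ 1 → cdfOf L X s ∈ {u | 0 ≤ u ∧ u ≤ 1 ∧ t < localTime b u} :=
      fun s hts hs => ⟨cdfOf_nonneg L X s, cdfOf_le_one h.tsum_eq X s, by
        rwa [h.localTime_cdfOf ⟨ht0.trans hts.le, hs⟩]⟩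
    have hbdd : BddBelow {u | 0 ≤ u ∧ u ≤ 1 ∧ t < localTime b u} := ⟨0, fun u hu => hu.1⟩
    refine le_antisymm ?_ ?_
    -- For s slightly greater than t, F(s) belongs to the set, as its local time is s. Right
    -- continuity of F then bounds the infimum by F(t).
    · refine ge_of_tendsto (tendsto_cdfOf_nhdsGT h.tsum_eq X t) ?_
      filter_upwards [self_mem_nhdsWithin, mem_nhdsWithin_of_mem_nhds (Iio_mem_nhds ht1)] with s hs1
        hs2
      exact csInf_le hbdd (hmem s hs1 (le_of_lt hs2))
    · refine le_csInf ⟨_, hmem 1 ht1 le_rfl⟩ fun u hu => ?_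
      by_contra hlt
      have := localTime_mono b (not_le.1 hlt).le
      rw [h.localTime_cdfOf ⟨ht0, ht1.le⟩] at this
      exact absurd hu.2.2 (not_lt.2 this)

lemma nextPoint_eq (h : Config a b L X) {v : ℝ} {k : ℕ}
    (hv : v ∈ Ioo (cdfOf L X (X k) - (L k).toReal) (cdfOf L X (X k))) :
    nextPoint a b v = cdfOf L X (X k) := by
  refine le_antisymm (csInf_le ⟨v, fun t ht => ht.1⟩ ⟨hv.2.le, cdfOf_le_one h.tsum_eq X _, ?_⟩)
    (le_csInf ⟨1, (hv.2.le.trans (cdfOf_le_one h.tsum_eq X _)), le_rfl, ?_⟩ fun t ht => ?_)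
  · simp only [mem_iUnion, not_exists, h.left, h.right]
    exact cdfOf_notMem_jump h.tsum_eq X _
  · simp only [mem_iUnion, not_exists, h.left, h.right]
    have := cdfOf_notMem_jump h.tsum_eq X 1
    rwa [cdfOf_one h.tsum_eq h.generic] at this
  · by_contra hlt
    refine ht.2.2 (mem_iUnion.2 ⟨k, ?_⟩)
    rw [h.left, h.right]
    exact ⟨hv.1.trans_le ht.1, not_le.1 hlt⟩

lemma dPoint_eq (h : Config a b L X) (hU : Hits L X U) (j : ℕ) :
    dPoint a b U j = cdfOf L X (chain (dStep L X) 0 U j) := by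
  induction j with
  | zero => rw [dPoint, chain, cdfOf_zero h.generic.pos]
  | succ j ih =>
    obtain ⟨k, hk, hv⟩ := hU j
    rw [dPoint, ih, h.nextPoint_eq hv, chain, dStep, pick_eq h.tsum_eq h.generic.injective hv,
      max_eq_right hk.le]

lemma chain_lt_succ (h : Config a b L X) (hU : Hits L X U) (j : ℕ) :
    chain (dStep L X) 0 U j < chain (dStep L X) 0 U (j + 1) := by
  obtain ⟨k, hk, hv⟩ := hU j
  rw [chain, dStep, pick_eq h.tsum_eq h.generic.injective hv, max_eq_right hk.le]
  exact hk

lemma dPoint_strictMono (h : Config a b L X) (hU : Hits L X U) : StrictMono (dPoint a b U) := by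
  refine strictMono_nat_of_lt_succ fun j => ?_
  have hm := fun i => (⟨chain_dStep_nonneg L X U i,
    (chain_dStep_lt_one h.tsum_eq h.generic U i).le⟩ : chain (dStep L X) 0 U i ∈ Icc (0 : ℝ) 1)
  rw [h.dPoint_eq hU, h.dPoint_eq hU]
  exact strictMonoOn_cdfOf h.tsum_eq h.ne_zero h.generic (hm j) (hm _) (h.chain_lt_succ hU j)

lemma tPoint_strictMono (h : Config a b L X) (hU : ∀ k, U k ∈ Ioo (0 : ℝ) 1) :
    StrictMono (tPoint b U) := by
  intro i j hij
  rw [h.tPoint_eq hU, h.tPoint_eq hU]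
  exact strictMonoOn_cdfOf h.tsum_eq h.ne_zero h.generic
    ⟨tLevel_nonneg hU i, (tLevel_lt_one hU i).le⟩ ⟨tLevel_nonneg hU j, (tLevel_lt_one hU j).le⟩
    (tLevel_strictMono hU hij)

lemma dSeq_eq (h : Config a b L X) (hU : Hits L X U) :
    dSeq a b U = incs L X (chain (dStep L X) 0 U) := by
  have hm := fun i => (⟨chain_dStep_nonneg L X U i,
    (chain_dStep_lt_one h.tsum_eq h.generic U i).le⟩ : chain (dStep L X) 0 U i ∈ Icc (0 : ℝ) 1)
  funext j
  simp only [dSeq, biSeq, incs, h.dPoint_eq hU, h.localTime_cdfOf (hm _)]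

lemma tSeq_eq (h : Config a b L X) (hU : ∀ k, U k ∈ Ioo (0 : ℝ) 1) :
    tSeq b U = incs L X (tLevel U) := by
  have hm := fun i => (⟨tLevel_nonneg hU i, (tLevel_lt_one hU i).le⟩ : tLevel U i ∈ Icc (0 : ℝ) 1)
  funext j
  simp only [tSeq, biSeq, incs, h.tPoint_eq hU, h.localTime_cdfOf (hm _)]

/-- The new D-point is to the right of the uniform point V of its step, so the remaining length
shrinks by at least the factor 1 - U j. -/
lemma one_sub_dPoint_le (h : Config a b L X) (hH : Hits L X U) (hU : ∀ k, U k ∈ Ioo (0 : ℝ) 1)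
    (j : ℕ) : 1 - dPoint a b U j ≤ 1 - tLevel U j := by
  induction j with
  | zero => simp [dPoint, tLevel_zero]
  | succ j ih =>
    obtain ⟨k, hk, hv⟩ := hH j
    have e1 := h.dPoint_eq hH (j + 1)
    rw [chain, dStep, pick_eq h.tsum_eq h.generic.injective hv, max_eq_right hk.le] at e1
    rw [← h.dPoint_eq hH j] at hv
    have e2 : 1 - tLevel U (j + 1) = (1 - tLevel U j) * (1 - U j) := by
      simp only [tLevel, Finset.prod_range_succ]
      ring
    rw [e2]
    have := mul_le_mul_of_nonneg_right ih (by linarith [(hU j).2] : (0 : ℝ) ≤ 1 - U j)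
    rw [e1]
    nlinarith [hv.2]

lemma tendsto_dPoint (h : Config a b L X) (hH : Hits L X U) (hU : ∀ k, U k ∈ Ioo (0 : ℝ) 1)
    (ht : Tendsto (tLevel U) atTop (𝓝 1)) : Tendsto (dPoint a b U) atTop (𝓝 1) := by
  refine tendsto_of_tendsto_of_tendsto_of_le_of_le ht tendsto_const_nhds (fun j => ?_) fun j => ?_
  · linarith [h.one_sub_dPoint_le hH hU j]
  · rw [h.dPoint_eq hH]
    exact cdfOf_le_one h.tsum_eq X _

lemma tendsto_tPoint (h : Config a b L X) (hU : ∀ k, U k ∈ Ioo (0 : ℝ) 1)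
    (ht : Tendsto (tLevel U) atTop (𝓝 1)) : Tendsto (tPoint b U) atTop (𝓝 1) := by
  have e : tPoint b U = fun j => cdfOf L X (tLevel U j) := funext fun j => h.tPoint_eq hU j
  rw [e, ← cdfOf_one h.tsum_eq h.generic]
  refine tendsto_cdfOf h.tsum_eq fun k => ?_
  filter_upwards [(tendsto_order.1 ht).1 _ (h.generic.lt_one k)] with j hj
  exact ⟨fun _ => (h.generic.lt_one k).le, fun _ => hj.le⟩

end Config

/-- The product of the first n factors 1 - U i has mean 2⁻ⁿ. These means are summable, so the
products are almost surely summable and tend to 0. -/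
lemma ae_tendsto_tLevel : ∀ᵐ U ∂unifSeq, Tendsto (tLevel U) atTop (𝓝 1) := by
  have hc : ∫⁻ u, ENNReal.ofReal (1 - u) ∂unif = 2⁻¹ := by
    rw [unif, ← ofReal_integral_eq_lintegral_ofReal]
    · rw [← integral_Ioc_eq_integral_Ioo, ← intervalIntegral.integral_of_le zero_le_one]
      rw [intervalIntegral.integral_sub (by simp) (by simp)]
      simp only [intervalIntegral.integral_const, integral_id]
      norm_num
      rw [ENNReal.ofReal_div_of_pos (by norm_num)]
      simp
    · exact (continuous_const.sub continuous_id).integrableOn_Icc.mono_set Ioo_subset_Icc_self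
    · filter_upwards [ae_restrict_mem measurableSet_Ioo] with u hu
      simpa using hu.2.le
  have hm : ∀ n, Measurable fun U : ℕ → ℝ =>
      ENNReal.ofReal (∏ i ∈ Finset.range n, (1 - U i)) := fun n => by fun_prop
  have hp : ∀ n, ∫⁻ U, ENNReal.ofReal (∏ i ∈ Finset.range n, (1 - U i)) ∂unifSeq = 2⁻¹ ^ n := by
    intro n
    induction n with
    | zero => simp
    | succ n ih =>
      rw [lintegral_unifSeq_cons (hm (n + 1))]
      simp only [Finset.prod_range_succ', seqCons_succ, seqCons_zero]
      rw [pow_succ, ← ih, ← hc]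
      have : ∀ u ∈ Ioo (0 : ℝ) 1, ∫⁻ U, ENNReal.ofReal ((∏ i ∈ Finset.range n, (1 - U i)) * (1 - u))
          ∂unifSeq = (∫⁻ U, ENNReal.ofReal (∏ i ∈ Finset.range n, (1 - U i)) ∂unifSeq) *
            ENNReal.ofReal (1 - u) := by
        intro u hu
        rw [← lintegral_mul_const _ (hm n)]
        refine lintegral_congr fun U => ?_
        rw [ENNReal.ofReal_mul' (by linarith [hu.2])]
      rw [← lintegral_const_mul _ (by fun_prop)]
      exact setLIntegral_congr_fun measurableSet_Ioo this
  have hsum : ∫⁻ U, ∑' n, ENNReal.ofReal (∏ i ∈ Finset.range n, (1 - U i)) ∂unifSeq ≠ ∞ := by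
    rw [lintegral_tsum fun n => (hm n).aemeasurable]
    simp [hp, ENNReal.tsum_geometric]
  filter_upwards [ae_lt_top (Measurable.tsum hm) hsum, ae_mem_Ioo_unifSeq] with U h1 h2
  have h3 := ENNReal.tendsto_atTop_zero_of_tsum_ne_top h1.ne
  have h4 : Tendsto (fun n => ∏ i ∈ Finset.range n, (1 - U i)) atTop (𝓝 0) := by
    have h5 := (ENNReal.tendsto_toReal ENNReal.zero_ne_top).comp h3
    refine (h5.congr fun n => ?_)
    exact ENNReal.toReal_ofReal (Finset.prod_nonneg fun i _ => by linarith [(h2 i).2])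
  have h6 := (tendsto_const_nhds (x := (1 : ℝ))).sub h4
  rw [sub_zero] at h6
  exact h6

end

/-! ### The canonical model: masses, positions and uniform variables. -/

section

/-- Equality of pieces i < j would force U j to equal a quantity determined by the earlier
variables. The T-terms are thus distinct, as ranking requires. -/
lemma ae_injective_stick : ∀ᵐ U ∂unifSeq, Function.Injective (stick 1 U) := by
  have h : ∀ i j : ℕ, i < j → ∀ᵐ U ∂unifSeq, U j ≠ stick 1 U i / ∏ l ∈ Finset.range j, (1 - U l) := by
    intro i j hij
    have hs : Measurable fun U : ℕ → ℝ => stick 1 U i / ∏ l ∈ Finset.range j, (1 - U l) := by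
      unfold stick
      fun_prop
    have hm : MeasurableSet {U : ℕ → ℝ | U j = stick 1 U i / ∏ l ∈ Finset.range j, (1 - U l)} :=
      measurableSet_eq_fun (measurable_pi_apply j) hs
    suffices h0 : unifSeq {U : ℕ → ℝ | U j = stick 1 U i / ∏ l ∈ Finset.range j, (1 - U l)} = 0 from
      measure_eq_zero_iff_ae_notMem.1 h0
    rw [← lintegral_indicator_one hm, lintegral_unifSeq_update j (measurable_one.indicator hm)]
    refine (lintegral_congr fun U => ?_).trans lintegral_zero
    refine (lintegral_congr_ae ?_).trans lintegral_zero
    set x := stick 1 U i / ∏ l ∈ Finset.range j, (1 - U l) with hx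
    have hne : ∀ᵐ u ∂unif, u ≠ x := by
      unfold unif
      exact ae_restrict_of_ae (Measure.ae_ne volume x)
    filter_upwards [hne] with u hu
    refine indicator_of_notMem ?_ _
    have e1 : ∀ n ≤ j, ∏ l ∈ Finset.range n, (1 - Function.update U j u l) =
        ∏ l ∈ Finset.range n, (1 - U l) := fun n hn => Finset.prod_congr rfl fun l hl => by
      rw [Function.update_of_ne (by have := Finset.mem_range.1 hl; omega)]
    simp only [mem_ofPred_eq, Function.update_self, stick, e1 j le_rfl, e1 i hij.le,
      Function.update_of_ne hij.ne]
    exact hu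
  have h' : ∀ᵐ U ∂unifSeq, ∀ i j : ℕ, i < j →
      U j ≠ stick 1 U i / ∏ l ∈ Finset.range j, (1 - U l) :=
    ae_all_iff.2 fun i => ae_all_iff.2 fun j => by
      by_cases hij : i < j
      · filter_upwards [h i j hij] with U hU _ using hU
      · exact Eventually.of_forall fun U h => absurd h hij
  filter_upwards [h', ae_mem_Ioo_unifSeq] with U h1 h2
  have key : ∀ i j, i < j → stick 1 U i ≠ stick 1 U j := by
    intro i j hij he
    have hp : (0 : ℝ) < ∏ l ∈ Finset.range j, (1 - U l) :=
      Finset.prod_pos fun l _ => by linarith [(h2 l).2]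
    refine h1 i j hij ?_
    rw [he, stick, one_mul, mul_div_cancel_right₀ _ hp.ne']
  intro i j hij
  by_contra hne
  rcases lt_or_gt_of_ne hne with h3 | h3
  · exact key i j h3 hij
  · exact key j i h3 hij.symm

lemma gem_one : gem 1 = unifSeq.map (stick 1) := by
  have hb : betaMeasure 1 1 = unif := by
    have e : betaPDF 1 1 = (Ioo (0 : ℝ) 1).indicator 1 := by
      ext x
      rw [betaPDF_eq]
      by_cases hx : 0 < x ∧ x < 1
      · rw [if_pos hx, indicator_of_mem (show x ∈ Ioo (0 : ℝ) 1 from hx)]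
        simp [beta, one_add_one_eq_two]
      · rw [if_neg hx, indicator_of_notMem (show x ∉ Ioo (0 : ℝ) 1 from hx)]
        simp
    rw [betaMeasure, e, withDensity_indicator_one measurableSet_Ioo, unif]
  have es : stick 1 = fun (W : ℕ → ℝ) j => W j * ∏ i ∈ Finset.range j, (1 - W i) := by
    funext W j
    rw [stick, one_mul]
  rw [gem, hb, es, unifSeq]

section Canonical

/-- The law of the masses and positions of the atoms, and of the uniform variables. -/
def jointLaw (lam : Measure (ℕ → ℝ≥0∞)) : Measure (((ℕ → ℝ≥0∞) × (ℕ → ℝ)) × (ℕ → ℝ)) :=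
  (lam.prod unifSeq).prod unifSeq

/-- The bivariate sequence of the `D`-partition. -/
def dIncs (z : ((ℕ → ℝ≥0∞) × (ℕ → ℝ)) × (ℕ → ℝ)) : ℕ → ℝ × ℝ :=
  incs z.1.1 z.1.2 (chain (dStep z.1.1 z.1.2) 0 z.2)

/-- The bivariate sequence of the `T`-partition. -/
def tIncs (z : ((ℕ → ℝ≥0∞) × (ℕ → ℝ)) × (ℕ → ℝ)) : ℕ → ℝ × ℝ :=
  incs z.1.1 z.1.2 (tLevel z.2)

lemma measurable_dIncs : Measurable dIncs :=
  measurable_incs (measurable_fst.comp measurable_fst) (measurable_snd.comp measurable_fst)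
    (measurable_dChain (measurable_fst.comp measurable_fst) (measurable_snd.comp measurable_fst)
      measurable_const measurable_snd)

lemma measurable_tIncs : Measurable tIncs :=
  measurable_incs (measurable_fst.comp measurable_fst) (measurable_snd.comp measurable_fst)
    (measurable_tLevel measurable_snd)

/-- Positive masses with sum `1`. -/
def Masses (L : ℕ → ℝ≥0∞) : Prop := ∑' k, L k = 1 ∧ ∀ k, L k ≠ 0

variable {lam : Measure (ℕ → ℝ≥0∞)}

instance [IsProbabilityMeasure lam] : IsProbabilityMeasure (jointLaw lam) := by unfold jointLaw; infer_instance

lemma lintegral_jointLaw {G : ((ℕ → ℝ≥0∞) × (ℕ → ℝ)) × (ℕ → ℝ) → ℝ≥0∞} (hG : Measurable G) :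
    ∫⁻ z, G z ∂jointLaw lam = ∫⁻ L, ∫⁻ X, ∫⁻ U, G ((L, X), U) ∂unifSeq ∂unifSeq ∂lam := by
  rw [jointLaw, lintegral_prod _ hG.aemeasurable, lintegral_prod]
  exact hG.lintegral_prod_right'.aemeasurable

lemma lintegral_map_jointLaw {α : Type*} [MeasurableSpace α]
    {S : ((ℕ → ℝ≥0∞) × (ℕ → ℝ)) × (ℕ → ℝ) → α} (hS : Measurable S) {F : α → ℝ≥0∞}
    (hF : Measurable F) : ∫⁻ y, F y ∂(jointLaw lam).map S =
      ∫⁻ L, ∫⁻ X, ∫⁻ U, F (S ((L, X), U)) ∂unifSeq ∂unifSeq ∂lam := by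
  rw [lintegral_map hF hS]
  exact lintegral_jointLaw (hF.comp hS)

/-- What holds almost surely for the masses and positions of the atoms and the uniform variables. -/
structure Typical (z : ((ℕ → ℝ≥0∞) × (ℕ → ℝ)) × (ℕ → ℝ)) : Prop where
  masses : Masses z.1.1
  generic : Generic z.1.2
  hits : Hits z.1.1 z.1.2 z.2
  mem_Ioo : ∀ k, z.2 k ∈ Ioo (0 : ℝ) 1
  tendsto_tLevel : Tendsto (tLevel z.2) atTop (𝓝 1)
  injective_stick : Function.Injective (stick 1 z.2)

lemma ae_typical (hlam : ∀ᵐ L ∂lam, Masses L) : ∀ᵐ z ∂jointLaw lam, Typical z := by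
  have h1 : ∀ᵐ z ∂jointLaw lam, Masses z.1.1 :=
    Measure.quasiMeasurePreserving_fst.ae (Measure.quasiMeasurePreserving_fst.ae hlam)
  have h2 : ∀ᵐ z ∂jointLaw lam, Generic z.1.2 :=
    Measure.quasiMeasurePreserving_fst.ae (Measure.quasiMeasurePreserving_snd.ae ae_generic)
  have h3 : ∀ᵐ z ∂jointLaw lam, Hits z.1.1 z.1.2 z.2 := by
    have hm := measurableSet_hits (l := fun z : ((ℕ → ℝ≥0∞) × (ℕ → ℝ)) × (ℕ → ℝ) => z.1.1)
      (x := fun z => z.1.2) (U := fun z => z.2) (measurable_fst.comp measurable_fst)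
      (measurable_snd.comp measurable_fst) measurable_snd
    rw [jointLaw, Measure.ae_prod_iff_ae_ae hm]
    have h1' : ∀ᵐ y ∂lam.prod unifSeq, Masses y.1 := Measure.quasiMeasurePreserving_fst.ae hlam
    have h2' : ∀ᵐ y ∂lam.prod unifSeq, Generic y.2 :=
      Measure.quasiMeasurePreserving_snd.ae ae_generic
    filter_upwards [h1', h2'] with y hy1 hy2
    exact ae_hits hy1.1 hy1.2 hy2
  have h4 : ∀ᵐ z ∂jointLaw lam, ∀ k, z.2 k ∈ Ioo (0 : ℝ) 1 :=
    Measure.quasiMeasurePreserving_snd.ae ae_mem_Ioo_unifSeq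
  have h5 : ∀ᵐ z ∂jointLaw lam, Tendsto (tLevel z.2) atTop (𝓝 1) :=
    Measure.quasiMeasurePreserving_snd.ae ae_tendsto_tLevel
  have h6 : ∀ᵐ z ∂jointLaw lam, Function.Injective (stick 1 z.2) :=
    Measure.quasiMeasurePreserving_snd.ae ae_injective_stick
  filter_upwards [h1, h2, h3, h4, h5, h6] with z h1 h2 h3 h4 h5 h6
  exact ⟨h1, h2, h3, h4, h5, h6⟩

lemma hasSum_sub_succ {c : ℕ → ℝ} {x : ℝ} (hc : Monotone c) (h0 : c 0 = 0)
    (h : Tendsto c atTop (𝓝 x)) : HasSum (fun j => c (j + 1) - c j) x := by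
  rw [hasSum_iff_tendsto_nat_of_nonneg fun j => sub_nonneg.2 (hc (Nat.le_succ j))]
  simpa only [Finset.sum_range_sub, h0, sub_zero] using h

namespace Typical

variable {z : ((ℕ → ℝ≥0∞) × (ℕ → ℝ)) × (ℕ → ℝ)}

/-- Every typical collection of atoms comes from an interval partition, so the facts about `dPoint`
and `tPoint` apply to the canonical sequences. -/
lemma config (h : Typical z) : Config
    (fun k => cdfOf z.1.1 z.1.2 (z.1.2 k) - (z.1.1 k).toReal)
    (fun k => cdfOf z.1.1 z.1.2 (z.1.2 k)) z.1.1 z.1.2 :=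
  ⟨h.masses.1, h.masses.2, h.generic, fun _ => rfl, fun _ => rfl⟩

lemma hasSum_dIncs (h : Typical z) : HasSum (fun k => (dIncs z k).1) 1 := by
  have hc := h.config
  have e : ∀ j, dPoint (fun k => cdfOf z.1.1 z.1.2 (z.1.2 k) - (z.1.1 k).toReal)
    (fun k => cdfOf z.1.1 z.1.2 (z.1.2 k)) z.2 j = _ := hc.dPoint_eq h.hits
  have := hasSum_sub_succ (hc.dPoint_strictMono h.hits).monotone rfl
    (hc.tendsto_dPoint h.hits h.mem_Ioo h.tendsto_tLevel)
  simp only [e] at this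
  exact this

lemma hasSum_tIncs_fst (h : Typical z) : HasSum (fun k => (tIncs z k).1) 1 := by
  have hc := h.config
  have e : ∀ j, tPoint (fun k => cdfOf z.1.1 z.1.2 (z.1.2 k)) z.2 j = _ := hc.tPoint_eq h.mem_Ioo
  have := hasSum_sub_succ (hc.tPoint_strictMono h.mem_Ioo).monotone rfl
    (hc.tendsto_tPoint h.mem_Ioo h.tendsto_tLevel)
  simp only [e] at this
  exact this

lemma tIncs_snd (z : ((ℕ → ℝ≥0∞) × (ℕ → ℝ)) × (ℕ → ℝ)) (k : ℕ) :
    (tIncs z k).2 = stick 1 z.2 k := tLevel_succ_sub _ _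

lemma hasSum_tIncs_snd (h : Typical z) : HasSum (fun k => (tIncs z k).2) 1 :=
  hasSum_sub_succ (tLevel_strictMono h.mem_Ioo).monotone (tLevel_zero _) h.tendsto_tLevel

lemma tIncs_fst_pos (h : Typical z) (k : ℕ) : 0 < (tIncs z k).1 := by
  refine sub_pos.2 (strictMonoOn_cdfOf h.masses.1 h.masses.2 h.generic ?_ ?_
    (tLevel_strictMono h.mem_Ioo (Nat.lt_succ_self k)))
  all_goals exact ⟨tLevel_nonneg h.mem_Ioo _, (tLevel_lt_one h.mem_Ioo _).le⟩

lemma rankable (h : Typical z) : Rankable (tIncs z) where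
  injective i j hij := h.injective_stick (by
    rw [← tIncs_snd, ← tIncs_snd, hij])
  pos := h.tIncs_fst_pos
  summable := h.hasSum_tIncs_fst.summable

lemma goodWeights_fst (h : Typical z) : GoodWeights Prod.fst (tIncs z) :=
  ⟨h.rankable, h.tIncs_fst_pos, h.hasSum_tIncs_fst⟩

lemma goodWeights_snd (h : Typical z) : GoodWeights Prod.snd (tIncs z) :=
  ⟨h.rankable, fun k => by
    rw [tIncs_snd]
    exact stick_pos h.mem_Ioo k, h.hasSum_tIncs_snd⟩

end Typical

lemma lintegral_tIncs_biased (hlam : ∀ᵐ L ∂lam, Masses L) (r : ℕ) {f : (Fin r → ℝ × ℝ) → ℝ≥0∞}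
    (hf : Measurable f) :
    ∫⁻ y, f (firstTerms r y) ∂(jointLaw lam).map tIncs =
      ∫⁻ x, injSum r x (fun y => qfac r 1 (fun i => (y i).2) * f y) ∂(jointLaw lam).map tIncs := by
  have hq : Measurable fun y : Fin r → ℝ × ℝ => qsnd r 1 y * f y := (measurable_qsnd 1).mul hf
  have h1 : Measurable fun y : ℕ → ℝ × ℝ => f (firstTerms r y) := hf.comp (measurable_firstTerms r)
  have h2 : Measurable fun x : ℕ → ℝ × ℝ => injSum r x (fun y => qsnd r 1 y * f y) :=
    measurable_injSum (x := fun x => x) (g := fun _ y => qsnd r 1 y * f y) measurable_id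
      (hq.comp measurable_snd)
  change _ = ∫⁻ x, injSum r x (fun y => qsnd r 1 y * f y) ∂(jointLaw lam).map tIncs
  rw [lintegral_map_jointLaw measurable_tIncs h1, lintegral_map_jointLaw measurable_tIncs h2]
  refine lintegral_congr_ae ?_
  filter_upwards [hlam] with L hL
  exact tLevel_biased hL.1 r hf

lemma lintegral_dIncs_biased (hlam : ∀ᵐ L ∂lam, Masses L) (r : ℕ) {f : (Fin r → ℝ × ℝ) → ℝ≥0∞}
    (hf : Measurable f) :
    ∫⁻ y, f (firstTerms r y) ∂(jointLaw lam).map dIncs =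
      ∫⁻ x, injSum r x (fun y => qfac r 1 (fun i => (y i).1) * f y) ∂(jointLaw lam).map tIncs := by
  have hq : Measurable fun y : Fin r → ℝ × ℝ => qfst r 1 y * f y := (measurable_qfst 1).mul hf
  have h1 : Measurable fun y : ℕ → ℝ × ℝ => f (firstTerms r y) := hf.comp (measurable_firstTerms r)
  have h2 : Measurable fun x : ℕ → ℝ × ℝ => injSum r x (fun y => qfst r 1 y * f y) :=
    measurable_injSum (x := fun x => x) (g := fun _ y => qfst r 1 y * f y) measurable_id
      (hq.comp measurable_snd)
  change _ = ∫⁻ x, injSum r x (fun y => qfst r 1 y * f y) ∂(jointLaw lam).map tIncs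
  rw [lintegral_map_jointLaw measurable_dIncs h1, lintegral_map_jointLaw measurable_tIncs h2]
  refine lintegral_congr_ae ?_
  filter_upwards [hlam] with L hL
  exact dChain_biased hL.1 hL.2 r hf

lemma measurable_seq_map {α β : Type*} [MeasurableSpace α] [MeasurableSpace β] {g : α → β}
    (hg : Measurable g) : Measurable fun (x : ℕ → α) j => g (x j) :=
  measurable_pi_iff.2 fun j => hg.comp (measurable_pi_apply j)

lemma map_tIncs_snd [IsProbabilityMeasure lam] : (jointLaw lam).map (fun z j => (tIncs z j).2) = gem 1 := by
  have hs : Measurable (stick 1) := measurable_stick measurable_const measurable_id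
  have e : (fun z j => (tIncs z j).2) = stick 1 ∘ Prod.snd := by
    funext z j
    exact Typical.tIncs_snd z j
  rw [e, ← Measure.map_map hs measurable_snd, ← Measure.snd, jointLaw, Measure.snd_prod, gem_one]

lemma map_dIncs_snd [IsProbabilityMeasure lam] (hlam : ∀ᵐ L ∂lam, Masses L) :
    (jointLaw lam).map (fun z j => (dIncs z j).2) = gem 1 := by
  have hs : Measurable (stick 1) := measurable_stick measurable_const measurable_id
  have hd : Measurable fun z j => (dIncs z j).2 :=
    (measurable_seq_map measurable_snd).comp measurable_dIncs
  have := Measure.isProbabilityMeasure_map (μ := jointLaw lam) hd.aemeasurable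
  rw [gem_one]
  refine ext_of_firstTerms fun r => Measure.ext_of_lintegral _ fun g hg => ?_
  have hgr : Measurable fun y : ℕ → ℝ => g (firstTerms r y) := hg.comp (measurable_firstTerms r)
  rw [lintegral_map hg (measurable_firstTerms r), lintegral_map hg (measurable_firstTerms r),
    lintegral_map hgr hs, lintegral_map_jointLaw hd hgr]
  have e : ∀ᵐ L ∂lam, ∫⁻ X, ∫⁻ U, g (firstTerms r fun j => (dIncs ((L, X), U) j).2)
      ∂unifSeq ∂unifSeq = ∫⁻ U, g (firstTerms r (stick 1 U)) ∂unifSeq := by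
    filter_upwards [hlam] with L hL
    exact lintegral_dChain_snd hL.1 hL.2 r hg
  rw [lintegral_congr_ae e]
  simp

/-- The mean first D-length exceeds the mean first T-length by at least ∫(1 - p) dp times E[L_0²],
and both factors are nonzero. -/
theorem map_dIncs_fst_ne [IsProbabilityMeasure lam] (hlam : ∀ᵐ L ∂lam, Masses L) :
    (jointLaw lam).map (fun z j => (dIncs z j).1) ≠ (jointLaw lam).map fun z j => (tIncs z j).1 := by
  intro h
  have hd : Measurable fun z j => (dIncs z j).1 :=
    (measurable_seq_map measurable_fst).comp measurable_dIncs
  have ht : Measurable fun z j => (tIncs z j).1 :=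
    (measurable_seq_map measurable_fst).comp measurable_tIncs
  have hg : Measurable fun x : ℕ → ℝ => ENNReal.ofReal (x 0) := by fun_prop
  have e : ∫⁻ z, ENNReal.ofReal (dIncs z 0).1 ∂jointLaw lam =
      ∫⁻ z, ENNReal.ofReal (tIncs z 0).1 ∂jointLaw lam := by
    have := congrArg (fun m => ∫⁻ x, ENNReal.ofReal (x 0) ∂m) h
    rwa [lintegral_map hg hd, lintegral_map hg ht] at this
  have hd0 : Measurable fun z => ENNReal.ofReal (dIncs z 0).1 := hg.comp hd
  have ht0 : Measurable fun z => ENNReal.ofReal (tIncs z 0).1 := hg.comp ht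
  rw [lintegral_jointLaw hd0, lintegral_jointLaw ht0] at e
  have eT : ∫⁻ L, ∫⁻ X, ∫⁻ U, ENNReal.ofReal (tIncs ((L, X), U) 0).1 ∂unifSeq ∂unifSeq ∂lam =
      ∫⁻ p in Ioo (0 : ℝ) 1, ENNReal.ofReal p := by
    have : ∀ᵐ L ∂lam, ∫⁻ X, ∫⁻ U, ENNReal.ofReal (tIncs ((L, X), U) 0).1 ∂unifSeq ∂unifSeq =
        ∫⁻ p in Ioo (0 : ℝ) 1, ENNReal.ofReal p := by
      filter_upwards [hlam] with L hL
      exact lintegral_tLevel_fst hL.1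
    rw [lintegral_congr_ae this]
    simp
  have hm0 : Measurable fun L : ℕ → ℝ≥0∞ => L 0 ^ 2 := (measurable_pi_apply 0).pow_const 2
  have eD : (∫⁻ p in Ioo (0 : ℝ) 1, ENNReal.ofReal p) +
      (∫⁻ p in Ioo (0 : ℝ) 1, ENNReal.ofReal (1 - p)) * ∫⁻ L, L 0 ^ 2 ∂lam ≤
      ∫⁻ L, ∫⁻ X, ∫⁻ U, ENNReal.ofReal (dIncs ((L, X), U) 0).1 ∂unifSeq ∂unifSeq ∂lam := by
    have h1 : (∫⁻ p in Ioo (0 : ℝ) 1, ENNReal.ofReal p) +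
        (∫⁻ p in Ioo (0 : ℝ) 1, ENNReal.ofReal (1 - p)) * ∫⁻ L, L 0 ^ 2 ∂lam =
        ∫⁻ L, ((∫⁻ p in Ioo (0 : ℝ) 1, ENNReal.ofReal p) +
          (∫⁻ p in Ioo (0 : ℝ) 1, ENNReal.ofReal (1 - p)) * L 0 ^ 2) ∂lam := by
      rw [lintegral_add_left measurable_const, lintegral_const_mul _ hm0]
      simp
    rw [h1]
    refine lintegral_mono_ae ?_
    filter_upwards [hlam] with L hL
    exact le_lintegral_dChain_fst hL.1 hL.2
  rw [e, eT] at eD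
  have hfin : ∫⁻ p in Ioo (0 : ℝ) 1, ENNReal.ofReal p ≠ ∞ := by
    refine ne_top_of_le_ne_top (b := ∫⁻ p in Ioo (0 : ℝ) 1, 1) (by simp) ?_
    refine setLIntegral_mono measurable_const fun p hp => ?_
    exact ENNReal.ofReal_le_one.2 hp.2.le
  have h0 : (∫⁻ p in Ioo (0 : ℝ) 1, ENNReal.ofReal (1 - p)) * ∫⁻ L, L 0 ^ 2 ∂lam = 0 := by
    have := ENNReal.le_sub_of_add_le_left hfin eD
    simpa using this
  rcases mul_eq_zero.1 h0 with h1 | h1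
  · rw [lintegral_eq_zero_iff (by fun_prop)] at h1
    have h2 : ∀ᵐ p ∂volume.restrict (Ioo (0 : ℝ) 1), False := by
      filter_upwards [h1, ae_restrict_mem measurableSet_Ioo] with p hp hp2
      simp only [Pi.zero_apply, ENNReal.ofReal_eq_zero] at hp
      linarith [hp2.2]
    have h3 := ae_iff.1 h2
    simp at h3
  · rw [lintegral_eq_zero_iff hm0] at h1
    have h2 : ∀ᵐ L ∂lam, False := by
      filter_upwards [h1, hlam] with L h3 h4
      simp only [Pi.zero_apply, ne_eq, OfNat.ofNat_ne_zero, not_false_eq_true, pow_eq_zero_iff] at h3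
      exact h4.2 0 h3
    have h3 := ae_iff.1 h2
    simp at h3

end Canonical

end

/-! ### Transfer from the canonical model to the given partition. -/

section

lemma hasSum_one_iff {f : ℕ → ℝ} (hf : ∀ k, 0 ≤ f k) :
    HasSum f 1 ↔ ∑' k, ENNReal.ofReal (f k) = 1 := by
  constructor
  · intro h
    rw [← ENNReal.ofReal_tsum_of_nonneg hf h.summable, h.tsum_eq, ENNReal.ofReal_one]
  · intro h
    have := ENNReal.hasSum_toReal (f := fun k => ENNReal.ofReal (f k)) (by simp [h])
    rw [← ENNReal.tsum_toReal_eq fun k => ENNReal.ofReal_ne_top, h, ENNReal.toReal_one] at this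
    simpa only [ENNReal.toReal_ofReal (hf _)] using this

/-- Summability and the total are expressed by sums in `ℝ≥0∞`, which are measurable functions of x;
this makes the set of good sequences measurable. -/
lemma goodWeights_iff {w : ℝ × ℝ → ℝ} {x : ℕ → ℝ × ℝ} : GoodWeights w x ↔
    Function.Injective x ∧ ((∀ k, 0 < (x k).1) ∧ ∑' k, ENNReal.ofReal (x k).1 ≠ ∞) ∧
      (∀ k, 0 < w (x k)) ∧ ∑' k, ENNReal.ofReal (w (x k)) = 1 := by
  constructor
  · intro h
    exact ⟨h.injective, ⟨h.pos, h.summable.tsum_ofReal_ne_top⟩, h.weight_pos,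
      (hasSum_one_iff fun k => (h.weight_pos k).le).1 h.weight_hasSum⟩
  · rintro ⟨h1, ⟨h2, h3⟩, h4, h5⟩
    refine ⟨⟨h1, h2, ?_⟩, h4, (hasSum_one_iff fun k => (h4 k).le).2 h5⟩
    simpa only [ENNReal.toReal_ofReal (h2 _).le] using ENNReal.summable_toReal h3

lemma measurableSet_goodWeights {w : ℝ × ℝ → ℝ} (hw : Measurable w) :
    MeasurableSet {x | GoodWeights w x} := by
  have hk : ∀ k, Measurable fun x : ℕ → ℝ × ℝ => x k := measurable_pi_apply
  have hpos : ∀ {v : ℝ × ℝ → ℝ}, Measurable v →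
      MeasurableSet {x : ℕ → ℝ × ℝ | ∀ k, 0 < v (x k)} := fun hv => by
    simp only [Set.ofPred_forall]
    exact MeasurableSet.iInter fun k => measurableSet_lt measurable_const (hv.comp (hk k))
  have hsum : ∀ {v : ℝ × ℝ → ℝ}, Measurable v →
      Measurable fun x : ℕ → ℝ × ℝ => ∑' k, ENNReal.ofReal (v (x k)) := fun hv =>
    Measurable.tsum fun k => (hv.comp (hk k)).ennreal_ofReal
  have hinj : MeasurableSet {x : ℕ → ℝ × ℝ | Function.Injective x} := by
    simp only [Function.Injective, Set.ofPred_forall]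
    refine MeasurableSet.iInter fun i => MeasurableSet.iInter fun j => ?_
    by_cases hij : i = j
    · simp [hij]
    · simp only [hij, imp_false]
      exact (measurableSet_eq_fun (hk i) (hk j)).compl
  simp only [goodWeights_iff]
  exact hinj.inter (((hpos measurable_fst).inter
    (measurableSet_eq_fun (hsum measurable_fst) measurable_const).compl).inter
      ((hpos hw).inter (measurableSet_eq_fun (hsum hw) measurable_const)))

section Canonical

variable {lam : Measure (ℕ → ℝ≥0∞)}

lemma ae_goodWeights_tIncs (hlam : ∀ᵐ L ∂lam, Masses L) :
    (∀ᵐ x ∂(jointLaw lam).map tIncs, GoodWeights Prod.fst x) ∧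
      ∀ᵐ x ∂(jointLaw lam).map tIncs, GoodWeights Prod.snd x := by
  rw [ae_map_iff measurable_tIncs.aemeasurable (measurableSet_goodWeights measurable_fst),
    ae_map_iff measurable_tIncs.aemeasurable (measurableSet_goodWeights measurable_snd)]
  constructor
  · filter_upwards [ae_typical hlam] with z hz using hz.goodWeights_fst
  · filter_upwards [ae_typical hlam] with z hz using hz.goodWeights_snd

lemma ae_hasSum_dIncs (hlam : ∀ᵐ L ∂lam, Masses L) :
    ∀ᵐ y ∂(jointLaw lam).map dIncs, HasSum (fun k => (y k).1) 1 := by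
  have hk : ∀ k, Measurable fun y : ℕ → ℝ × ℝ => (y k).1 := fun k =>
    measurable_fst.comp (measurable_pi_apply k)
  have h : ∀ᵐ y ∂(jointLaw lam).map dIncs,
      (∀ k, 0 ≤ (y k).1) ∧ ∑' k, ENNReal.ofReal (y k).1 = 1 := by
    rw [ae_map_iff measurable_dIncs.aemeasurable]
    · filter_upwards [ae_typical hlam] with z hz
      have h0 : ∀ k, 0 ≤ (dIncs z k).1 := fun k =>
        sub_nonneg.2 (cdfOf_mono hz.masses.1 _ (hz.config.chain_lt_succ hz.hits k).le)
      exact ⟨h0, (hasSum_one_iff h0).1 hz.hasSum_dIncs⟩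
    · have h1 : MeasurableSet {y : ℕ → ℝ × ℝ | ∀ k, 0 ≤ (y k).1} := by
        simp only [Set.ofPred_forall]
        exact MeasurableSet.iInter fun k => measurableSet_le measurable_const (hk k)
      exact h1.inter
        (measurableSet_eq_fun (Measurable.tsum fun k => (hk k).ennreal_ofReal) measurable_const)
  filter_upwards [h] with y hy using (hasSum_one_iff hy.1).2 hy.2

end Canonical

section Transfer

variable {Ω : Type*} [MeasurableSpace Ω] {μ : Measure Ω}

lemma inBiasedOrder_of_map {w : ℝ × ℝ → ℝ} (hw : Measurable w) {X : Ω → ℕ → ℝ × ℝ}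
    (hX : AEMeasurable X μ)
    (h : ∀ (n : ℕ) (k : Fin n → ℕ), Function.Injective k → ∀ B : Set (ℕ → ℝ × ℝ), MeasurableSet B →
      μ.map X ({y | ∀ i : Fin n, rankOf y i = k i} ∩ {y | ranked y ∈ B}) =
        ∫⁻ y in {y | ranked y ∈ B}, ENNReal.ofReal (biasedProb w (ranked y) k) ∂μ.map X) :
    InBiasedOrder μ w X := by
  intro n k hk B hB
  have hmR : MeasurableSet {y : ℕ → ℝ × ℝ | ∀ i : Fin n, rankOf y i = k i} := by
    simp only [Set.ofPred_forall]
    exact MeasurableSet.iInter fun i => measurableSet_eq_fun (measurable_rankOf _) measurable_const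
  have hmB : MeasurableSet {y : ℕ → ℝ × ℝ | ranked y ∈ B} := measurable_ranked hB
  have hF : Measurable fun y => ENNReal.ofReal (biasedProb w (ranked y) k) :=
    ((measurable_biasedProb hw k).comp measurable_ranked).ennreal_ofReal
  have := h n k hk B hB
  rw [Measure.map_apply_of_aemeasurable hX (hmR.inter hmB),
    Measure.restrict_map_of_aemeasurable hX hmB,
    lintegral_map' hF.aemeasurable hX.restrict] at this
  exact this

lemma IsInfiniteExchangeable.exchOrder {a b : ℕ → Ω → ℝ} (hex : IsInfiniteExchangeable μ a b) :
    ExchOrder μ (fun k ω => b k ω - a k ω) a where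
  measurable_mark k := (hex.measurable_right k).sub (hex.measurable_left k)
  measurable_point := hex.measurable_left
  injective := by
    filter_upwards [hex.subset_unit, hex.disjoint] with ω h1 h2 k l hkl
    by_contra hne
    have h3 := Set.Ioo_disjoint_Ioo.1 (h2 hne)
    have hkl' : a k ω = a l ω := hkl
    rw [hkl', max_self] at h3
    rcases min_le_iff.1 h3 with h | h
    · linarith [(h1 k).2.1]
    · linarith [(h1 l).2.1]
  exchangeable := hex.exchangeable

/-- The lengths of the intervals. -/
def lens (a b : ℕ → Ω → ℝ) (ω : Ω) (k : ℕ) : ℝ≥0∞ := ENNReal.ofReal (b k ω - a k ω)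

/-- The local times at the intervals. -/
def levels (a b : ℕ → Ω → ℝ) (ω : Ω) : ℕ → ℝ :=
  codeLevel (orderCode (fun k => b k ω - a k ω) fun k => a k ω)

variable {a b : ℕ → Ω → ℝ}

lemma IsInfiniteExchangeable.measurable_lens (hex : IsInfiniteExchangeable μ a b) :
    Measurable (lens a b) :=
  measurable_pi_iff.2 fun k =>
    ((hex.measurable_right k).sub (hex.measurable_left k)).ennreal_ofReal

lemma IsInfiniteExchangeable.measurable_levels (hex : IsInfiniteExchangeable μ a b) :
    Measurable (levels a b) :=
  measurable_codeLevel.comp (measurable_orderCode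
    (measurable_pi_iff.2 fun k => (hex.measurable_right k).sub (hex.measurable_left k))
    (measurable_pi_iff.2 hex.measurable_left))

lemma IsInfiniteExchangeable.map_lens_levels [IsProbabilityMeasure μ]
    (hex : IsInfiniteExchangeable μ a b) :
    μ.map (fun ω => (lens a b ω, levels a b ω)) = (μ.map (lens a b)).prod unifSeq := by
  have hl : Measurable fun ω k => b k ω - a k ω :=
    measurable_pi_iff.2 fun k => (hex.measurable_right k).sub (hex.measurable_left k)
  have hp := Measure.isProbabilityMeasure_map (μ := μ) hl.aemeasurable
  have hT : Measurable fun (x : ℕ → ℝ) k => ENNReal.ofReal (x k) :=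
    measurable_seq_map ENNReal.measurable_ofReal
  have h := congrArg (Measure.map (Prod.map (fun (x : ℕ → ℝ) k => ENNReal.ofReal (x k)) id))
    hex.exchOrder.map_levels
  have hl' : Measurable fun ω => ((fun k => b k ω - a k ω),
      codeLevel (orderCode (fun k => b k ω - a k ω) fun k => a k ω)) :=
    hl.prodMk hex.measurable_levels
  rw [Measure.map_map (hT.prodMap measurable_id) hl', ← Measure.map_prod_map _ _ hT measurable_id, Measure.map_map hT hl, Measure.map_id] at h
  exact h

lemma IsInfiniteExchangeable.ae_config [IsProbabilityMeasure μ]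
    (hex : IsInfiniteExchangeable μ a b) :
    ∀ᵐ ω ∂μ, Config (fun k => a k ω) (fun k => b k ω) (lens a b ω) (levels a b ω) := by
  have hlaw : μ.map (levels a b) = unifSeq := by
    have hp := Measure.isProbabilityMeasure_map (μ := μ) hex.measurable_lens.aemeasurable
    have h := congrArg (Measure.map Prod.snd) hex.map_lens_levels
    rwa [Measure.map_map measurable_snd (hex.measurable_lens.prodMk hex.measurable_levels),
      ← Measure.snd, Measure.snd_prod] at h
  have hgen : ∀ᵐ ω ∂μ, Generic (levels a b ω) := by
    refine ae_of_ae_map hex.measurable_levels.aemeasurable ?_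
    rw [hlaw]
    exact ae_generic
  filter_upwards [hex.subset_unit, hex.disjoint, hex.total, hgen, hex.exchOrder.injective] with
    ω h1 h2 h3 h4 h5
  refine config_of_partition h1 h2 h3 h4 fun k l hkl => ?_
  -- Monotonicity of the local time gives only a weak inequality between levels; it is strict
  -- because generic levels are distinct.
  refine lt_of_le_of_ne ?_ fun h => hkl.ne (congrArg (fun k => a k ω) (h4.injective h))
  simp only [levels, codeLevel_orderCode h5]
  exact localTime_mono _ hkl.le

lemma IsInfiniteExchangeable.ae_masses [IsProbabilityMeasure μ]
    (hex : IsInfiniteExchangeable μ a b) : ∀ᵐ L ∂μ.map (lens a b), Masses L := by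
  have hm : MeasurableSet {L : ℕ → ℝ≥0∞ | Masses L} := by
    have h1 : MeasurableSet {L : ℕ → ℝ≥0∞ | ∑' k, L k = 1} :=
      measurableSet_eq_fun (Measurable.tsum measurable_pi_apply) measurable_const
    have h2 : MeasurableSet {L : ℕ → ℝ≥0∞ | ∀ k, L k ≠ 0} := by
      simp only [Set.ofPred_forall]
      exact MeasurableSet.iInter fun k =>
        (measurableSet_eq_fun (measurable_pi_apply k) measurable_const).compl
    exact h1.inter h2
  rw [ae_map_iff hex.measurable_lens.aemeasurable hm]
  filter_upwards [hex.ae_config] with ω h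
  exact ⟨h.tsum_eq, h.ne_zero⟩

variable {U : ℕ → Ω → ℝ}

lemma aemeasurable_unif (hU : ∀ j, HasLaw (U j) (volume.restrict (Set.Ioo (0 : ℝ) 1)) μ) :
    AEMeasurable (fun ω j => U j ω) μ :=
  aemeasurable_pi_iff.2 fun j => (hU j).aemeasurable

lemma map_unif (hU : ∀ j, HasLaw (U j) (volume.restrict (Set.Ioo (0 : ℝ) 1)) μ)
    (hindep : iIndepFun U μ) : μ.map (fun ω j => U j ω) = unifSeq :=
  (hindep.hasLaw_infinitePi hU (aemeasurable_unif hU)).map_eq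

lemma IsInfiniteExchangeable.map_joint [IsProbabilityMeasure μ]
    (hex : IsInfiniteExchangeable μ a b)
    (hU : ∀ j, HasLaw (U j) (volume.restrict (Set.Ioo (0 : ℝ) 1)) μ) (hindep : iIndepFun U μ)
    (hUI : IndepFun (fun ω (k : ℕ) => (a k ω, b k ω)) (fun ω (j : ℕ) => U j ω) μ) :
    μ.map (fun ω => ((lens a b ω, levels a b ω), fun j => U j ω)) =
      jointLaw (μ.map (lens a b)) := by
  have hpair : Measurable fun (x : ℕ → ℝ × ℝ) => ((fun k => ENNReal.ofReal ((x k).2 - (x k).1)),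
      codeLevel (orderCode (fun k => (x k).2 - (x k).1) fun k => (x k).1)) := by
    have h1 := measurable_seq_map (α := ℝ × ℝ) measurable_fst
    have h2 : Measurable fun (x : ℕ → ℝ × ℝ) k => (x k).2 - (x k).1 :=
      measurable_seq_map (measurable_snd.sub measurable_fst)
    exact ((measurable_seq_map ENNReal.measurable_ofReal).comp h2).prodMk
      (measurable_codeLevel.comp (measurable_orderCode h2 h1))
  have hi : IndepFun (fun ω => (lens a b ω, levels a b ω)) (fun ω j => U j ω) μ :=
    hUI.comp hpair measurable_id
  rw [(indepFun_iff_map_prod_eq_prod_map_map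
    (hex.measurable_lens.prodMk hex.measurable_levels).aemeasurable (aemeasurable_unif hU)).1 hi,
    map_unif hU hindep, hex.map_lens_levels, jointLaw]

end Transfer

end

end ExchPart

end

open ExchPart
theorem theorem4 {Ω : Type*} [MeasurableSpace Ω] (μ : Measure Ω) [IsProbabilityMeasure μ]
    (a b : ℕ → Ω → ℝ) (hex : IsInfiniteExchangeable μ a b)
    (U : ℕ → Ω → ℝ) (hU : ∀ j, HasLaw (U j) (volume.restrict (Set.Ioo (0 : ℝ) 1)) μ)
    (hindep : iIndepFun U μ)
    (hUI : IndepFun (fun ω (k : ℕ) => (a k ω, b k ω)) (fun ω (j : ℕ) => U j ω) μ)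
    (XD XT : Ω → ℕ → ℝ × ℝ)
    (hXD : XD = fun ω => dSeq (fun k => a k ω) (fun k => b k ω) (fun j => U j ω))
    (hXT : XT = fun ω => tSeq (fun k => b k ω) (fun j => U j ω)) :
    -- the normalized local time exists as a limit and is continuous
    (∀ᵐ ω ∂μ, ContinuousOn (localTime fun k => b k ω) (Set.Icc 0 1) ∧
      ∀ u ∈ Set.Icc (0 : ℝ) 1,
        Tendsto (fracLeft (fun k => b k ω) u) atTop (𝓝 (localTime (fun k => b k ω) u))) ∧
    -- both sequences of division points increase strictly to 1
    (∀ᵐ ω ∂μ, StrictMono (dPoint (fun k => a k ω) (fun k => b k ω) (fun j => U j ω)) ∧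
      Tendsto (dPoint (fun k => a k ω) (fun k => b k ω) (fun j => U j ω)) atTop (𝓝 1)) ∧
    (∀ᵐ ω ∂μ, StrictMono (tPoint (fun k => b k ω) (fun j => U j ω)) ∧
      Tendsto (tPoint (fun k => b k ω) (fun j => U j ω)) atTop (𝓝 1)) ∧
    AEMeasurable XD μ ∧ AEMeasurable XT μ ∧
    -- (i) the length-ranked bivariate sequences have the same distribution
    IdentDistrib (fun ω => ranked (XD ω)) (fun ω => ranked (XT ω)) μ μ ∧
    -- (ii) the D-sequence is in length-biased order
    InBiasedOrder μ Prod.fst XD ∧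
    -- (iii) the T-sequence is in local-time-biased order
    InBiasedOrder μ Prod.snd XT ∧
    -- (iv) same law of the local time sequences, different laws of the length sequences
    IdentDistrib (fun ω j => (XD ω j).2) (fun ω j => (XT ω j).2) μ μ ∧
    μ.map (fun ω j => (XD ω j).1) ≠ μ.map (fun ω j => (XT ω j).1) ∧
    -- the local time sequences have the GEM(1) distribution
    HasLaw (fun ω j => (XD ω j).2) (gem 1) μ ∧
    HasLaw (fun ω j => (XT ω j).2) (gem 1) μ := by
  -- Z has the law of the canonical model, and XD and XT agree almost surely with measurable
  -- functions of Z, which gives their almost everywhere measurability and their laws.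
  set Z : Ω → ((ℕ → ℝ≥0∞) × (ℕ → ℝ)) × (ℕ → ℝ) :=
    fun ω => ((lens a b ω, levels a b ω), fun j => U j ω) with hZ
  set lam := μ.map (lens a b) with hlamdef
  have hlamP : IsProbabilityMeasure lam :=
    Measure.isProbabilityMeasure_map hex.measurable_lens.aemeasurable
  have hZm : AEMeasurable Z μ :=
    (hex.measurable_lens.prodMk hex.measurable_levels).aemeasurable.prodMk (aemeasurable_unif hU)
  have hlaw : μ.map Z = jointLaw lam := hex.map_joint hU hindep hUI
  have hlam : ∀ᵐ L ∂lam, Masses L := hex.ae_masses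
  have hconf := hex.ae_config
  have htyp : ∀ᵐ ω ∂μ, Typical (Z ω) := by
    refine ae_of_ae_map hZm ?_
    rw [hlaw]
    exact ae_typical hlam
  have hD : XD =ᵐ[μ] dIncs ∘ Z := by
    filter_upwards [hconf, htyp] with ω h1 h2
    rw [hXD]
    exact h1.dSeq_eq h2.hits
  have hT : XT =ᵐ[μ] tIncs ∘ Z := by
    filter_upwards [hconf, htyp] with ω h1 h2
    rw [hXT]
    exact h1.tSeq_eq h2.mem_Ioo
  have hDm : AEMeasurable XD μ := (measurable_dIncs.comp_aemeasurable hZm).congr hD.symm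
  have hTm : AEMeasurable XT μ := (measurable_tIncs.comp_aemeasurable hZm).congr hT.symm
  have hDl : μ.map XD = (jointLaw lam).map dIncs := by
    rw [Measure.map_congr hD, ← hlaw,
      AEMeasurable.map_map_of_aemeasurable measurable_dIncs.aemeasurable hZm]
  have hTl : μ.map XT = (jointLaw lam).map tIncs := by
    rw [Measure.map_congr hT, ← hlaw,
      AEMeasurable.map_map_of_aemeasurable measurable_tIncs.aemeasurable hZm]
  have hcompD : ∀ {β : Type} [MeasurableSpace β] (g : (ℕ → ℝ × ℝ) → β), Measurable g →
      μ.map (fun ω => g (XD ω)) = (jointLaw lam).map fun z => g (dIncs z) := fun g hg => by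
    rw [← Function.comp_def, ← AEMeasurable.map_map_of_aemeasurable hg.aemeasurable hDm, hDl,
      Measure.map_map hg measurable_dIncs, Function.comp_def]
  have hcompT : ∀ {β : Type} [MeasurableSpace β] (g : (ℕ → ℝ × ℝ) → β), Measurable g →
      μ.map (fun ω => g (XT ω)) = (jointLaw lam).map fun z => g (tIncs z) := fun g hg => by
    rw [← Function.comp_def, ← AEMeasurable.map_map_of_aemeasurable hg.aemeasurable hTm, hTl,
      Measure.map_map hg measurable_tIncs, Function.comp_def]
  have hPD : IsProbabilityMeasure ((jointLaw lam).map dIncs) :=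
    Measure.isProbabilityMeasure_map measurable_dIncs.aemeasurable
  have hPT : IsProbabilityMeasure ((jointLaw lam).map tIncs) :=
    Measure.isProbabilityMeasure_map measurable_tIncs.aemeasurable
  obtain ⟨hfst, hsnd⟩ := ae_goodWeights_tIncs hlam
  have hDsum := ae_hasSum_dIncs hlam
  have hTsum : ∀ᵐ y ∂(jointLaw lam).map tIncs, HasSum (fun k => (y k).2) 1 := by
    filter_upwards [hsnd] with y hy using hy.weight_hasSum
  have hDbias := fun (r : ℕ) (f : (Fin r → ℝ × ℝ) → ℝ≥0∞) (hf : Measurable f) =>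
    lintegral_dIncs_biased hlam r hf
  have hTbias := fun (r : ℕ) (f : (Fin r → ℝ × ℝ) → ℝ≥0∞) (hf : Measurable f) =>
    lintegral_tIncs_biased hlam r hf
  have hms := measurable_seq_map (α := ℝ × ℝ) measurable_snd
  have hmf := measurable_seq_map (α := ℝ × ℝ) measurable_fst
  have hgemD : μ.map (fun ω j => (XD ω j).2) = gem 1 :=
    (hcompD _ hms).trans (map_dIncs_snd hlam)
  have hgemT : μ.map (fun ω j => (XT ω j).2) = gem 1 := (hcompT _ hms).trans map_tIncs_snd
  refine ⟨?_, ?_, ?_, hDm, hTm, ⟨measurable_ranked.comp_aemeasurable hDm,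
    measurable_ranked.comp_aemeasurable hTm, ?_⟩, ?_, ?_, ⟨hms.comp_aemeasurable hDm,
    hms.comp_aemeasurable hTm, hgemD.trans hgemT.symm⟩, ?_, ⟨hms.comp_aemeasurable hDm, hgemD⟩,
    ⟨hms.comp_aemeasurable hTm, hgemT⟩⟩
  · filter_upwards [hconf] with ω h
    exact ⟨h.continuous_localTime.continuousOn, fun u hu => h.tendsto_fracLeft hu⟩
  · filter_upwards [hconf, htyp] with ω h1 h2
    exact ⟨h1.dPoint_strictMono h2.hits, h1.tendsto_dPoint h2.hits h2.mem_Ioo h2.tendsto_tLevel⟩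
  · filter_upwards [hconf, htyp] with ω h1 h2
    exact ⟨h1.tPoint_strictMono h2.mem_Ioo, h1.tendsto_tPoint h2.mem_Ioo h2.tendsto_tLevel⟩
  · rw [hcompD _ measurable_ranked, hcompT _ measurable_ranked]
    have h := map_ranked_eq measurable_fst hfst hDsum hDbias
    rwa [Measure.map_map measurable_ranked measurable_dIncs,
      Measure.map_map measurable_ranked measurable_tIncs] at h
  · refine inBiasedOrder_of_map measurable_fst hDm ?_
    rw [hDl]
    exact biased_of_lintegral_eq measurable_fst hfst hDsum hDbias
  · refine inBiasedOrder_of_map measurable_snd hTm ?_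
    rw [hTl]
    exact biased_of_lintegral_eq measurable_snd hsnd hTsum hTbias
  · rw [hcompD _ hmf, hcompT _ hmf]
    exact map_dIncs_fst_ne hlam
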